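/- **Setting.** For $f\in\mathcal S'(\mathbb R^3)$ with values in $\mathbb C^3$ write $\hat f(\xi)=(2\pi)^{-3}\int e^{-ix\cdot\xi}f(x)\,dx$, so that $\partial_k$ has the symbol $i\xi_k$ and the transform of a product is the convolution of the transforms. Fix a real-valued radially symmetric Schwartz function $\varphi$ on $\mathbb R^3$ supported in $\{3/4\le|\xi|\le 8/3\}$ with $\sum_{j\in\mathbb Z}\varphi(2^{-j}\xi)=1$ for $\xi\ne0$, and put $\varphi_j(\xi)=\varphi(2^{-j}\xi)$. The space $\dot{FB}^s_{p,q}$ consists of the tempered vector fields $f$ with $\hat f\in L^1_{loc}$ and $$\|f\|_{\dot{FB}^s_{p,q}}=\big\|\,2^{js}\|\varphi_j\hat f\|_{L^p}\,\big\|_{\ell^q(\mathbb Z)}<\infty .$$ With $I=(0,\infty)$, $\mathcal L^\infty(I;\dot{FB}^s_{p,q})$ consists of the Bochner measurable $u:I\to\dot{FB}^s_{p,q}$ with $$\|u\|_{\mathcal L^\infty(I;\dot{FB}^s_{p,q})}=\big\|\,2^{js}\,\|\,\|\varphi_j\hat u(t)\|_{L^p}\|_{L^\infty(I)}\big\|_{\ell^q(\mathbb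 Z)}<\infty ;$$ functions that agree for almost every $t$ are identified. Let $\nu>0$, $\Omega\in\mathbb R$. The fractional Navier–Stokes–Coriolis system is $$\partial_tu+\nu(-\Delta)^\alpha u+u\cdot\nabla u+\Omega e_3\times u+\nabla p=F,\qquad \operatorname{div}u=0,\qquad u(0)=u_0 .$$ Its linear semigroup $S(t)=S^\alpha_\Omega(t)$ has the symbol $$\hat S(t,\xi)=\cos\!\Big(\Omega t\tfrac{\xi_3}{|\xi|}\Big)e^{-\nu|\xi|^{2\alpha}t}\,\mathrm{Id}+\sin\!\Big(\Omega t\tfrac{\xi_3}{|\xi|}\Big)e^{-\nu|\xi|^{2\alpha}t}R(\xi),\qquad R(\xi)=\frac1{|\xi|}\begin{pmatrix}0&\xi_3&-\xi_2\\-\xi_3&0&\xi_1\\ \xi_2&-\xi_1&0\end{pmatrix},$$ $\mathbb P$ is the Leray projector, with symbol $\delta_{mk}-\xi_m\xi_k/|\xi|^2$, and $$[B(v,w)]^\wedge(\xi,t)=-\int_0^t\hat S(t-\tau,\xi)\,\hat{\mathbb P}(\xi)\,\big[i\xi\cdot(v\otimes w)^\wedge(\xi,\tau)\big]\,d\tau,\qquad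 (v\otimes w)^\wedge_{mk}=\hat v_m*\hat w_k .$$ A global mild solution with data $(u_0,F)$ is a $u\in\mathcal X$ ($\mathcal X$ as below) that satisfies $$u(t)=S(t)u_0+B(u,u)(t)+\int_0^tS(t-\tau)\mathbb PF(\tau)\,d\tau ,$$ in Fourier variables, for almost every $t\in I$ and almost every $\xi\in\mathbb R^3$, all the integrals converging absolutely. **Theorem 1.** Let $\nu>0$, $1<p\le\infty$, $1\le q\le\infty$, $\frac12<\alpha<\frac14\big(5-\frac3p\big)$, and put $\mathcal X=\mathcal L^\infty(I;\dot{FB}^{4-2\alpha-3/p}_{p,q})$. There are constants $K>0$ and $C>0$, independent of the Coriolis parameter $\Omega$, such that, for every $\Omega\in\mathbb R$, $B$ is defined on $\mathcal X\times\mathcal X$ with values in $\mathcal X$ and $$\|B(v,w)\|_{\mathcal X}\le K\|v\|_{\mathcal X}\|w\|_{\mathcal X},$$ and such that the following holds for every $0<\varepsilon<\frac1{4K}$ and every $\Omega\in\mathbb R$. 1. If $u_0\in\dot{FB}^{4-2\alpha-3/p}_{p,q}$ and $F\in\mathcal L^\infty(I;\dot{FB}^{4-4\alpha-3/p}_{p,q})$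 satisfy $$C\Big(\|u_0\|_{\dot{FB}^{4-2\alpha-3/p}_{p,q}}+\|F\|_{\mathcal L^\infty(I;\dot{FB}^{4-4\alpha-3/p}_{p,q})}\Big)<\varepsilon ,$$ then the system has a global mild solution $u\in\mathcal X$ with $\|u\|_{\mathcal X}\le2\varepsilon$, and it is the only global mild solution in the ball $\{u\in\mathcal X:\|u\|_{\mathcal X}\le2\varepsilon\}$. 2. These solutions depend continuously on the data: if $(u_0,F)$ and $(v_0,G)$ both satisfy this smallness condition and $u,v$ are the corresponding solutions in the ball, then $$\|u-v\|_{\mathcal X}\le\frac{C}{1-4K\varepsilon}\Big(\|u_0-v_0\|_{\dot{FB}^{4-2\alpha-3/p}_{p,q}}+\|F-G\|_{\mathcal L^\infty(I;\dot{FB}^{4-4\alpha-3/p}_{p,q})}\Big).$$ -/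

import Mathlib

open MeasureTheory Filter Topology Set
open scoped ENNReal SchwartzMap FourierTransform

noncomputable section

namespace FNSC

/-- Physical space and frequency space `ℝ³`. -/
abbrev E3 := EuclideanSpace ℝ (Fin 3)

/-- Values of vector fields, `ℂ³`. -/
abbrev C3 := EuclideanSpace ℂ (Fin 3)

/-! ### Fourier-Besov spaces -/

/-- A radially symmetric Schwartz function `φ` supported in `3/4 ≤ |ξ| ≤ 8/3` such that
`∑_{j ∈ ℤ} φ(2^{-j} ξ) = 1` for `ξ ≠ 0`. -/
structure DyadicPartition where
  /-- the generating function -/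
  φ : 𝓢(E3, ℝ)
  radial : ∀ ξ η : E3, ‖ξ‖ = ‖η‖ → φ ξ = φ η
  supp : Function.support φ ⊆ {ξ : E3 | 3 / 4 ≤ ‖ξ‖ ∧ ‖ξ‖ ≤ 8 / 3}
  sum_eq_one : ∀ ξ : E3, ξ ≠ 0 → HasSum (fun j : ℤ => φ ((2 : ℝ) ^ (-j) • ξ)) 1

/-- The dyadic piece `φ_j(ξ) = φ(2^{-j} ξ)`. -/
def DyadicPartition.piece (P : DyadicPartition) (j : ℤ) (ξ : E3) : ℝ :=
  P.φ ((2 : ℝ) ^ (-j) • ξ)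

/-- The Fourier transform of the tempered vector field `f` is the locally integrable function
`g = f̂`.  The normalization is `f̂(ξ) = (2π)⁻³ ∫ exp(-i x·ξ) f(x) dx`, the one for which
`∂_k` has the symbol `i ξ_k` and the transform of a product is the convolution of the transforms
(without a constant).  In terms of Mathlib's transform `𝓕` (kernel `exp(-2πi x·η)`), this is
`g(ξ) = (2π)⁻³ (𝓕 f)(ξ / 2π)`; the identity below is this relation tested against compactly
supported smooth functions. -/
def HasFourierDensity (f : 𝓢'(E3, C3)) (g : E3 → C3) : Prop :=
  LocallyIntegrable g volume ∧
    ∀ ψ : 𝓢(E3, ℂ), HasCompactSupport ψ →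
      (𝓕 f) ψ = ∫ ξ, ψ ((2 * Real.pi)⁻¹ • ξ) • g ξ

/-- `‖φ_j f̂‖_{L^p}`.  The function `f̂` is unique up to null sets, so that the infimum is over
equal numbers; it is `∞` if `f̂` is not a locally integrable function. -/
def blockNorm (P : DyadicPartition) (p : ℝ≥0∞) (j : ℤ) (f : 𝓢'(E3, C3)) : ℝ≥0∞ :=
  ⨅ (g : E3 → C3) (_ : HasFourierDensity f g), eLpNorm (fun ξ => P.piece j ξ • g ξ) p volume

/-- The weighted sequence norm `‖(2^{js} a_j)_j‖_{ℓ^q(ℤ)}`. -/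
def weightedSeqNorm (s : ℝ) (q : ℝ≥0∞) (a : ℤ → ℝ≥0∞) : ℝ≥0∞ :=
  eLpNorm (fun j : ℤ => (2 : ℝ≥0∞) ^ ((j : ℝ) * s) * a j) q Measure.count

/-- The norm of the homogeneous Fourier-Besov space `FḂ^s_{p,q}(ℝ³)`; the space consists of the
tempered vector fields for which it is finite. -/
def fbNorm (P : DyadicPartition) (s : ℝ) (p q : ℝ≥0∞) (f : 𝓢'(E3, C3)) : ℝ≥0∞ :=
  weightedSeqNorm s q (fun j => blockNorm P p j f)

/-! ### Time-dependent spaces on `I = (0, ∞)` -/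

/-- Lebesgue measure on `I = (0, ∞)`. -/
def timeMeasure : Measure ℝ := volume.restrict (Ioi 0)

/-- Bochner (strong) measurability of `u : I → FḂ^s_{p,q}`: for almost every `t` the value
`u(t)` is the limit, in the norm of `FḂ^s_{p,q}`, of measurable functions with finitely many
values in `FḂ^s_{p,q}`. -/
def BochnerMeasurable (P : DyadicPartition) (s : ℝ) (p q : ℝ≥0∞) (u : ℝ → 𝓢'(E3, C3)) : Prop :=
  ∃ S : ℕ → SimpleFunc ℝ 𝓢'(E3, C3),
    (∀ n t, fbNorm P s p q (S n t) < ∞) ∧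
    ∀ᵐ t ∂timeMeasure, Tendsto (fun n => fbNorm P s p q (S n t - u t)) atTop (𝓝 0)

/-- The norm of `𝓛^∞(I; FḂ^s_{p,q})`, i.e. the `ℓ^q`-norm of
`2^{js} ‖ ‖φ_j û(t)‖_{L^p} ‖_{L^∞(I)}`. -/
def timeNorm (P : DyadicPartition) (s : ℝ) (p q : ℝ≥0∞) (u : ℝ → 𝓢'(E3, C3)) : ℝ≥0∞ :=
  weightedSeqNorm s q (fun j => eLpNorm (fun t => blockNorm P p j (u t)) ∞ timeMeasure)

/-- Membership in `𝓛^∞(I; FḂ^s_{p,q})`. -/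
def MemTime (P : DyadicPartition) (s : ℝ) (p q : ℝ≥0∞) (u : ℝ → 𝓢'(E3, C3)) : Prop :=
  BochnerMeasurable P s p q u ∧ timeNorm P s p q u < ∞

/-! ### The Stokes-Coriolis semigroup, the bilinear term and mild solutions -/

/-- The matrix `R(ξ)`. -/
def rotMatrix (ξ : E3) : Matrix (Fin 3) (Fin 3) ℂ :=
  ((‖ξ‖⁻¹ : ℝ) : ℂ) •
    !![0, (ξ 2 : ℂ), -(ξ 1 : ℂ);
       -(ξ 2 : ℂ), 0, (ξ 0 : ℂ);
       (ξ 1 : ℂ), -(ξ 0 : ℂ), 0]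

/-- The symbol of the semigroup,
`cos(Ω t ξ₃/|ξ|) exp(-ν t |ξ|^{2α}) I + sin(Ω t ξ₃/|ξ|) exp(-ν t |ξ|^{2α}) R(ξ)`. -/
def semigroupSymbol (ν α Ω t : ℝ) (ξ : E3) : Matrix (Fin 3) (Fin 3) ℂ :=
  ((Real.cos (Ω * t * (ξ 2 / ‖ξ‖)) * Real.exp (-(ν * t * ‖ξ‖ ^ (2 * α))) : ℝ) : ℂ) •
      (1 : Matrix (Fin 3) (Fin 3) ℂ) +
    ((Real.sin (Ω * t * (ξ 2 / ‖ξ‖)) * Real.exp (-(ν * t * ‖ξ‖ ^ (2 * α))) : ℝ) : ℂ) •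
      rotMatrix ξ

/-- The symbol of the Leray projector, `δ_{mk} - ξ_m ξ_k / |ξ|²`. -/
def leraySymbol (ξ : E3) : Matrix (Fin 3) (Fin 3) ℂ :=
  Matrix.of fun m k => (if m = k then 1 else 0) - ((ξ m * ξ k / ‖ξ‖ ^ 2 : ℝ) : ℂ)

/-- The action of a matrix on `ℂ³`. -/
def act (A : Matrix (Fin 3) (Fin 3) ℂ) (v : C3) : C3 := WithLp.toLp 2 (A.mulVec v.ofLp)

/-- The transform of `v ⊗ w` at a fixed time: the convolutions `v̂_m * ŵ_k`. -/
def tensorHat (V W : E3 → C3) (ξ : E3) : Matrix (Fin 3) (Fin 3) ℂ :=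
  Matrix.of fun m k => ∫ η, V η m * W (ξ - η) k

/-- `i ξ · (v ⊗ w)^`, the transform of `∇ · (v ⊗ w)`. -/
def divTensorHat (V W : E3 → C3) (ξ : E3) : C3 :=
  WithLp.toLp 2 fun k => Complex.I * ∑ m, (ξ m : ℂ) * tensorHat V W ξ m k

/-- `τ ↦ Ŝ(t - τ, ξ) P̂(ξ) G(τ, ξ)`. -/
def duhamelIntegrand (ν α Ω : ℝ) (G : ℝ → E3 → C3) (t : ℝ) (ξ : E3) (τ : ℝ) : C3 :=
  act (semigroupSymbol ν α Ω (t - τ) ξ) (act (leraySymbol ξ) (G τ ξ))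

/-- `∫₀ᵗ Ŝ(t - τ, ξ) P̂(ξ) G(τ, ξ) dτ`. -/
def duhamelHat (ν α Ω : ℝ) (G : ℝ → E3 → C3) (t : ℝ) (ξ : E3) : C3 :=
  ∫ τ in Ioo 0 t, duhamelIntegrand ν α Ω G t ξ τ

/-- The integrals in `duhamelHat` converge absolutely. -/
def DuhamelConverges (ν α Ω : ℝ) (G : ℝ → E3 → C3) : Prop :=
  ∀ᵐ t ∂timeMeasure, ∀ᵐ ξ ∂(volume : Measure E3),
    IntegrableOn (duhamelIntegrand ν α Ω G t ξ) (Ioo 0 t)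

/-- The transform of the bilinear term,
`[B(v,w)]^(ξ,t) = -∫₀ᵗ Ŝ(t - τ, ξ) P̂(ξ) [i ξ · (v ⊗ w)^(ξ, τ)] dτ`. -/
def bilinearHat (ν α Ω : ℝ) (V W : ℝ → E3 → C3) (t : ℝ) (ξ : E3) : C3 :=
  -duhamelHat ν α Ω (fun τ => divTensorHat (V τ) (W τ)) t ξ

/-- The convolutions and the time integrals in `bilinearHat` converge absolutely. -/
def BilinearConverges (ν α Ω : ℝ) (V W : ℝ → E3 → C3) : Prop :=
  (∀ᵐ τ ∂timeMeasure, ∀ᵐ ξ ∂(volume : Measure E3), ∀ m k : Fin 3,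
    Integrable (fun η => V τ η m * W τ (ξ - η) k)) ∧
  DuhamelConverges ν α Ω (fun τ => divTensorHat (V τ) (W τ))

/-- `U(t, ξ)` is a jointly measurable version of the spatial Fourier transform of `u`. -/
def IsFourierVersion (u : ℝ → 𝓢'(E3, C3)) (U : ℝ → E3 → C3) : Prop :=
  AEStronglyMeasurable (Function.uncurry U) (timeMeasure.prod (volume : Measure E3)) ∧
    ∀ᵐ t ∂timeMeasure, HasFourierDensity (u t) (U t)

/-- `b = B(v, w)`. -/
def IsBilinearTerm (ν α Ω : ℝ) (v w b : ℝ → 𝓢'(E3, C3)) : Prop :=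
  ∃ V W Z : ℝ → E3 → C3,
    IsFourierVersion v V ∧ IsFourierVersion w W ∧ IsFourierVersion b Z ∧
    BilinearConverges ν α Ω V W ∧
    ∀ᵐ t ∂timeMeasure, ∀ᵐ ξ ∂(volume : Measure E3), Z t ξ = bilinearHat ν α Ω V W t ξ

/-- `u` satisfies the integral equation `u(t) = S(t) u₀ + B(u,u)(t) + ∫₀ᵗ S(t-τ) P F(τ) dτ`,
in Fourier variables, for almost every `t ∈ (0, ∞)` and almost every `ξ`. -/
def IsMildSolution (ν α Ω : ℝ) (u₀ : 𝓢'(E3, C3)) (F u : ℝ → 𝓢'(E3, C3)) : Prop :=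
  ∃ (U₀ : E3 → C3) (G U : ℝ → E3 → C3),
    HasFourierDensity u₀ U₀ ∧ IsFourierVersion F G ∧ IsFourierVersion u U ∧
    DuhamelConverges ν α Ω G ∧ BilinearConverges ν α Ω U U ∧
    ∀ᵐ t ∂timeMeasure, ∀ᵐ ξ ∂(volume : Measure E3),
      U t ξ = act (semigroupSymbol ν α Ω t ξ) (U₀ ξ) + bilinearHat ν α Ω U U t ξ +
        duhamelHat ν α Ω G t ξ

/-- `3/p`, which is `0` for `p = ∞`. -/
def threeOver (p : ℝ≥0∞) : ℝ := 3 * (p⁻¹).toReal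

/-- The regularity `4 - 2α - 3/p` of the velocity. -/
def velReg (α : ℝ) (p : ℝ≥0∞) : ℝ := 4 - 2 * α - threeOver p

/-- The regularity `4 - 4α - 3/p` of the force. -/
def forceReg (α : ℝ) (p : ℝ≥0∞) : ℝ := 4 - 4 * α - threeOver p

end FNSC

end

noncomputable section

namespace FNSC

/-! ### Minkowski's integral inequality and sequence norms -/

/-! On the frequency side the mild equation is `U = A + B(U, U)`, where `A` collects the free
evolution and the Duhamel integral of the force. The regularity `s = 4 - 2α - 3/p` is critical for
the scaling, so a fixed point argument closes in the ball of radius `2ε` with contraction factor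
`4Kε`. The same difference inequality (`MildEquation.tnorm_sub_le`) gives uniqueness and continuous
dependence.

Linear bounds: sine, cosine and the entries of `R` are at most one in modulus, so `Ω` never enters.
On the shell `|ξ| ~ 2^j` the factor `exp(-ν (t-τ) |ξ|^{2α})` has time integral of order `2^{-2αj}`.
Hence the Duhamel integral gains `2α` derivatives, with a supremum in time on both sides
(`tnorm_duhamelHat_le`).

Product bound (`exists_divTensorHat_bound`): split the convolution according to which of the two
frequencies is larger. The factor of lower frequency is measured in `L¹` of a ball of radius `~
2^l`, which costs `2^{lβ}` with `β = 3 - 3/p - s = 2α - 1 > 0`. The other factor is a single block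
in `L^p`. The output block `j` sees only `l ≥ j - 2`, and the sum over these converges because `s -
β = 5 - 4α - 3/p > 0`. The divergence costs one derivative, so the result has regularity `s - β - 1
= s - 2α`, exactly what the Duhamel integral recovers.

The rest is measurability. Membership in `𝓧` includes Bochner measurability, that is, essentially
separable values. Elements of `𝓧` are therefore exchanged for jointly measurable functions of `(t,
ξ)` with finite norm and separable values (`IsPath`), by `exists_measurable_version` and
`exists_memTime`. The delicate point is that the Duhamel integral keeps separability. For `q < ∞` it
is a limit of frequency truncations, each Lipschitz in time. For `q = ∞` truncations need not
converge, and Lebesgue's density theorem is used: at high frequency the Duhamel kernel concentrates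
at the present time, where the source is close to a fixed element of a countable set
(`separablyValued_duhamelHat_top`). -/

theorem measurable_eLpNorm_left {α β : Type*} [MeasurableSpace α] [MeasurableSpace β]
    (μ : Measure α) [SFinite μ] (p : ℝ≥0∞) {f : α → β → ℝ≥0∞}
    (hf : Measurable (Function.uncurry f)) :
    Measurable fun y => eLpNorm (fun x => f x y) p μ := by
  have hf' : Measurable fun z : β × α => f z.2 z.1 := hf.comp measurable_swap
  by_cases h0 : p = 0
  · simp [h0]
  by_cases htop : p = ∞
  · subst htop
    refine measurable_of_Iic fun c => ?_
    -- An essential supremum is at most `c` exactly when the slice of `{f > c}` is null, and slice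
    -- measures are measurable functions of `y`.
    have : (fun y => eLpNorm (fun x => f x y) ∞ μ) ⁻¹' Iic c =
        {y | μ (Prod.mk y ⁻¹' {z : β × α | c < f z.2 z.1}) = 0} := by
      ext y
      simp only [mem_preimage, mem_Iic, Set.mem_ofPred_eq, eLpNorm_exponent_top, eLpNormEssSup,
        enorm_eq_self]
      constructor
      · intro h
        have := ENNReal.ae_le_essSup (μ := μ) (fun x => f x y)
        rw [← not_not (a := μ _ = 0)]
        intro hne
        apply hne
        have h2 : ∀ᵐ x ∂μ, f x y ≤ c := this.mono fun x hx => hx.trans h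
        rw [ae_iff] at h2
        simpa using h2
      · intro h
        refine essSup_le_of_ae_le _ ?_
        rw [Filter.EventuallyLE, ae_iff]
        simpa using h
    rw [this]
    exact measurable_measure_prodMk_left (measurableSet_lt measurable_const hf')
      (measurableSet_singleton 0)
  · simp only [eLpNorm_eq_lintegral_rpow_enorm_toReal h0 htop, enorm_eq_self]
    exact ((hf'.pow_const p.toReal).lintegral_prod_right').pow_const _

/-- Minkowski's integral inequality. -/
theorem eLpNorm_lintegral_le {α β : Type*} [MeasurableSpace α] [MeasurableSpace β]
    (μ : Measure α) (ν : Measure β) [SFinite μ] [SFinite ν] {p : ℝ≥0∞} (hp : 1 ≤ p)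
    {f : α → β → ℝ≥0∞} (hf : Measurable (Function.uncurry f)) :
    eLpNorm (fun x => ∫⁻ y, f x y ∂ν) p μ ≤ ∫⁻ y, eLpNorm (fun x => f x y) p μ ∂ν := by
  have hN := measurable_eLpNorm_left μ p hf
  set N : β → ℝ≥0∞ := fun y => eLpNorm (fun x => f x y) p μ with hNdef
  have hfs : Measurable fun z : β × α => f z.2 z.1 := hf.comp measurable_swap
  by_cases htop : p = ∞
  · subst htop
    have h1 : ∀ᵐ y ∂ν, ∀ᵐ x ∂μ, f x y ≤ N y := by
      refine Eventually.of_forall fun y => ?_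
      have := ENNReal.ae_le_essSup (μ := μ) (fun x => f x y)
      simpa [hNdef, eLpNorm_exponent_top, eLpNormEssSup] using this
    rw [Measure.ae_ae_comm (p := fun y x => f x y ≤ N y)
      (measurableSet_le hfs (hN.comp measurable_fst))] at h1
    simp only [eLpNorm_exponent_top, eLpNormEssSup, enorm_eq_self]
    refine essSup_le_of_ae_le _ ?_
    filter_upwards [h1] with x hx
    exact lintegral_mono_ae hx
  have h0 : p ≠ 0 := (zero_lt_one.trans_le hp).ne'
  rcases hp.eq_or_lt with h1 | h1
  · subst h1
    simp only [hNdef, eLpNorm_one_eq_lintegral_enorm, enorm_eq_self]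
    rw [lintegral_lintegral_swap hf.aemeasurable]
  set r := p.toReal with hr
  have hr1 : 1 < r := by
    rw [hr, ← ENNReal.toReal_one]
    exact (ENNReal.toReal_lt_toReal ENNReal.one_ne_top htop).2 h1
  have hr0 : 0 < r := by linarith
  have hNr : ∀ y, N y ^ r = ∫⁻ x, f x y ^ r ∂μ := by
    intro y
    simp only [hNdef, eLpNorm_eq_lintegral_rpow_enorm_toReal h0 htop, enorm_eq_self, ← hr]
    rw [← ENNReal.rpow_mul, one_div, inv_mul_cancel₀ hr0.ne', ENNReal.rpow_one]
  set T := ∫⁻ y, N y ∂ν with hT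
  by_cases hTtop : T = ∞
  · simp [hTtop]
  have hNfin : ∀ᵐ y ∂ν, N y < ∞ := ae_lt_top hN hTtop
  -- Duality is avoided: Hölder in `y` is applied to `N^{1/q} · (f N^{-1/q})`. Integrating the
  -- `r`-th power in `x` then turns `∫ f^r` into `N^r`, and `r - r/q = 1`.
  set q := r.conjExponent with hq
  have hrq : r.HolderConjugate q := Real.HolderConjugate.conjExponent hr1
  have hq0 : 0 < q := hrq.symm.pos
  have hqr : r / q = r - 1 := hrq.div_conj_eq_sub_one
  -- the pointwise factorization
  have hfac : ∀ᵐ x ∂μ, ∀ᵐ y ∂ν, f x y ≤ N y ^ (1 / q) * (f x y * N y ^ (-(1 / q))) := by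
    have hm : MeasurableSet
        {z : β × α | f z.2 z.1 ≤ N z.1 ^ (1 / q) * (f z.2 z.1 * N z.1 ^ (-(1 / q)))} := by
      refine measurableSet_le hfs ?_
      exact ((hN.comp measurable_fst).pow_const _).mul
        (hfs.mul ((hN.comp measurable_fst).pow_const _))
    refine (Measure.ae_ae_comm
      (p := fun y x => f x y ≤ N y ^ (1 / q) * (f x y * N y ^ (-(1 / q)))) hm).1 ?_
    filter_upwards [hNfin] with y hy
    -- Here the weight is `0 · ∞ = 0`, so the factorization survives only because `f(·, y)` vanishes
    -- almost everywhere.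
    by_cases hy0 : N y = 0
    · have : ∫⁻ x, f x y ^ r ∂μ = 0 := by rw [← hNr, hy0, ENNReal.zero_rpow_of_pos hr0]
      have hmy : Measurable fun x => f x y := hf.comp (measurable_id.prodMk measurable_const)
      rw [lintegral_eq_zero_iff (hmy.pow_const r)] at this
      filter_upwards [this] with x hx
      have : f x y = 0 := by
        simpa [ENNReal.rpow_eq_zero_iff, hr0, hr0.le, not_lt.2 hr0.le] using hx
      simp [this]
    · refine Eventually.of_forall fun x => ?_
      rw [mul_left_comm, ← ENNReal.rpow_add _ _ hy0 hy.ne]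
      simp
  have hpt : ∀ᵐ x ∂μ, (∫⁻ y, f x y ∂ν) ^ r ≤
      T ^ (r / q) * ∫⁻ y, f x y ^ r * N y ^ (-(r / q)) ∂ν := by
    filter_upwards [hfac] with x hx
    have hmx : Measurable fun y => f x y := hf.comp (measurable_const.prodMk measurable_id)
    have h2 := ENNReal.lintegral_mul_le_Lp_mul_Lq ν hrq.symm
      (f := fun y => N y ^ (1 / q)) (g := fun y => f x y * N y ^ (-(1 / q)))
      (hN.pow_const _).aemeasurable (hmx.mul (hN.pow_const _)).aemeasurable
    have h3 : ∫⁻ y, f x y ∂ν ≤ T ^ (1 / q) * (∫⁻ y, f x y ^ r * N y ^ (-(r / q)) ∂ν) ^ (1 / r) := by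
      refine (lintegral_mono_ae hx).trans (h2.trans (le_of_eq ?_))
      congr 2
      · refine congrArg _ (funext fun y => ?_)
        rw [← ENNReal.rpow_mul, one_div, inv_mul_cancel₀ hq0.ne', ENNReal.rpow_one]
      · refine congrArg _ (funext fun y => ?_)
        rw [ENNReal.mul_rpow_of_nonneg _ _ hr0.le, ← ENNReal.rpow_mul]
        congr 2
        field_simp
    calc (∫⁻ y, f x y ∂ν) ^ r
        ≤ (T ^ (1 / q) * (∫⁻ y, f x y ^ r * N y ^ (-(r / q)) ∂ν) ^ (1 / r)) ^ r := by gcongr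
      _ = _ := by
        rw [ENNReal.mul_rpow_of_nonneg _ _ hr0.le, ← ENNReal.rpow_mul, ← ENNReal.rpow_mul]
        congr 2
        · field_simp
        · rw [one_div, inv_mul_cancel₀ hr0.ne', ENNReal.rpow_one]
  have hmain : ∫⁻ x, (∫⁻ y, f x y ∂ν) ^ r ∂μ ≤ T ^ r := by
    have hmeas : Measurable (Function.uncurry fun (x : α) (y : β) => f x y ^ r * N y ^ (-(r / q))) :=
      (hf.pow_const r).mul ((hN.comp measurable_snd).pow_const _)
    calc ∫⁻ x, (∫⁻ y, f x y ∂ν) ^ r ∂μ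
        ≤ ∫⁻ x, T ^ (r / q) * ∫⁻ y, f x y ^ r * N y ^ (-(r / q)) ∂ν ∂μ := lintegral_mono_ae hpt
      _ = T ^ (r / q) * ∫⁻ x, ∫⁻ y, f x y ^ r * N y ^ (-(r / q)) ∂ν ∂μ :=
          lintegral_const_mul _ hmeas.lintegral_prod_right'
      _ = T ^ (r / q) * ∫⁻ y, ∫⁻ x, f x y ^ r * N y ^ (-(r / q)) ∂μ ∂ν := by
          rw [lintegral_lintegral_swap hmeas.aemeasurable]
      _ ≤ T ^ (r / q) * ∫⁻ y, N y ∂ν := by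
          gcongr with y
          have hmy : Measurable fun x => f x y := hf.comp (measurable_id.prodMk measurable_const)
          rw [lintegral_mul_const _ (hmy.pow_const r), ← hNr]
          rcases eq_or_ne (N y) 0 with h | h
          · simp [h, ENNReal.zero_rpow_of_pos hr0]
          rcases eq_or_ne (N y) ∞ with h' | h'
          · simp [h']
          rw [← ENNReal.rpow_add _ _ h h', hqr]
          simp
      _ = T ^ r := by
          rw [← hT]
          rcases eq_or_ne T 0 with h | h
          · simp [h, ENNReal.zero_rpow_of_pos hr0]
          nth_rewrite 2 [← ENNReal.rpow_one T]
          rw [← ENNReal.rpow_add _ _ h hTtop, hqr]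
          simp
  rw [eLpNorm_eq_lintegral_rpow_enorm_toReal h0 htop]
  simp only [enorm_eq_self, ← hr]
  calc (∫⁻ x, (∫⁻ y, f x y ∂ν) ^ r ∂μ) ^ (1 / r) ≤ (T ^ r) ^ (1 / r) := by gcongr
    _ = T := by rw [← ENNReal.rpow_mul, mul_one_div_cancel hr0.ne', ENNReal.rpow_one]

/-- Countable subadditivity of the `L^p` norm. -/
theorem eLpNorm_tsum_le {α ι : Type*} [MeasurableSpace α] [Countable ι] (μ : Measure α) [SFinite μ]
    {p : ℝ≥0∞} (hp : 1 ≤ p) {f : ι → α → ℝ≥0∞} (hf : ∀ i, Measurable (f i)) :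
    eLpNorm (fun x => ∑' i, f i x) p μ ≤ ∑' i, eLpNorm (f i) p μ := by
  let _ : MeasurableSpace ι := ⊤
  have := eLpNorm_lintegral_le μ (Measure.count : Measure ι) hp (f := fun x i => f i x)
    (measurable_from_prod_countable_left fun i => hf i)
  simpa only [lintegral_count] using this

theorem eLpNorm_mul_const {α : Type*} [MeasurableSpace α] (μ : Measure α) (p : ℝ≥0∞) (c : ℝ≥0∞)
    {f : α → ℝ≥0∞} (hf : Measurable f) :
    eLpNorm (fun x => c * f x) p μ = c * eLpNorm f p μ := by
  by_cases h0 : p = 0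
  · simp [h0]
  by_cases htop : p = ∞
  · subst htop
    simp only [eLpNorm_exponent_top, eLpNormEssSup, enorm_eq_self]
    exact ENNReal.essSup_const_mul
  have hr : 0 < p.toReal := ENNReal.toReal_pos h0 htop
  simp only [eLpNorm_eq_lintegral_rpow_enorm_toReal h0 htop, enorm_eq_self]
  simp only [ENNReal.mul_rpow_of_nonneg _ _ hr.le]
  rw [lintegral_const_mul _ (hf.pow_const _), ENNReal.mul_rpow_of_nonneg _ _ (by positivity),
    ← ENNReal.rpow_mul, mul_one_div_cancel hr.ne', ENNReal.rpow_one]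

theorem two_rpow_add (x y : ℝ) : (2 : ℝ≥0∞) ^ (x + y) = 2 ^ x * 2 ^ y :=
  ENNReal.rpow_add _ _ two_ne_zero ENNReal.ofNat_ne_top

theorem two_rpow_ne_top (x : ℝ) : (2 : ℝ≥0∞) ^ x ≠ ∞ := by
  simp [ENNReal.rpow_eq_top_iff]

theorem two_rpow_mul_neg (x : ℝ) : (2 : ℝ≥0∞) ^ x * 2 ^ (-x) = 1 := by
  rw [← two_rpow_add]; simp

theorem two_rpow_eq_ofReal (x : ℝ) : (2 : ℝ≥0∞) ^ x = ENNReal.ofReal ((2 : ℝ) ^ x) := by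
  rw [← ENNReal.ofReal_rpow_of_pos two_pos]; simp

theorem tsum_two_rpow_neg_lt_top {β : ℝ} (hβ : 0 < β) :
    ∑' n : ℕ, (2 : ℝ≥0∞) ^ (-((n : ℝ) * β)) < ∞ := by
  have : ∀ n : ℕ, (2 : ℝ≥0∞) ^ (-((n : ℝ) * β)) = ((2 : ℝ≥0∞) ^ (-β)) ^ n := by
    intro n
    rw [← ENNReal.rpow_natCast, ← ENNReal.rpow_mul]
    congr 1; ring
  simp only [this, ENNReal.tsum_geometric]
  rw [ENNReal.inv_lt_top, tsub_pos_iff_lt]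
  exact ENNReal.rpow_lt_one_of_one_lt_of_neg (by norm_num) (by linarith)

section weightedSeqNorm

variable {s : ℝ} {q : ℝ≥0∞}

theorem wsn_mono {a b : ℤ → ℝ≥0∞} (h : ∀ j, a j ≤ b j) :
    weightedSeqNorm s q a ≤ weightedSeqNorm s q b :=
  eLpNorm_mono_enorm fun j => by simpa using mul_le_mul_right (h j) _

theorem wsn_const_mul (c : ℝ≥0∞) (a : ℤ → ℝ≥0∞) :
    weightedSeqNorm s q (fun j => c * a j) = c * weightedSeqNorm s q a := by
  unfold weightedSeqNorm
  rw [← eLpNorm_mul_const _ _ _ (measurable_of_countable _)]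
  congr 1; ext j; ring

theorem wsn_zero : weightedSeqNorm s q (fun _ => 0) = 0 := by
  simpa using wsn_const_mul (s := s) (q := q) 0 (fun _ => 0)

theorem wsn_add_le (hq : 1 ≤ q) (a b : ℤ → ℝ≥0∞) :
    weightedSeqNorm s q (fun j => a j + b j) ≤ weightedSeqNorm s q a + weightedSeqNorm s q b := by
  unfold weightedSeqNorm
  refine le_trans (le_of_eq ?_) (eLpNorm_add_le (measurable_of_countable _).aestronglyMeasurable
    (measurable_of_countable _).aestronglyMeasurable hq)
  congr 1; ext j; simp [mul_add]

theorem wsn_tsum_le {ι : Type*} [Countable ι] (hq : 1 ≤ q) (a : ι → ℤ → ℝ≥0∞) :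
    weightedSeqNorm s q (fun j => ∑' i, a i j) ≤ ∑' i, weightedSeqNorm s q (a i) := by
  unfold weightedSeqNorm
  simp only [← ENNReal.tsum_mul_left]
  exact eLpNorm_tsum_le _ hq fun i => measurable_of_countable _

theorem wsn_weight (r : ℝ) (a : ℤ → ℝ≥0∞) :
    weightedSeqNorm s q (fun j => 2 ^ ((j : ℝ) * r) * a j) = weightedSeqNorm (s + r) q a := by
  unfold weightedSeqNorm
  congr 1; ext j
  rw [← mul_assoc, ← two_rpow_add]
  congr 2; ring

/-- Counting measure is translation invariant, so only the weight changes. This factor is the source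
of the geometric decay in the product estimate. -/
theorem wsn_shift (m : ℤ) (a : ℤ → ℝ≥0∞) :
    weightedSeqNorm s q (fun j => a (j + m)) = 2 ^ (-((m : ℝ) * s)) * weightedSeqNorm s q a := by
  have hmp : MeasurePreserving (fun j : ℤ => j + m) Measure.count Measure.count := by
    refine ⟨measurable_of_countable _, Measure.ext fun t ht => ?_⟩
    rw [Measure.map_apply (measurable_of_countable _) ht]
    rw [← Measure.count_injective_image (f := fun j : ℤ => j + m) (add_left_injective m),
      image_preimage_eq _ (show Function.Surjective fun j : ℤ => j + m from
        (Equiv.addRight m).surjective)]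
  have h1 : weightedSeqNorm s q a =
      eLpNorm (fun j : ℤ => (2 : ℝ≥0∞) ^ (((j + m : ℤ) : ℝ) * s) * a (j + m)) q Measure.count :=
    (eLpNorm_comp_measurePreserving (g := fun j : ℤ => (2 : ℝ≥0∞) ^ ((j : ℝ) * s) * a j)
      (measurable_of_countable _).aestronglyMeasurable hmp).symm
  rw [h1, ← eLpNorm_mul_const _ _ _ (measurable_of_countable _)]
  unfold weightedSeqNorm
  congr 1; ext j
  rw [← mul_assoc, ← two_rpow_add]
  congr 2; push_cast; ring

theorem le_wsn (hq : 1 ≤ q) (a : ℤ → ℝ≥0∞) (j : ℤ) :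
    2 ^ ((j : ℝ) * s) * a j ≤ weightedSeqNorm s q a := by
  unfold weightedSeqNorm
  by_cases htop : q = ∞
  · subst htop
    simp only [eLpNorm_exponent_top, eLpNormEssSup, enorm_eq_self]
    have := ENNReal.ae_le_essSup (μ := Measure.count)
      (fun j : ℤ => (2 : ℝ≥0∞) ^ ((j : ℝ) * s) * a j)
    rw [ae_iff, Measure.count_eq_zero_iff] at this
    by_contra hcon
    have : j ∈ (∅ : Set ℤ) := by
      rw [← this]; exact hcon
    exact this
  · have h0 : q ≠ 0 := (zero_lt_one.trans_le hq).ne'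
    have hr : 0 < q.toReal := ENNReal.toReal_pos h0 htop
    simp only [eLpNorm_eq_lintegral_rpow_enorm_toReal h0 htop, enorm_eq_self, lintegral_count]
    calc 2 ^ ((j : ℝ) * s) * a j
        = ((2 ^ ((j : ℝ) * s) * a j) ^ q.toReal) ^ (1 / q.toReal) := by
          rw [← ENNReal.rpow_mul, mul_one_div_cancel hr.ne', ENNReal.rpow_one]
      _ ≤ _ := by
          gcongr
          exact ENNReal.le_tsum (f := fun i : ℤ => ((2 : ℝ≥0∞) ^ ((i : ℝ) * s) * a i) ^ q.toReal) j

theorem le_wsn' (hq : 1 ≤ q) (a : ℤ → ℝ≥0∞) (j : ℤ) :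
    a j ≤ 2 ^ (-((j : ℝ) * s)) * weightedSeqNorm s q a := by
  calc a j = 2 ^ (-((j : ℝ) * s)) * (2 ^ ((j : ℝ) * s) * a j) := by
        rw [← mul_assoc, mul_comm (2 ^ (-_)), two_rpow_mul_neg, one_mul]
    _ ≤ _ := by gcongr; exact le_wsn hq a j

theorem lt_top_of_wsn (hq : 1 ≤ q) {a : ℤ → ℝ≥0∞} (h : weightedSeqNorm s q a < ∞) (j : ℤ) :
    a j < ∞ :=
  (le_wsn' hq a j).trans_lt (ENNReal.mul_lt_top (two_rpow_ne_top _).lt_top h)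

theorem eq_zero_of_wsn (hq : 1 ≤ q) {a : ℤ → ℝ≥0∞} (h : weightedSeqNorm s q a = 0) (j : ℤ) :
    a j = 0 := by
  simpa [h] using le_wsn' hq (s := s) a j

theorem wsn_top_le {a : ℤ → ℝ≥0∞} {c : ℝ≥0∞} (h : ∀ j : ℤ, 2 ^ ((j : ℝ) * s) * a j ≤ c) :
    weightedSeqNorm s ∞ a ≤ c := by
  simp only [weightedSeqNorm, eLpNorm_exponent_top, eLpNormEssSup, enorm_eq_self]
  exact essSup_le_of_ae_le _ (Eventually.of_forall h)

theorem measurable_wsn {α : Type*} [MeasurableSpace α] {a : ℤ → α → ℝ≥0∞}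
    (ha : ∀ j, Measurable (a j)) : Measurable fun t => weightedSeqNorm s q (fun j => a j t) := by
  refine measurable_eLpNorm_left (Measure.count : Measure ℤ) q
    (f := fun (j : ℤ) (t : α) => (2 : ℝ≥0∞) ^ ((j : ℝ) * s) * a j t) ?_
  refine measurable_from_prod_countable_right fun j => ?_
  exact (ha j).const_mul (2 ^ ((j : ℝ) * s))

/-- The tails of a sequence of finite norm tend to zero when `q < ∞`. -/
theorem tendsto_wsn_tail (hq : 1 ≤ q) (hq' : q ≠ ∞) {a : ℤ → ℝ≥0∞}
    (h : weightedSeqNorm s q a < ∞) (A : ℕ → Set ℤ) (hA : ∀ j, ∀ᶠ n in atTop, j ∉ A n) :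
    Tendsto (fun n => weightedSeqNorm s q (fun j => (A n).indicator a j)) atTop (𝓝 0) := by
  have h0 : q ≠ 0 := (zero_lt_one.trans_le hq).ne'
  have hr : 0 < q.toReal := ENNReal.toReal_pos h0 hq'
  unfold weightedSeqNorm at h ⊢
  simp only [eLpNorm_eq_lintegral_rpow_enorm_toReal h0 hq', enorm_eq_self] at h ⊢
  have h' : ∫⁻ j : ℤ, ((2 : ℝ≥0∞) ^ ((j : ℝ) * s) * a j) ^ q.toReal ∂Measure.count ≠ ∞ := by
    intro hc
    rw [hc, ENNReal.top_rpow_of_pos (by positivity)] at h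
    exact lt_irrefl _ h
  have key := tendsto_lintegral_of_dominated_convergence (μ := (Measure.count : Measure ℤ))
    (F := fun n j => ((2 : ℝ≥0∞) ^ ((j : ℝ) * s) * (A n).indicator a j) ^ q.toReal)
    (f := fun _ => 0) _ (fun n => measurable_of_countable _)
    (fun n => Eventually.of_forall fun j => by
      refine ENNReal.rpow_le_rpow (mul_le_mul_right ?_ _) hr.le
      exact indicator_le_self' (fun _ _ => zero_le) j) h'
    (Eventually.of_forall fun j => by
      refine tendsto_const_nhds.congr' ?_
      filter_upwards [hA j] with n hn
      rw [indicator_of_notMem hn, mul_zero, ENNReal.zero_rpow_of_pos hr])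
  simp only [lintegral_zero] at key
  have := (ENNReal.continuous_rpow_const (y := 1 / q.toReal)).tendsto 0 |>.comp key
  rwa [ENNReal.zero_rpow_of_pos (by positivity)] at this

end weightedSeqNorm

/-! ### Density of compactly supported functions in the Schwartz space -/

section Cutoff

open scoped ContDiff

variable {E : Type*} [NormedAddCommGroup E] [NormedSpace ℝ E]

/-- Each derivative of the dilated cutoff brings a factor `c ≤ 1`, so the bound is uniform in the
dilation. -/
theorem norm_iteratedFDeriv_one_sub_comp_smul_le (χ : 𝓢(E, ℂ)) {c : ℝ} (hc0 : 0 ≤ c) (hc : c ≤ 1)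
    (i : ℕ) (x : E) :
    ‖iteratedFDeriv ℝ i (fun y => 1 - χ (c • y)) x‖ ≤ 1 + SchwartzMap.seminorm ℝ 0 i χ := by
  have hχ : ContDiff ℝ i χ := χ.smooth i
  have hχc : ContDiff ℝ i (fun y => χ (c • y)) := hχ.comp (contDiff_const_smul c)
  have h1 : iteratedFDeriv ℝ i (fun y => 1 - χ (c • y)) x =
      iteratedFDeriv ℝ i (fun _ : E => (1 : ℂ)) x - iteratedFDeriv ℝ i (fun y => χ (c • y)) x :=
    iteratedFDeriv_sub_apply (f := fun _ : E => (1 : ℂ)) contDiff_const.contDiffAt hχc.contDiffAt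
  rw [h1]
  refine (norm_sub_le _ _).trans (add_le_add ?_ ?_)
  · rcases Nat.eq_zero_or_pos i with rfl | hi
    · simp
    · rw [iteratedFDeriv_const_of_ne hi.ne']; simp
  · rw [iteratedFDeriv_comp_const_smul c hχ]
    simp only [norm_smul, norm_pow, Real.norm_eq_abs, abs_of_nonneg hc0]
    calc c ^ i * ‖iteratedFDeriv ℝ i χ (c • x)‖ ≤ 1 * ‖iteratedFDeriv ℝ i χ (c • x)‖ := by
          gcongr; exact pow_le_one₀ hc0 hc
      _ ≤ _ := by rw [one_mul]; exact χ.norm_iteratedFDeriv_le_seminorm ℝ i _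

/-- The error `θ - ψ` vanishes for `‖x‖ < n + 1`. Elsewhere one more power of `‖x‖` is at least `n +
1`, and spending it on `ψ` in the Leibniz rule yields the rate `1/(n + 1)`. -/
theorem seminorm_cutoff_le (χ ψ : 𝓢(E, ℂ)) (hχ : ∀ x, ‖x‖ ≤ 1 → χ x = 1) (k l : ℕ) :
    ∃ C : ℝ, 0 ≤ C ∧ ∀ (n : ℕ) (θ : 𝓢(E, ℂ)),
      (∀ x, θ x = χ (((n + 1 : ℕ) : ℝ)⁻¹ • x) * ψ x) →
      SchwartzMap.seminorm ℂ k l (θ - ψ) ≤ C / (n + 1 : ℕ) := by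
  refine ⟨∑ i ∈ Finset.range (l + 1), (l.choose i : ℝ) * (1 + SchwartzMap.seminorm ℝ 0 i χ) *
    SchwartzMap.seminorm ℝ (k + 1) (l - i) ψ, Finset.sum_nonneg fun i _ => by positivity, ?_⟩
  intro n θ hθ
  have hn : (0 : ℝ) < (n + 1 : ℕ) := by positivity
  set c : ℝ := ((n + 1 : ℕ) : ℝ)⁻¹ with hcdef
  have hc0 : 0 < c := inv_pos.2 hn
  have hc1 : c ≤ 1 := inv_le_one_of_one_le₀ (by exact_mod_cast Nat.le_add_left 1 n)
  have hfun : ∀ x, (ψ - θ) x = (1 - χ (c • x)) * ψ x := by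
    intro x; rw [sub_apply, hθ]; ring
  have hfun' : ((ψ - θ : 𝓢(E, ℂ)) : E → ℂ) = fun x => (1 - χ (c • x)) * ψ x := funext hfun
  rw [← neg_sub ψ θ, map_neg_eq_map]
  refine SchwartzMap.seminorm_le_bound ℂ k l _ (by positivity) fun x => ?_
  rcases lt_or_ge ‖x‖ (n + 1 : ℕ) with hx | hx
  · have h0 : ((ψ - θ : 𝓢(E, ℂ)) : E → ℂ) =ᶠ[𝓝 x] fun _ => 0 := by
      have hev : ∀ᶠ y in 𝓝 x, ‖y‖ < (n + 1 : ℕ) :=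
        continuous_norm.continuousAt.eventually (Iio_mem_nhds hx)
      filter_upwards [hev] with y hy
      rw [hfun, hχ _ ?_]
      · simp
      · rw [norm_smul, Real.norm_eq_abs, abs_of_pos hc0, hcdef, inv_mul_le_iff₀ hn, mul_one]
        exact hy.le
    rw [(h0.iteratedFDeriv ℝ l).eq_of_nhds]
    have : iteratedFDeriv ℝ l (fun _ : E => (0 : ℂ)) x = 0 := by
      simp
    rw [this, norm_zero, mul_zero]
    positivity
  · rw [hfun', Finset.sum_div, ]
    have hsm : ContDiff ℝ l (fun y => 1 - χ (c • y)) :=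
      contDiff_const.sub ((χ.smooth l).comp (contDiff_const_smul c))
    have h1 := norm_iteratedFDeriv_mul_le (n := l) hsm (ψ.smooth l) x le_rfl
    refine (mul_le_mul_of_nonneg_left h1 (by positivity)).trans ?_
    rw [Finset.mul_sum]
    refine Finset.sum_le_sum fun i _ => ?_
    have hψ : ‖x‖ ^ k * ‖iteratedFDeriv ℝ (l - i) ψ x‖ ≤
        SchwartzMap.seminorm ℝ (k + 1) (l - i) ψ / (n + 1 : ℕ) := by
      rw [le_div_iff₀ hn]
      calc ‖x‖ ^ k * ‖iteratedFDeriv ℝ (l - i) ψ x‖ * (n + 1 : ℕ)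
          ≤ ‖x‖ ^ k * ‖iteratedFDeriv ℝ (l - i) ψ x‖ * ‖x‖ := by gcongr
        _ = ‖x‖ ^ (k + 1) * ‖iteratedFDeriv ℝ (l - i) ψ x‖ := by ring
        _ ≤ _ := ψ.le_seminorm ℝ _ _ x
    calc ‖x‖ ^ k * ((l.choose i : ℝ) * ‖iteratedFDeriv ℝ i (fun y => 1 - χ (c • y)) x‖ *
          ‖iteratedFDeriv ℝ (l - i) ψ x‖)
        = (l.choose i : ℝ) * ‖iteratedFDeriv ℝ i (fun y => 1 - χ (c • y)) x‖ *
          (‖x‖ ^ k * ‖iteratedFDeriv ℝ (l - i) ψ x‖) := by ring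
      _ ≤ (l.choose i : ℝ) * (1 + SchwartzMap.seminorm ℝ 0 i χ) *
          (SchwartzMap.seminorm ℝ (k + 1) (l - i) ψ / (n + 1 : ℕ)) := by
          gcongr
          exact norm_iteratedFDeriv_one_sub_comp_smul_le χ hc0.le hc1 i x
      _ = _ := by ring

/-- Every Schwartz function is the limit of compactly supported ones. -/
theorem exists_tendsto_hasCompactSupport [FiniteDimensional ℝ E] (ψ : 𝓢(E, ℂ)) :
    ∃ θ : ℕ → 𝓢(E, ℂ), (∀ n, HasCompactSupport (θ n)) ∧ Tendsto θ atTop (𝓝 ψ) := by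
  let b : ContDiffBump (0 : E) := ⟨1, 2, one_pos, one_lt_two⟩
  have hb1 : HasCompactSupport (Complex.ofRealCLM ∘ b) := b.hasCompactSupport.comp_left rfl
  have hb0 : ContDiff ℝ ∞ b := b.contDiff
  have hb2 : ContDiff ℝ ∞ (Complex.ofRealCLM ∘ b) := Complex.ofRealCLM.contDiff.comp hb0
  let χ : 𝓢(E, ℂ) := hb1.toSchwartzMap hb2
  have hχ : ∀ x, ‖x‖ ≤ 1 → χ x = 1 := by
    intro x hx
    have : b x = 1 := b.one_of_mem_closedBall (by simpa using hx)
    show (b x : ℂ) = 1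
    rw [this]; simp
  have hcs : ∀ n : ℕ, HasCompactSupport fun x => χ (((n + 1 : ℕ) : ℝ)⁻¹ • x) * ψ x := by
    intro n
    have h1 : HasCompactSupport fun x => χ (((n + 1 : ℕ) : ℝ)⁻¹ • x) :=
      (show HasCompactSupport (χ : E → ℂ) from hb1).comp_smul (by positivity)
    exact h1.mul_right
  have hcd : ∀ n : ℕ, ContDiff ℝ ∞ fun x => χ (((n + 1 : ℕ) : ℝ)⁻¹ • x) * ψ x := by
    intro n
    exact ((χ.smooth ⊤).comp (contDiff_const_smul _)).mul (ψ.smooth ⊤)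
  refine ⟨fun n => (hcs n).toSchwartzMap (hcd n), hcs, ?_⟩
  rw [(schwartz_withSeminorms ℂ E ℂ).tendsto_nhds_atTop]
  rintro ⟨k, l⟩ ε hε
  obtain ⟨C, hC, h⟩ := seminorm_cutoff_le χ ψ hχ k l
  obtain ⟨N, hN⟩ := exists_nat_gt (C / ε)
  refine ⟨N, fun n hn => (h n _ fun x => rfl).trans_lt ?_⟩
  have hn' : (N : ℝ) ≤ n := by exact_mod_cast hn
  rw [div_lt_iff₀ (by positivity)]
  rw [div_lt_iff₀ hε] at hN
  push_cast
  nlinarith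

end Cutoff

/-! ### Fourier densities of tempered vector fields -/


theorem integrable_smul_of_hasCompactSupport {g : E3 → C3} (hg : LocallyIntegrable g volume)
    (ψ : 𝓢(E3, ℂ)) (hψ : HasCompactSupport ψ) :
    Integrable (fun ξ => ψ ((2 * Real.pi)⁻¹ • ξ) • g ξ) volume :=
  hg.integrable_smul_left_of_hasCompactSupport (ψ.continuous.comp (continuous_const_smul _))
    (hψ.comp_smul (inv_ne_zero Real.two_pi_pos.ne'))

theorem HasFourierDensity.congr {f : 𝓢'(E3, C3)} {g g' : E3 → C3} (h : HasFourierDensity f g)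
    (hg : g =ᵐ[volume] g') : HasFourierDensity f g' := by
  refine ⟨h.1.congr hg, fun ψ hψ => (h.2 ψ hψ).trans (integral_congr_ae ?_)⟩
  filter_upwards [hg] with ξ hξ
  rw [hξ]

theorem HasFourierDensity.sub {f f' : 𝓢'(E3, C3)} {g g' : E3 → C3} (h : HasFourierDensity f g)
    (h' : HasFourierDensity f' g') : HasFourierDensity (f - f') (fun ξ => g ξ - g' ξ) := by
  refine ⟨h.1.sub h'.1, fun ψ hψ => ?_⟩
  have : 𝓕 (f - f') ψ = 𝓕 f ψ - 𝓕 f' ψ := by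
    simp only [TemperedDistribution.fourier_apply]; rfl
  rw [this, h.2 ψ hψ, h'.2 ψ hψ, ← integral_sub (integrable_smul_of_hasCompactSupport h.1 ψ hψ)
    (integrable_smul_of_hasCompactSupport h'.1 ψ hψ)]
  simp only [smul_sub]

theorem hasFourierDensity_zero : HasFourierDensity 0 (fun _ => 0) := by
  refine ⟨locallyIntegrable_zero, fun ψ hψ => ?_⟩
  simp only [TemperedDistribution.fourier_apply, smul_zero, integral_zero]
  rfl

theorem HasFourierDensity.unique {f : 𝓢'(E3, C3)} {g g' : E3 → C3} (h : HasFourierDensity f g)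
    (h' : HasFourierDensity f g') : g =ᵐ[volume] g' := by
  refine ae_eq_of_integral_contDiff_smul_eq h.1 h'.1 fun ψ hψ hψc => ?_
  have hpi : (2 * Real.pi) ≠ 0 := Real.two_pi_pos.ne'
  -- The test function is dilated by `2π` to undo the rescaling built into `HasFourierDensity`.
  have h1 : HasCompactSupport (Complex.ofRealCLM ∘ fun x : E3 => ψ ((2 * Real.pi) • x)) :=
    (hψc.comp_smul hpi).comp_left rfl
  have h2 : ContDiff ℝ (⊤ : ℕ∞) (Complex.ofRealCLM ∘ fun x : E3 => ψ ((2 * Real.pi) • x)) :=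
    Complex.ofRealCLM.contDiff.comp (hψ.comp (contDiff_const_smul _))
  have e1 := h.2 (h1.toSchwartzMap h2) h1
  rw [h'.2 (h1.toSchwartzMap h2) h1] at e1
  have key : ∀ ξ : E3, (h1.toSchwartzMap h2) ((2 * Real.pi)⁻¹ • ξ) = (ψ ξ : ℂ) := by
    intro ξ
    show ((ψ ((2 * Real.pi) • (2 * Real.pi)⁻¹ • ξ) : ℝ) : ℂ) = _
    rw [smul_inv_smul₀ hpi]
  simp only [key] at e1
  simpa using e1.symm

/-- A density is tested only on compactly supported functions. These are dense in the Schwartz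
space, tempered distributions are continuous, and `𝓕` is invertible. -/
theorem HasFourierDensity.injective {f f' : 𝓢'(E3, C3)} {g : E3 → C3} (h : HasFourierDensity f g)
    (h' : HasFourierDensity f' g) : f = f' := by
  have h𝓕 : 𝓕 f = 𝓕 f' := by
    ext1 ψ
    obtain ⟨θ, hθ, hlim⟩ := exists_tendsto_hasCompactSupport ψ
    have l1 : Tendsto (fun n => 𝓕 f (θ n)) atTop (𝓝 (𝓕 f ψ)) :=
      ((𝓕 f).continuous.tendsto ψ).comp hlim
    have l2 : Tendsto (fun n => 𝓕 f' (θ n)) atTop (𝓝 (𝓕 f' ψ)) :=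
      ((𝓕 f').continuous.tendsto ψ).comp hlim
    have : (fun n => 𝓕 f (θ n)) = fun n => 𝓕 f' (θ n) := by
      ext1 n
      rw [h.2 _ (hθ n), h'.2 _ (hθ n)]
    rw [this] at l1
    exact tendsto_nhds_unique l1 l2
  have := congrArg (fun T : 𝓢'(E3, C3) => (𝓕⁻ T : 𝓢'(E3, C3))) h𝓕
  simpa only [FourierTransform.fourierInv_fourier_eq] using this

/-- A measurable function that is integrable against an inverse power of `1 + |ξ|²` is the Fourier
transform of a tempered vector field. -/
theorem exists_hasFourierDensity {g : E3 → C3} (hg : Measurable g) (r : ℝ)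
    (hint : ∫⁻ ξ, ENNReal.ofReal ((1 + ‖ξ‖ ^ 2) ^ (-r)) * ‖g ξ‖ₑ < ∞) :
    ∃ f, HasFourierDensity f g := by
  set w : E3 → ℝ := fun ξ => (1 + ‖ξ‖ ^ 2) ^ r with hw
  have hwpos : ∀ ξ, 0 < w ξ := fun ξ => Real.rpow_pos_of_pos (by positivity) _
  have hwinv : ∀ ξ, (w ξ)⁻¹ = (1 + ‖ξ‖ ^ 2) ^ (-r) := fun ξ => by
    rw [Real.rpow_neg (by positivity)]
  have hwc : Continuous w := by
    refine Continuous.rpow_const (by fun_prop) fun ξ => Or.inl (by positivity)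
  set u : E3 → C3 := fun ξ => ((w ξ)⁻¹ : ℝ) • g ξ with hu
  have hum : Measurable u := (hwc.measurable.inv).smul hg
  have hui : Integrable u volume := by
    refine ⟨hum.aestronglyMeasurable, ?_⟩
    refine lt_of_le_of_lt (le_of_eq (lintegral_congr fun ξ => ?_)) hint
    rw [hu]
    simp only [enorm_smul, hwinv]
    rw [Real.enorm_of_nonneg (by positivity)]
  have hgu : ∀ ξ, g ξ = w ξ • u ξ := fun ξ => by
    simp only [hu]; rw [smul_inv_smul₀ (hwpos ξ).ne']
  have hloc : LocallyIntegrable g volume := by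
    rw [locallyIntegrable_iff]
    intro K hK
    obtain ⟨C, hC⟩ := hK.exists_bound_of_continuousOn hwc.continuousOn
    refine Integrable.mono' ((hui.integrableOn (s := K)).norm.const_mul C)
      hg.aestronglyMeasurable ?_
    filter_upwards [ae_restrict_mem hK.measurableSet] with ξ hξ
    rw [hgu, norm_smul]
    gcongr
    exact hC ξ hξ
  have hwT : Function.HasTemperateGrowth (fun ξ : E3 => ((w ξ : ℝ) : ℂ)) :=
    (Function.Complex.hasTemperateGrowth_ofReal).comp
      (Function.hasTemperateGrowth_one_add_norm_sq_rpow E3 r)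
  let d : E3 ≃L[ℝ] E3 :=
    ContinuousLinearEquiv.smulLeft (Units.mk0 (2 * Real.pi)⁻¹ (inv_ne_zero Real.two_pi_pos.ne'))
  -- Write `g = w u` with `u` integrable and `w` of temperate growth. The functional `ψ ↦ ∫ w(ξ)
  -- ψ(ξ/2π) u(ξ) dξ` is then tempered, and its inverse transform has density `g`.
  let T : 𝓢'(E3, C3) := PointwiseConvergenceCLM.precomp C3
    ((SchwartzMap.smulLeftCLM ℂ (fun ξ : E3 => ((w ξ : ℝ) : ℂ))) ∘L
      (SchwartzMap.compCLMOfContinuousLinearEquiv ℂ d))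
    (Lp.toTemperedDistribution (p := 1) (hui.toL1 u))
  refine ⟨𝓕⁻ T, hloc, fun ψ _ => ?_⟩
  rw [FourierTransform.fourier_fourierInv_eq]
  have : T ψ = (Lp.toTemperedDistribution (p := 1) (hui.toL1 u))
      ((SchwartzMap.smulLeftCLM ℂ (fun ξ : E3 => ((w ξ : ℝ) : ℂ)))
      (SchwartzMap.compCLMOfContinuousLinearEquiv ℂ d ψ)) := rfl
  rw [this, Lp.toTemperedDistribution_apply]
  refine integral_congr_ae ?_
  filter_upwards [hui.coeFn_toL1] with ξ hξ
  rw [hξ, SchwartzMap.smulLeftCLM_apply_apply hwT, hgu ξ]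
  have : (SchwartzMap.compCLMOfContinuousLinearEquiv ℂ d ψ) ξ = ψ ((2 * Real.pi)⁻¹ • ξ) := rfl
  rw [this, smul_eq_mul, mul_comm, mul_smul]
  simp

/-! ### Fourier-Besov norms of functions on frequency space -/

/-- `‖φ_j g‖_{L^p}`. -/
def blk (P : DyadicPartition) (p : ℝ≥0∞) (j : ℤ) (g : E3 → C3) : ℝ≥0∞ :=
  eLpNorm (fun ξ => P.piece j ξ • g ξ) p volume

/-- The Fourier-Besov norm of a vector field with Fourier transform `g`. -/
def fnNorm (P : DyadicPartition) (s : ℝ) (p q : ℝ≥0∞) (g : E3 → C3) : ℝ≥0∞ :=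
  weightedSeqNorm s q (fun j => blk P p j g)

/-- `‖ ‖φ_j U(t)‖_{L^p} ‖_{L^∞(I)}`. -/
def timeBlk (P : DyadicPartition) (p : ℝ≥0∞) (U : ℝ → E3 → C3) (j : ℤ) : ℝ≥0∞ :=
  eLpNorm (fun t => blk P p j (U t)) ∞ timeMeasure

/-- The norm of `𝓛^∞(I; FḂ^s_{p,q})` in terms of Fourier transforms. -/
def tnorm (P : DyadicPartition) (s : ℝ) (p q : ℝ≥0∞) (U : ℝ → E3 → C3) : ℝ≥0∞ :=
  weightedSeqNorm s q (timeBlk P p U)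

section Pieces

variable (P : DyadicPartition)

theorem continuous_piece (j : ℤ) : Continuous (P.piece j) :=
  P.φ.continuous.comp (continuous_const_smul _)

theorem measurable_piece (j : ℤ) : Measurable (P.piece j) := (continuous_piece P j).measurable

theorem measurable_piece_smul (j : ℤ) {g : E3 → C3} (hg : Measurable g) :
    Measurable fun ξ => P.piece j ξ • g ξ := (measurable_piece P j).smul hg

theorem norm_bounds_of_piece_ne_zero {j : ℤ} {ξ : E3} (h : P.piece j ξ ≠ 0) :
    3 / 4 * (2 : ℝ) ^ j ≤ ‖ξ‖ ∧ ‖ξ‖ ≤ 8 / 3 * (2 : ℝ) ^ j := by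
  have h1 := P.supp (show (2 : ℝ) ^ (-j) • ξ ∈ Function.support P.φ from h)
  have h2 : (0 : ℝ) < 2 ^ j := by positivity
  have h3 : ‖(2 : ℝ) ^ (-j) • ξ‖ = ‖ξ‖ / 2 ^ j := by
    rw [norm_smul, zpow_neg, norm_inv, Real.norm_of_nonneg h2.le, inv_mul_eq_div]
  obtain ⟨h4, h5⟩ := h1
  rw [h3] at h4 h5
  rw [le_div_iff₀ h2] at h4
  rw [div_le_iff₀ h2] at h5
  exact ⟨h4, h5⟩

theorem exists_piece_bound : ∃ M : ℝ, 0 < M ∧ ∀ j ξ, ‖P.piece j ξ‖ ≤ M := by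
  refine ⟨SchwartzMap.seminorm ℝ 0 0 P.φ + 1, by positivity, fun j ξ => ?_⟩
  have := P.φ.norm_le_seminorm ℝ ((2 : ℝ) ^ (-j) • ξ)
  exact this.trans (by linarith)

/-- The function `φ` may change sign, so the absolute values sum to at least one and not exactly to
one. -/
theorem one_le_tsum_piece {ξ : E3} (hξ : ξ ≠ 0) : 1 ≤ ∑' j : ℤ, ‖P.piece j ξ‖ₑ := by
  have h := P.sum_eq_one ξ hξ
  have h2 : ‖∑' j : ℤ, P.piece j ξ‖ₑ = 1 := by
    rw [show ∑' j : ℤ, P.piece j ξ = 1 from h.tsum_eq]; simp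
  rw [← h2]
  exact enorm_tsum_le_tsum_enorm

theorem exists_piece_ne_zero {ξ : E3} (hξ : ξ ≠ 0) : ∃ j, P.piece j ξ ≠ 0 := by
  by_contra! h
  have := one_le_tsum_piece P hξ
  simp [h] at this

theorem enorm_le_tsum_piece_smul (g : E3 → C3) {ξ : E3} (hξ : ξ ≠ 0) :
    ‖g ξ‖ₑ ≤ ∑' j : ℤ, ‖P.piece j ξ • g ξ‖ₑ := by
  simp only [enorm_smul]
  rw [ENNReal.tsum_mul_right]
  calc ‖g ξ‖ₑ = 1 * ‖g ξ‖ₑ := (one_mul _).symm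
    _ ≤ _ := by gcongr; exact one_le_tsum_piece P hξ

theorem ae_ne_zero : ∀ᵐ ξ : E3, ξ ≠ 0 := by
  rw [ae_iff]; simp

end Pieces

section Blocks

variable (P : DyadicPartition) {p : ℝ≥0∞}

theorem blk_congr (p : ℝ≥0∞) (j : ℤ) {g g' : E3 → C3} (h : g =ᵐ[volume] g') :
    blk P p j g = blk P p j g' := by
  refine eLpNorm_congr_ae ?_
  filter_upwards [h] with ξ hξ
  rw [hξ]

theorem blk_eq_eLpNorm_enorm (p : ℝ≥0∞) (j : ℤ) (g : E3 → C3) :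
    blk P p j g = eLpNorm (fun ξ => ‖P.piece j ξ • g ξ‖ₑ) p volume :=
  (eLpNorm_congr_enorm_ae (Eventually.of_forall fun _ => by simp))

theorem blk_mono (p : ℝ≥0∞) (j : ℤ) {g g' : E3 → C3}
    (h : ∀ᵐ ξ, P.piece j ξ ≠ 0 → ‖g ξ‖ₑ ≤ ‖g' ξ‖ₑ) : blk P p j g ≤ blk P p j g' := by
  refine eLpNorm_mono_enorm_ae ?_
  filter_upwards [h] with ξ hξ
  by_cases h0 : P.piece j ξ = 0
  · simp [h0]
  · rw [enorm_smul, enorm_smul]; gcongr; exact hξ h0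

theorem blk_zero (p : ℝ≥0∞) (j : ℤ) : blk P p j (fun _ => 0) = 0 := by
  simp [blk]

theorem blk_neg (p : ℝ≥0∞) (j : ℤ) (g : E3 → C3) : blk P p j (fun ξ => -g ξ) = blk P p j g := by
  refine eLpNorm_congr_enorm_ae (Eventually.of_forall fun ξ => ?_)
  simp

theorem blk_sub_comm (p : ℝ≥0∞) (j : ℤ) (g h : E3 → C3) :
    blk P p j (fun ξ => g ξ - h ξ) = blk P p j (fun ξ => h ξ - g ξ) := by
  rw [← blk_neg]; simp

theorem blk_add_le (hp : 1 ≤ p) (j : ℤ) {g g' : E3 → C3} (hg : AEStronglyMeasurable g volume)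
    (hg' : AEStronglyMeasurable g' volume) :
    blk P p j (fun ξ => g ξ + g' ξ) ≤ blk P p j g + blk P p j g' := by
  unfold blk
  refine le_trans (le_of_eq ?_) (eLpNorm_add_le
    ((continuous_piece P j).aestronglyMeasurable.smul hg)
    ((continuous_piece P j).aestronglyMeasurable.smul hg') hp)
  congr 1; ext1 ξ; simp [smul_add]

theorem blk_sub_le (hp : 1 ≤ p) (j : ℤ) {g g' : E3 → C3} (hg : AEStronglyMeasurable g volume)
    (hg' : AEStronglyMeasurable g' volume) :
    blk P p j (fun ξ => g ξ - g' ξ) ≤ blk P p j g + blk P p j g' := by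
  rw [← blk_neg P p j g']
  simp only [sub_eq_add_neg]
  exact blk_add_le P hp j hg hg'.neg

theorem blk_sub_le_sub_add_sub (hp : 1 ≤ p) (j : ℤ) {g g' g'' : E3 → C3}
    (hg : AEStronglyMeasurable g volume) (hg' : AEStronglyMeasurable g' volume)
    (hg'' : AEStronglyMeasurable g'' volume) :
    blk P p j (fun ξ => g ξ - g'' ξ) ≤
      blk P p j (fun ξ => g ξ - g' ξ) + blk P p j (fun ξ => g' ξ - g'' ξ) := by
  refine le_trans (le_of_eq ?_) (blk_add_le P hp j (hg.sub hg') (hg'.sub hg''))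
  congr 1; ext1 ξ; simp

theorem ae_eq_of_blk_sub_eq_zero (hp : 1 ≤ p) {g g' : E3 → C3}
    (hg : AEStronglyMeasurable g volume) (hg' : AEStronglyMeasurable g' volume)
    (h : ∀ j, blk P p j (fun ξ => g ξ - g' ξ) = 0) : g =ᵐ[volume] g' := by
  have h' : ∀ j, ∀ᵐ ξ, P.piece j ξ • (g ξ - g' ξ) = 0 := fun j => by
    exact (eLpNorm_eq_zero_iff ((continuous_piece P j).aestronglyMeasurable.smul (hg.sub hg'))
      (zero_lt_one.trans_le hp).ne').1 (h j)
  filter_upwards [ae_all_iff.2 h', ae_ne_zero] with ξ h1 h2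
  obtain ⟨j, hj⟩ := exists_piece_ne_zero P h2
  exact sub_eq_zero.1 ((smul_eq_zero.1 (h1 j)).resolve_left hj)

theorem inv_toReal_le_one (hp : 1 ≤ p) : (p⁻¹).toReal ≤ 1 := by
  rw [← ENNReal.toReal_one]
  exact ENNReal.toReal_mono ENNReal.one_ne_top (ENNReal.inv_le_one.2 hp)

/-- The constant in the embedding of `L^p` into `L^1` on a ball of radius `8/3`. -/
def ballConst (p : ℝ≥0∞) : ℝ≥0∞ :=
  (ENNReal.ofReal ((8 / 3 : ℝ) ^ 3) * volume (Metric.ball (0 : E3) 1)) ^ (1 - (p⁻¹).toReal)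

theorem ballConst_ne_top (hp : 1 ≤ p) : ballConst p ≠ ∞ := by
  refine ENNReal.rpow_ne_top_of_nonneg (by linarith [inv_toReal_le_one hp]) ?_
  exact ENNReal.mul_ne_top ENNReal.ofReal_ne_top measure_ball_lt_top.ne

/-- A Bernstein inequality: Hölder on the ball of radius `8/3 · 2^j` containing the shell, whose
volume to the power `1 - 1/p` gives `2^{j(3 - 3/p)}`. -/
theorem lintegral_piece_smul_le (hp : 1 ≤ p) (j : ℤ) {g : E3 → C3}
    (hg : AEStronglyMeasurable g volume) :
    ∫⁻ ξ, ‖P.piece j ξ • g ξ‖ₑ ≤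
      ballConst p * 2 ^ ((j : ℝ) * (3 - threeOver p)) * blk P p j g := by
  have hm : AEStronglyMeasurable (fun ξ => P.piece j ξ • g ξ) volume :=
    (continuous_piece P j).aestronglyMeasurable.smul hg
  set B := Metric.closedBall (0 : E3) (8 / 3 * (2 : ℝ) ^ j) with hB
  have hsupp : Function.support (fun ξ => P.piece j ξ • g ξ) ⊆ B := by
    intro ξ hξ
    have : P.piece j ξ ≠ 0 := fun h => hξ (by simp [h])
    simpa [hB] using (norm_bounds_of_piece_ne_zero P this).2
  have h1 := eLpNorm_le_eLpNorm_mul_rpow_measure_univ (μ := volume.restrict B) hp hm.restrict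
  rw [eLpNorm_restrict_eq_of_support_subset hsupp, eLpNorm_restrict_eq_of_support_subset hsupp,
    eLpNorm_one_eq_lintegral_enorm] at h1
  refine h1.trans (le_of_eq ?_)
  rw [mul_comm]
  congr 1
  have he : (1 : ℝ) / (1 : ℝ≥0∞).toReal - 1 / p.toReal = 1 - (p⁻¹).toReal := by
    rw [ENNReal.toReal_inv]; simp
  rw [he, Measure.restrict_apply_univ, hB, Measure.addHaar_closedBall _ _ (by positivity)]
  have hfr : Module.finrank ℝ E3 = 3 := by simp
  have hnn : 0 ≤ 1 - (p⁻¹).toReal := by linarith [inv_toReal_le_one hp]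
  have h2 : ENNReal.ofReal ((8 / 3 * (2 : ℝ) ^ j) ^ 3) =
      ENNReal.ofReal ((8 / 3 : ℝ) ^ 3) * 2 ^ ((j : ℝ) * 3) := by
    rw [mul_pow, ENNReal.ofReal_mul (by positivity), two_rpow_eq_ofReal]
    congr 2
    rw [← Real.rpow_intCast, ← Real.rpow_natCast, ← Real.rpow_mul (by norm_num)]
    norm_num
  rw [hfr, h2, mul_right_comm, ENNReal.mul_rpow_of_nonneg _ _ hnn, ← ENNReal.rpow_mul]
  unfold ballConst threeOver
  congr 2; ring

theorem measurable_blk (p : ℝ≥0∞) (j : ℤ) {U : ℝ → E3 → C3}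
    (hU : Measurable (Function.uncurry U)) : Measurable fun t => blk P p j (U t) := by
  simp only [blk_eq_eLpNorm_enorm]
  refine measurable_eLpNorm_left (volume : Measure E3) p
    (f := fun ξ t => ‖P.piece j ξ • U t ξ‖ₑ) ?_
  have h1 : Measurable fun z : E3 × ℝ => P.piece j z.1 • U z.2 z.1 :=
    ((measurable_piece P j).comp measurable_fst).smul (hU.comp measurable_swap)
  exact h1.enorm

end Blocks

section Norms

variable (P : DyadicPartition) {p q : ℝ≥0∞} {s : ℝ}

theorem fnNorm_congr (s : ℝ) (p q : ℝ≥0∞) {g g' : E3 → C3} (h : g =ᵐ[volume] g') :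
    fnNorm P s p q g = fnNorm P s p q g' := by
  simp only [fnNorm, blk_congr P p _ h]

theorem fnNorm_neg (g : E3 → C3) : fnNorm P s p q (fun ξ => -g ξ) = fnNorm P s p q g := by
  simp only [fnNorm, blk_neg]

theorem fnNorm_zero : fnNorm P s p q (fun _ => 0) = 0 := by
  simp only [fnNorm, blk_zero, wsn_zero]

theorem fnNorm_sub_comm (g h : E3 → C3) :
    fnNorm P s p q (fun ξ => g ξ - h ξ) = fnNorm P s p q (fun ξ => h ξ - g ξ) := by
  simp only [fnNorm, blk_sub_comm P p _ g h]

theorem fnNorm_add_le (hp : 1 ≤ p) (hq : 1 ≤ q) {g g' : E3 → C3}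
    (hg : AEStronglyMeasurable g volume) (hg' : AEStronglyMeasurable g' volume) :
    fnNorm P s p q (fun ξ => g ξ + g' ξ) ≤ fnNorm P s p q g + fnNorm P s p q g' :=
  (wsn_mono fun j => blk_add_le P hp j hg hg').trans (wsn_add_le hq _ _)

theorem fnNorm_sub_le (hp : 1 ≤ p) (hq : 1 ≤ q) {g g' : E3 → C3}
    (hg : AEStronglyMeasurable g volume) (hg' : AEStronglyMeasurable g' volume) :
    fnNorm P s p q (fun ξ => g ξ - g' ξ) ≤ fnNorm P s p q g + fnNorm P s p q g' :=
  (wsn_mono fun j => blk_sub_le P hp j hg hg').trans (wsn_add_le hq _ _)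

theorem fnNorm_sub_le_sub_add_sub (hp : 1 ≤ p) (hq : 1 ≤ q) {g g' g'' : E3 → C3}
    (hg : AEStronglyMeasurable g volume) (hg' : AEStronglyMeasurable g' volume)
    (hg'' : AEStronglyMeasurable g'' volume) :
    fnNorm P s p q (fun ξ => g ξ - g'' ξ) ≤
      fnNorm P s p q (fun ξ => g ξ - g' ξ) + fnNorm P s p q (fun ξ => g' ξ - g'' ξ) :=
  (wsn_mono fun j => blk_sub_le_sub_add_sub P hp j hg hg' hg'').trans (wsn_add_le hq _ _)

theorem ae_eq_of_fnNorm_sub_eq_zero (hp : 1 ≤ p) (hq : 1 ≤ q) {g g' : E3 → C3}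
    (hg : AEStronglyMeasurable g volume) (hg' : AEStronglyMeasurable g' volume)
    (h : fnNorm P s p q (fun ξ => g ξ - g' ξ) = 0) : g =ᵐ[volume] g' :=
  ae_eq_of_blk_sub_eq_zero P hp hg hg' fun j => eq_zero_of_wsn hq h j

theorem ae_blk_le_timeBlk (p : ℝ≥0∞) (U : ℝ → E3 → C3) :
    ∀ᵐ t ∂timeMeasure, ∀ j, blk P p j (U t) ≤ timeBlk P p U j := by
  rw [ae_all_iff]
  intro j
  simp only [timeBlk, eLpNorm_exponent_top, eLpNormEssSup, enorm_eq_self]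
  exact ENNReal.ae_le_essSup _

theorem timeBlk_le {U : ℝ → E3 → C3} {j : ℤ} {c : ℝ≥0∞}
    (h : ∀ᵐ t ∂timeMeasure, blk P p j (U t) ≤ c) : timeBlk P p U j ≤ c := by
  simp only [timeBlk, eLpNorm_exponent_top, eLpNormEssSup, enorm_eq_self]
  exact essSup_le_of_ae_le _ h

/-- The supremum in time sits inside the `ℓ^q` norm, so what is needed is one sequence that
dominates the blocks at almost every time. A bound on `fnNorm` at each time would not suffice. -/
theorem tnorm_le {U : ℝ → E3 → C3} {a : ℤ → ℝ≥0∞}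
    (h : ∀ᵐ t ∂timeMeasure, ∀ j, blk P p j (U t) ≤ a j) :
    tnorm P s p q U ≤ weightedSeqNorm s q a :=
  wsn_mono fun _ => timeBlk_le P (h.mono fun _ ht => ht _)

theorem tnorm_congr {U V : ℝ → E3 → C3} (h : ∀ᵐ t ∂timeMeasure, U t =ᵐ[volume] V t) :
    tnorm P s p q U = tnorm P s p q V := by
  unfold tnorm timeBlk
  congr 1; ext1 j
  refine eLpNorm_congr_ae ?_
  filter_upwards [h] with t ht
  exact blk_congr P p j ht

theorem ae_fnNorm_le_tnorm (U : ℝ → E3 → C3) :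
    ∀ᵐ t ∂timeMeasure, fnNorm P s p q (U t) ≤ tnorm P s p q U := by
  filter_upwards [ae_blk_le_timeBlk P p U] with t ht
  exact wsn_mono ht

theorem tnorm_add_le (hp : 1 ≤ p) (hq : 1 ≤ q) {U V : ℝ → E3 → C3}
    (hU : ∀ᵐ t ∂timeMeasure, AEStronglyMeasurable (U t) volume)
    (hV : ∀ᵐ t ∂timeMeasure, AEStronglyMeasurable (V t) volume) :
    tnorm P s p q (fun t ξ => U t ξ + V t ξ) ≤ tnorm P s p q U + tnorm P s p q V := by
  refine (tnorm_le P (a := fun j => timeBlk P p U j + timeBlk P p V j) ?_).trans (wsn_add_le hq _ _)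
  filter_upwards [ae_blk_le_timeBlk P p U, ae_blk_le_timeBlk P p V, hU, hV] with t h1 h2 h3 h4 j
  exact (blk_add_le P hp j h3 h4).trans (add_le_add (h1 j) (h2 j))

theorem tnorm_neg (U : ℝ → E3 → C3) :
    tnorm P s p q (fun t ξ => -U t ξ) = tnorm P s p q U := by
  have : timeBlk P p (fun t ξ => -U t ξ) = timeBlk P p U := by
    ext1 j; simp only [timeBlk, blk_neg]
  simp only [tnorm, this]

theorem tnorm_sub_le (hp : 1 ≤ p) (hq : 1 ≤ q) {U V : ℝ → E3 → C3}
    (hU : ∀ᵐ t ∂timeMeasure, AEStronglyMeasurable (U t) volume)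
    (hV : ∀ᵐ t ∂timeMeasure, AEStronglyMeasurable (V t) volume) :
    tnorm P s p q (fun t ξ => U t ξ - V t ξ) ≤ tnorm P s p q U + tnorm P s p q V := by
  rw [← tnorm_neg P V]
  simp only [sub_eq_add_neg]
  exact tnorm_add_le P hp hq hU (hV.mono fun t ht => ht.neg)

theorem tnorm_zero : tnorm P s p q (fun _ _ => 0) = 0 := by
  have : timeBlk P p (fun _ _ => (0 : C3)) = fun _ => 0 := by
    ext1 j; simp only [timeBlk, blk_zero]; exact eLpNorm_zero
  simp only [tnorm, this, wsn_zero]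

theorem ae_eq_of_tnorm_sub_eq_zero (hp : 1 ≤ p) (hq : 1 ≤ q) {U V : ℝ → E3 → C3}
    (hU : ∀ᵐ t ∂timeMeasure, AEStronglyMeasurable (U t) volume)
    (hV : ∀ᵐ t ∂timeMeasure, AEStronglyMeasurable (V t) volume)
    (h : tnorm P s p q (fun t ξ => U t ξ - V t ξ) = 0) :
    ∀ᵐ t ∂timeMeasure, U t =ᵐ[volume] V t := by
  filter_upwards [ae_fnNorm_le_tnorm P (s := s) (p := p) (q := q) (fun t ξ => U t ξ - V t ξ),
    hU, hV] with t ht h1 h2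
  rw [h] at ht
  exact ae_eq_of_fnNorm_sub_eq_zero P hp hq h1 h2 (le_antisymm ht zero_le)

theorem measurable_fnNorm {U : ℝ → E3 → C3} (hU : Measurable (Function.uncurry U)) :
    Measurable fun t => fnNorm P s p q (U t) :=
  measurable_wsn fun j => measurable_blk P p j hU

end Norms

/-! ### Completeness -/

section Completeness

variable (P : DyadicPartition) {p : ℝ≥0∞}

theorem ae_lt_top_of_eLpNorm_lt_top {α : Type*} [MeasurableSpace α] {μ : Measure α} {p : ℝ≥0∞}
    (hp : 1 ≤ p) {f : α → ℝ≥0∞} (hf : Measurable f) (h : eLpNorm f p μ < ∞) :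
    ∀ᵐ x ∂μ, f x < ∞ := by
  by_cases htop : p = ∞
  · subst htop
    rw [eLpNorm_exponent_top] at h
    filter_upwards [ae_le_eLpNormEssSup (f := f) (μ := μ)] with x hx
    exact lt_of_le_of_lt hx h
  · have h0 : p ≠ 0 := (zero_lt_one.trans_le hp).ne'
    have hr : 0 < p.toReal := ENNReal.toReal_pos h0 htop
    rw [eLpNorm_eq_lintegral_rpow_enorm_toReal h0 htop] at h
    simp only [enorm_eq_self] at h
    have h3 : ∫⁻ x, f x ^ p.toReal ∂μ ≠ ∞ := by
      intro hc
      rw [hc, ENNReal.top_rpow_of_pos (by positivity)] at h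
      exact lt_irrefl _ h
    filter_upwards [ae_lt_top (hf.pow_const _) h3] with x hx
    by_contra hcon
    rw [not_lt, top_le_iff] at hcon
    rw [hcon, ENNReal.top_rpow_of_pos hr] at hx
    exact lt_irrefl _ hx

theorem ae_tsum_piece_lt_top (hp : 1 ≤ p) {d : ℕ → E3 → C3} (hd : ∀ n, Measurable (d n)) (j : ℤ)
    (h : ∑' n, blk P p j (d n) < ∞) : ∀ᵐ ξ, ∑' n, ‖P.piece j ξ • d n ξ‖ₑ < ∞ := by
  have hm : ∀ n, Measurable fun ξ => ‖P.piece j ξ • d n ξ‖ₑ :=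
    fun n => (measurable_piece_smul P j (hd n)).enorm
  exact ae_lt_top_of_eLpNorm_lt_top hp (Measurable.tsum hm)
    ((eLpNorm_tsum_le (volume : Measure E3) hp hm).trans_lt
      (by simpa only [blk_eq_eLpNorm_enorm] using h))

theorem tendsto_sub_of_tsum_enorm {x : ℕ → C3} (h : ∑' n, ‖x (n + 1) - x n‖ₑ < ∞) :
    ∃ y, Tendsto x atTop (𝓝 y) := by
  have hs : Summable fun n => dist (x n) (x (n + 1)) := by
    have : Summable fun n => ‖x (n + 1) - x n‖ := by
      have h2 : Summable fun n => ‖x (n + 1) - x n‖₊ := by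
        rw [← ENNReal.tsum_coe_ne_top_iff_summable]
        exact h.ne
      exact NNReal.summable_coe.2 h2
    simpa only [dist_eq_norm, norm_sub_rev] using this
  exact cauchySeq_tendsto_of_complete (cauchySeq_of_summable_dist hs)

theorem enorm_lim_sub_le {x : ℕ → C3} {y : C3} (h : Tendsto x atTop (𝓝 y)) (n : ℕ) :
    ‖y - x n‖ₑ ≤ ∑' m, ‖x (n + m + 1) - x (n + m)‖ₑ := by
  have h1 : Tendsto (fun k => ‖x (n + k) - x n‖ₑ) atTop (𝓝 ‖y - x n‖ₑ) := by
    have : Tendsto (fun k => x (n + k)) atTop (𝓝 y) := by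
      simpa only [add_comm n] using (tendsto_add_atTop_iff_nat n).2 h
    exact (this.sub_const _).enorm
  refine le_of_tendsto' h1 fun k => ?_
  have h2 : x (n + k) - x n = ∑ m ∈ Finset.range k, (x (n + m + 1) - x (n + m)) := by
    exact (Finset.sum_range_sub (fun m => x (n + m)) k).symm
  rw [h2]
  exact (enorm_sum_le _ _).trans (ENNReal.sum_le_tsum _)

/-- Completeness of the Fourier-Besov norms, with joint measurability of the limit. -/
theorem exists_limit_of_tsum_blk (hp : 1 ≤ p) {U : ℕ → ℝ → E3 → C3}
    (hU : ∀ n, Measurable (Function.uncurry (U n)))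
    (h : ∀ᵐ t ∂timeMeasure, ∀ j, ∑' n, blk P p j (fun ξ => U (n + 1) t ξ - U n t ξ) < ∞) :
    ∃ V : ℝ → E3 → C3, Measurable (Function.uncurry V) ∧
      ∀ᵐ t ∂timeMeasure, ∀ n j, blk P p j (fun ξ => V t ξ - U n t ξ) ≤
        ∑' m, blk P p j (fun ξ => U (n + m + 1) t ξ - U (n + m) t ξ) := by
  -- The limit is taken pointwise in `(t, ξ)`; joint measurability then comes for free, which `L^p`
  -- limits at separate times would not provide.
  refine ⟨fun t ξ => limUnder atTop fun n => U n t ξ, ?_, ?_⟩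
  · exact (StronglyMeasurable.limUnder (f := fun n (z : ℝ × E3) => U n z.1 z.2) (l := atTop)
      fun n => (hU n).stronglyMeasurable).measurable
  · have hUt : ∀ n t, Measurable (U n t) := fun n t =>
      (hU n).comp (measurable_const.prodMk measurable_id)
    filter_upwards [h] with t ht n j
    have hlim : ∀ᵐ ξ, Tendsto (fun n => U n t ξ) atTop
        (𝓝 (limUnder atTop fun n => U n t ξ)) := by
      have h1 : ∀ᵐ ξ, ∀ j, ∑' n, ‖P.piece j ξ • (U (n + 1) t ξ - U n t ξ)‖ₑ < ∞ :=
        ae_all_iff.2 fun j => ae_tsum_piece_lt_top P hp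
          (fun n => (hUt (n + 1) t).sub (hUt n t)) j (ht j)
      filter_upwards [h1, ae_ne_zero] with ξ h2 h3
      -- Division by a nonzero value `φ_i(ξ)` removes the localization from the summability.
      obtain ⟨i, hi⟩ := exists_piece_ne_zero P h3
      have h4 : ‖P.piece i ξ‖ₑ * ∑' n, ‖U (n + 1) t ξ - U n t ξ‖ₑ < ∞ := by
        rw [← ENNReal.tsum_mul_left]
        simpa only [enorm_smul] using h2 i
      have h5 : ∑' n, ‖U (n + 1) t ξ - U n t ξ‖ₑ < ∞ :=
        ENNReal.lt_top_of_mul_ne_top_right h4.ne (enorm_ne_zero.2 hi)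
      exact tendsto_nhds_limUnder (tendsto_sub_of_tsum_enorm (x := fun n => U n t ξ) h5)
    simp only [blk_eq_eLpNorm_enorm]
    refine le_trans ?_ (eLpNorm_tsum_le (volume : Measure E3) hp fun m =>
      (measurable_piece_smul P j ((hUt (n + m + 1) t).sub (hUt (n + m) t))).enorm)
    refine eLpNorm_mono_enorm_ae ?_
    filter_upwards [hlim] with ξ hξ
    rw [enorm_eq_self, enorm_eq_self, enorm_smul]
    calc _ ≤ ‖P.piece j ξ‖ₑ * ∑' m, ‖U (n + m + 1) t ξ - U (n + m) t ξ‖ₑ := by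
          gcongr; exact enorm_lim_sub_le (x := fun n => U n t ξ) hξ n
      _ = _ := by rw [← ENNReal.tsum_mul_left]; simp only [enorm_smul]

end Completeness

/-! ### Tempered vector fields and their Fourier densities: norms -/

section Interface

variable (P : DyadicPartition) {p q : ℝ≥0∞} {s : ℝ}

theorem blockNorm_eq (p : ℝ≥0∞) (j : ℤ) {f : 𝓢'(E3, C3)} {g : E3 → C3}
    (h : HasFourierDensity f g) : blockNorm P p j f = blk P p j g := by
  refine le_antisymm (iInf₂_le g h) (le_iInf₂ fun g' hg' => ?_)
  exact (blk_congr P p j (h.unique hg')).le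

theorem fbNorm_eq (s : ℝ) (p q : ℝ≥0∞) {f : 𝓢'(E3, C3)} {g : E3 → C3}
    (h : HasFourierDensity f g) : fbNorm P s p q f = fnNorm P s p q g := by
  simp only [fbNorm, fnNorm, blockNorm_eq P p _ h]

/-- The infimum over an empty family of densities is `∞`, so finiteness of a single block, here the
one of index `0`, already exhibits a density. -/
theorem exists_density_of_fbNorm_lt_top (hq : 1 ≤ q) {f : 𝓢'(E3, C3)}
    (h : fbNorm P s p q f < ∞) : ∃ g, Measurable g ∧ HasFourierDensity f g := by
  have h1 : blockNorm P p 0 f < ∞ := lt_top_of_wsn hq h 0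
  unfold blockNorm at h1
  simp only [iInf_lt_iff] at h1
  obtain ⟨g, hg, -⟩ := h1
  have hm := hg.1.aestronglyMeasurable
  exact ⟨hm.mk g, hm.stronglyMeasurable_mk.measurable, hg.congr hm.ae_eq_mk⟩

theorem fbNorm_sub_comm (hq : 1 ≤ q) (f g : 𝓢'(E3, C3)) :
    fbNorm P s p q (f - g) = fbNorm P s p q (g - f) := by
  have key : ∀ f g : 𝓢'(E3, C3), fbNorm P s p q (g - f) ≤ fbNorm P s p q (f - g) := by
    intro f g
    rcases eq_or_ne (fbNorm P s p q (f - g)) ∞ with h | h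
    · rw [h]; exact le_top
    obtain ⟨d, hd, hfd⟩ := exists_density_of_fbNorm_lt_top P hq h.lt_top
    have h2 := hasFourierDensity_zero.sub hfd
    rw [zero_sub, neg_sub] at h2
    rw [fbNorm_eq P s p q hfd, fbNorm_eq P s p q h2]
    simp only [zero_sub, fnNorm_neg]
    exact le_rfl
  exact le_antisymm (key g f) (key f g)

theorem fbNorm_triangle (hp : 1 ≤ p) (hq : 1 ≤ q) (f g h : 𝓢'(E3, C3)) :
    fbNorm P s p q (f - h) ≤ fbNorm P s p q (f - g) + fbNorm P s p q (g - h) := by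
  rw [fbNorm_sub_comm P hq g h]
  rcases eq_or_ne (fbNorm P s p q (f - g)) ∞ with h1 | h1
  · simp [h1]
  rcases eq_or_ne (fbNorm P s p q (h - g)) ∞ with h2 | h2
  · simp [h2]
  obtain ⟨a, ha, hfa⟩ := exists_density_of_fbNorm_lt_top P hq h1.lt_top
  obtain ⟨b, hb, hfb⟩ := exists_density_of_fbNorm_lt_top P hq h2.lt_top
  have h3 := hfa.sub hfb
  rw [sub_sub_sub_cancel_right] at h3
  rw [fbNorm_eq P s p q hfa, fbNorm_eq P s p q hfb, fbNorm_eq P s p q h3]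
  exact fnNorm_sub_le P hp hq ha.aestronglyMeasurable hb.aestronglyMeasurable

theorem tsum_int_le (f : ℤ → ℝ≥0∞) :
    ∑' k : ℤ, f k ≤ ∑' n : ℕ, f n + ∑' n : ℕ, f (-n) := by
  rw [tsum_of_nat_of_neg_add_one ENNReal.summable ENNReal.summable]
  refine add_le_add le_rfl ?_
  have := ENNReal.tsum_comp_le_tsum_of_injective (add_left_injective 1) (fun n : ℕ => f (-n))
  simpa using this

/-- A function with finite Fourier-Besov norm of regularity `s < 3 - 3/p` is the Fourier transform
of a tempered vector field. -/
theorem exists_hasFourierDensity_of_fnNorm (hp : 1 ≤ p) (hq : 1 ≤ q)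
    (hs : 0 < 3 - threeOver p - s) {g : E3 → C3} (hg : Measurable g)
    (h : fnNorm P s p q g < ∞) : ∃ f, HasFourierDensity f g := by
  -- The block `k` has `L¹` norm at most a constant times `2^{kβ}`. This is summable as `k → -∞`
  -- with the weight bounded by one. As `k → ∞` the weight `(1 + |ξ|²)^{-β} ≤ c 2^{-2kβ}` leaves
  -- `2^{-kβ}`. The number `9/16` below is the square of the inner radius `3/4`.
  set β := 3 - threeOver p - s with hβ
  refine exists_hasFourierDensity hg β ?_
  set w : E3 → ℝ≥0∞ := fun ξ => ENNReal.ofReal ((1 + ‖ξ‖ ^ 2) ^ (-β)) with hw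
  have hwm : Measurable w := by
    refine ENNReal.measurable_ofReal.comp (Continuous.measurable ?_)
    exact Continuous.rpow_const (by fun_prop) fun ξ => Or.inl (by positivity)
  set c : ℝ≥0∞ := ENNReal.ofReal ((9 / 16 : ℝ) ^ (-β)) with hc
  have hw1 : ∀ ξ, w ξ ≤ 1 := fun ξ => by
    rw [hw, ENNReal.ofReal_le_one]
    exact Real.rpow_le_one_of_one_le_of_nonpos (by nlinarith [sq_nonneg ‖ξ‖]) (by linarith)
  have hw2 : ∀ (k : ℤ) ξ, P.piece k ξ ≠ 0 → w ξ ≤ c * 2 ^ (-(2 * k * β)) := by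
    intro k ξ hk
    have h1 := (norm_bounds_of_piece_ne_zero P hk).1
    have h2 : (9 / 16 : ℝ) * (2 : ℝ) ^ (2 * k : ℝ) ≤ 1 + ‖ξ‖ ^ 2 := by
      have e : (2 : ℝ) ^ (2 * k : ℝ) = ((2 : ℝ) ^ k) ^ 2 := by
        rw [mul_comm, Real.rpow_mul (by norm_num), Real.rpow_intCast, Real.rpow_ofNat]
      rw [e]
      have : (0 : ℝ) < 2 ^ k := by positivity
      nlinarith
    rw [hw, hc, two_rpow_eq_ofReal, ← ENNReal.ofReal_mul (by positivity)]
    refine ENNReal.ofReal_le_ofReal ?_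
    refine (Real.rpow_le_rpow_of_nonpos (by positivity) h2 (by linarith)).trans (le_of_eq ?_)
    rw [Real.mul_rpow (by norm_num) (by positivity), ← Real.rpow_mul (by norm_num)]
    congr 2; ring
  set N := fnNorm P s p q g with hN
  -- the bound on each dyadic piece
  have hpiece : ∀ k : ℤ, ∀ m : ℝ≥0∞, (∀ ξ, P.piece k ξ ≠ 0 → w ξ ≤ m) →
      ∫⁻ ξ, w ξ * ‖P.piece k ξ • g ξ‖ₑ ≤ ballConst p * N * (m * 2 ^ ((k : ℝ) * β)) := by
    intro k m hm
    calc ∫⁻ ξ, w ξ * ‖P.piece k ξ • g ξ‖ₑ ≤ ∫⁻ ξ, m * ‖P.piece k ξ • g ξ‖ₑ := by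
          refine lintegral_mono fun ξ => ?_
          by_cases h0 : P.piece k ξ = 0
          · simp [h0]
          · exact mul_le_mul_left (hm ξ h0) _
      _ = m * ∫⁻ ξ, ‖P.piece k ξ • g ξ‖ₑ :=
          lintegral_const_mul _ (measurable_piece_smul P k hg).enorm
      _ ≤ m * (ballConst p * 2 ^ ((k : ℝ) * (3 - threeOver p)) *
          (2 ^ (-((k : ℝ) * s)) * N)) := by
          gcongr
          refine (lintegral_piece_smul_le P hp k hg.aestronglyMeasurable).trans ?_
          gcongr
          exact le_wsn' hq (fun j => blk P p j g) k
      _ = _ := by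
          have : (2 : ℝ≥0∞) ^ ((k : ℝ) * β) =
              2 ^ ((k : ℝ) * (3 - threeOver p)) * 2 ^ (-((k : ℝ) * s)) := by
            rw [← two_rpow_add]; congr 1; rw [hβ]; ring
          rw [this]; ring
  have hG := tsum_two_rpow_neg_lt_top hs
  have h1 : ∫⁻ ξ, w ξ * ‖g ξ‖ₑ ≤ ∑' k : ℤ, ∫⁻ ξ, w ξ * ‖P.piece k ξ • g ξ‖ₑ := by
    have hsum := lintegral_tsum (μ := (volume : Measure E3))
      (f := fun (k : ℤ) ξ => w ξ * ‖P.piece k ξ • g ξ‖ₑ)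
      fun k => (hwm.mul (measurable_piece_smul P k hg).enorm).aemeasurable
    rw [← hsum]
    refine lintegral_mono_ae ?_
    filter_upwards [ae_ne_zero] with ξ hξ
    rw [ENNReal.tsum_mul_left]
    gcongr
    exact enorm_le_tsum_piece_smul P g hξ
  refine (h1.trans (tsum_int_le _)).trans_lt (ENNReal.add_lt_top.2 ⟨?_, ?_⟩)
  · refine lt_of_le_of_lt (b := ∑' n : ℕ, ballConst p * N * (c * 2 ^ (-((n : ℝ) * β)))) ?_ ?_
    · refine ENNReal.tsum_le_tsum fun n => (hpiece n _ (hw2 n)).trans (le_of_eq ?_)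
      rw [mul_assoc c, ← two_rpow_add]
      congr 3; push_cast; ring
    · rw [ENNReal.tsum_mul_left, ENNReal.tsum_mul_left]
      exact ENNReal.mul_lt_top (ENNReal.mul_lt_top (ballConst_ne_top hp).lt_top h)
        (ENNReal.mul_lt_top ENNReal.ofReal_lt_top hG)
  · refine lt_of_le_of_lt (b := ∑' n : ℕ, ballConst p * N * (1 * 2 ^ (-((n : ℝ) * β)))) ?_ ?_
    · refine ENNReal.tsum_le_tsum fun n => (hpiece (-n) 1 fun ξ _ => hw1 ξ).trans (le_of_eq ?_)
      congr 3; push_cast; ring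
    · rw [ENNReal.tsum_mul_left, ENNReal.tsum_mul_left]
      exact ENNReal.mul_lt_top (ENNReal.mul_lt_top (ballConst_ne_top hp).lt_top h)
        (ENNReal.mul_lt_top ENNReal.one_lt_top hG)

end Interface

/-! ### Separably valued functions and Bochner measurability -/

/-- `U` is almost everywhere separably valued in the Fourier-Besov space. -/
def SeparablyValued (P : DyadicPartition) (s : ℝ) (p q : ℝ≥0∞) (U : ℝ → E3 → C3) : Prop :=
  ∃ D : ℕ → E3 → C3, (∀ i, Measurable (D i) ∧ fnNorm P s p q (D i) < ∞) ∧
    ∀ᵐ t ∂timeMeasure, ∀ ε : ℝ≥0∞, 0 < ε → ∃ i, fnNorm P s p q (fun ξ => U t ξ - D i ξ) < ε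

theorem exists_half_pow_lt {ε : ℝ≥0∞} (h : 0 < ε) : ∃ k : ℕ, (2⁻¹ : ℝ≥0∞) ^ k < ε := by
  have := ENNReal.tendsto_pow_atTop_nhds_zero_of_lt_one (r := 2⁻¹) (by simp)
  exact ((tendsto_order.1 this).2 ε h).exists

theorem le_limsup_of_le_add {a : ℝ≥0∞} {b c : ℕ → ℝ≥0∞} (h : ∀ n, a ≤ b n + c n)
    (hc : Tendsto c atTop (𝓝 0)) : a ≤ limsup b atTop := by
  refine le_of_forall_gt fun x hx => ?_
  obtain ⟨y, hy1, hy2⟩ := exists_between hx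
  have h1 : ∀ᶠ n in atTop, b n < y := eventually_lt_of_limsup_lt hy1
  have h2 : Tendsto (fun n => y + c n) atTop (𝓝 (y + 0)) := tendsto_const_nhds.add hc
  rw [add_zero] at h2
  refine lt_of_le_of_lt (ge_of_tendsto h2 ?_) hy2
  filter_upwards [h1] with n hn
  exact (h n).trans (by gcongr)

section Versions

variable (P : DyadicPartition) {p q : ℝ≥0∞} {s : ℝ}

theorem measurable_section {U : ℝ → E3 → C3} (hU : Measurable (Function.uncurry U)) (t : ℝ) :
    Measurable (U t) := hU.comp (measurable_const.prodMk measurable_id)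

/-- All values of the simple functions form one countable set, from which a point within `2^{-k}` of
`u(t)` is selected measurably in `t`. -/
theorem exists_countable_approximation (hp : 1 ≤ p) (hq : 1 ≤ q) {u : ℝ → 𝓢'(E3, C3)}
    (hu : BochnerMeasurable P s p q u) :
    ∃ (e : ℕ → 𝓢'(E3, C3)) (N : ℕ → ℝ → ℕ), (∀ i, fbNorm P s p q (e i) < ∞) ∧
      (∀ k, Measurable (N k)) ∧
      ∀ᵐ t ∂timeMeasure, ∀ k, fbNorm P s p q (e (N k t) - u t) ≤ (2⁻¹ : ℝ≥0∞) ^ k := by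
  obtain ⟨S, hS, hlim⟩ := hu
  have hcount : (⋃ n, range (S n)).Countable :=
    countable_iUnion fun n => (S n).finite_range.countable
  have hne : (⋃ n, range (S n)).Nonempty := ⟨S 0 0, mem_iUnion.2 ⟨0, mem_range_self 0⟩⟩
  obtain ⟨e, he⟩ := hcount.exists_eq_range hne
  have hefin : ∀ i, fbNorm P s p q (e i) < ∞ := by
    intro i
    have : e i ∈ ⋃ n, range (S n) := he ▸ mem_range_self i
    obtain ⟨n, t, ht⟩ := mem_iUnion.1 this
    rw [← ht]; exact hS n t
  have hSe : ∀ n t, ∃ i, e i = S n t := by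
    intro n t
    have : S n t ∈ range e := he ▸ mem_iUnion.2 ⟨n, mem_range_self t⟩
    exact this
  -- The distance from `e i` to `u(t)` is not known to be measurable in `t`. This upper limit is,
  -- since each `S n` is simple, and it dominates that distance for almost every `t`.
  set h : ℕ → ℝ → ℝ≥0∞ := fun i t => limsup (fun n => fbNorm P s p q (e i - S n t)) atTop with hh
  have hmeas : ∀ i, Measurable (h i) := fun i =>
    Measurable.limsup fun n => ((S n).map fun y => fbNorm P s p q (e i - y)).measurable
  classical
  -- The second alternative only makes the search total; it is excluded at almost every time.
  have hex : ∀ (k : ℕ) (t : ℝ), ∃ i, h i t < (2⁻¹ : ℝ≥0∞) ^ k ∨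
      ∀ i', ¬ h i' t < (2⁻¹ : ℝ≥0∞) ^ k := by
    intro k t
    by_cases hc : ∃ i, h i t < (2⁻¹ : ℝ≥0∞) ^ k
    · exact hc.imp fun i hi => Or.inl hi
    · exact ⟨0, Or.inr (by simpa using hc)⟩
  refine ⟨e, fun k t => Nat.find (hex k t), hefin, fun k => measurable_find (hex k) fun i => ?_, ?_⟩
  · have h1 : ∀ i, MeasurableSet {t | h i t < (2⁻¹ : ℝ≥0∞) ^ k} :=
      fun i => measurableSet_lt (hmeas i) measurable_const
    have h2 : {t | ∀ i', ¬ h i' t < (2⁻¹ : ℝ≥0∞) ^ k} =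
        ⋂ i', {t | h i' t < (2⁻¹ : ℝ≥0∞) ^ k}ᶜ := by
      ext t; simp
    have h3 : MeasurableSet {t | ∀ i', ¬ h i' t < (2⁻¹ : ℝ≥0∞) ^ k} := by
      rw [h2]; exact MeasurableSet.iInter fun i' => (h1 i').compl
    exact (h1 i).union h3
  · filter_upwards [hlim] with t ht k
    have hle : ∀ i, fbNorm P s p q (e i - u t) ≤ h i t := fun i =>
      le_limsup_of_le_add (fun n => fbNorm_triangle P hp hq (e i) (S n t) (u t)) ht
    have hgood : ∃ i, h i t < (2⁻¹ : ℝ≥0∞) ^ k := by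
      -- Two errors of this size add up to `2^{-(k+1)}`, which is strictly below `2^{-k}`.
      have hpos : (0 : ℝ≥0∞) < (2⁻¹ : ℝ≥0∞) ^ (k + 1) / 2 :=
        ENNReal.half_pos (pow_ne_zero _ (by simp))
      have hev := (tendsto_order.1 ht).2 _ hpos
      obtain ⟨n, hn⟩ := hev.exists
      obtain ⟨i, hi⟩ := hSe n t
      refine ⟨i, lt_of_le_of_lt (b := (2⁻¹ : ℝ≥0∞) ^ (k + 1)) (limsup_le_of_le (by isBoundedDefault) ?_) ?_⟩
      · filter_upwards [hev] with m hm
        rw [hi]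
        refine (fbNorm_triangle P hp hq (S n t) (u t) (S m t)).trans ?_
        rw [fbNorm_sub_comm P hq (u t)]
        exact (add_le_add hn.le hm.le).trans (ENNReal.add_halves _).le
      · rw [pow_succ]
        refine (ENNReal.mul_lt_mul_iff_right (pow_ne_zero _ (by simp)) (by simp)).2 ?_ |>.trans_eq
          (mul_one _)
        simp
    rcases Nat.find_spec (hex k t) with h1 | h1
    · exact (hle _).trans h1.le
    · exact absurd hgood (by simpa using h1)

/-- A Bochner measurable vector field has a jointly measurable Fourier version. -/
theorem exists_measurable_version (hp : 1 ≤ p) (hq : 1 ≤ q) {u : ℝ → 𝓢'(E3, C3)}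
    (hu : BochnerMeasurable P s p q u) :
    ∃ U : ℝ → E3 → C3, Measurable (Function.uncurry U) ∧
      (∀ᵐ t ∂timeMeasure, HasFourierDensity (u t) (U t)) ∧ SeparablyValued P s p q U := by
  obtain ⟨e, N, hefin, hN, hap⟩ := exists_countable_approximation P hp hq hu
  choose D hDm hD using fun i => exists_density_of_fbNorm_lt_top P hq (hefin i)
  -- Only countably many functions of `ξ` occur and the index is measurable in `t`, so `W k` is
  -- jointly measurable. It converges geometrically to the density of `u(t)`.
  set W : ℕ → ℝ → E3 → C3 := fun k t => D (N k t) with hW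
  have hWm : ∀ k, Measurable (Function.uncurry (W k)) := by
    intro k
    have h1 : Measurable fun z : ℕ × E3 => D z.1 z.2 :=
      measurable_from_prod_countable_right fun i => hDm i
    exact h1.comp (((hN k).comp measurable_fst).prodMk measurable_snd)
  -- the densities at almost every time
  have hdens : ∀ᵐ t ∂timeMeasure, ∃ g : E3 → C3, Measurable g ∧ HasFourierDensity (u t) g ∧
      ∀ k, fnNorm P s p q (fun ξ => W k t ξ - g ξ) ≤ (2⁻¹ : ℝ≥0∞) ^ k := by
    filter_upwards [hap] with t ht
    obtain ⟨d, hdm, hd⟩ := exists_density_of_fbNorm_lt_top P hq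
      ((ht 0).trans_lt (by simp))
    -- `u(t) = e - (e - u(t))`, and both terms on the right have densities.
    have h1 := (hD (N 0 t)).sub hd
    rw [sub_sub_cancel] at h1
    refine ⟨_, (hDm (N 0 t)).sub hdm, h1, fun k => ?_⟩
    have h2 := (hD (N k t)).sub h1
    exact (fbNorm_eq P s p q h2).ge.trans (ht k)
  have hblk : ∀ᵐ t ∂timeMeasure, ∃ g : E3 → C3, Measurable g ∧ HasFourierDensity (u t) g ∧
      (∀ k, fnNorm P s p q (fun ξ => W k t ξ - g ξ) ≤ (2⁻¹ : ℝ≥0∞) ^ k) ∧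
      (∀ k j, blk P p j (fun ξ => W k t ξ - g ξ) ≤ 2 ^ (-((j : ℝ) * s)) * (2⁻¹ : ℝ≥0∞) ^ k) ∧
      ∀ j, ∑' n, blk P p j (fun ξ => W (n + 1) t ξ - W n t ξ) < ∞ := by
    filter_upwards [hdens] with t ⟨g, hgm, hg, hk⟩
    have hb : ∀ k j, blk P p j (fun ξ => W k t ξ - g ξ) ≤
        2 ^ (-((j : ℝ) * s)) * (2⁻¹ : ℝ≥0∞) ^ k := fun k j =>
      (le_wsn' hq (fun j => blk P p j (fun ξ => W k t ξ - g ξ)) j).trans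
        (mul_le_mul_right (hk k) _)
    refine ⟨g, hgm, hg, hk, hb, fun j => ?_⟩
    refine lt_of_le_of_lt (b := ∑' n : ℕ, 2 ^ (-((j : ℝ) * s)) * 2 * (2⁻¹ : ℝ≥0∞) ^ n) ?_ ?_
    · refine ENNReal.tsum_le_tsum fun n => ?_
      refine (blk_sub_le_sub_add_sub P hp j (measurable_section (hWm (n + 1)) t).aestronglyMeasurable
        hgm.aestronglyMeasurable (measurable_section (hWm n) t).aestronglyMeasurable).trans ?_
      rw [blk_sub_comm P p j g]
      refine (add_le_add ((hb (n + 1) j).trans (mul_le_mul_right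
        (pow_le_pow_right_of_le_one' (by simp) (Nat.le_succ n)) _)) (hb n j)).trans (le_of_eq ?_)
      ring
    · rw [ENNReal.tsum_mul_left, ENNReal.tsum_geometric]
      refine ENNReal.mul_lt_top (ENNReal.mul_lt_top (two_rpow_ne_top _).lt_top (by simp)) ?_
      rw [ENNReal.one_sub_inv_two]; simp
  obtain ⟨V, hVm, hV⟩ := exists_limit_of_tsum_blk P hp hWm
    (hblk.mono fun t ⟨g, _, _, _, _, h⟩ => h)
  have hVg : ∀ᵐ t ∂timeMeasure, ∃ g : E3 → C3, HasFourierDensity (u t) g ∧ V t =ᵐ[volume] g ∧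
      ∀ k, fnNorm P s p q (fun ξ => W k t ξ - g ξ) ≤ (2⁻¹ : ℝ≥0∞) ^ k := by
    filter_upwards [hblk, hV] with t ⟨g, hgm, hg, hk, hb, hsum⟩ hVt
    refine ⟨g, hg, ae_eq_of_blk_sub_eq_zero P hp (measurable_section hVm t).aestronglyMeasurable
      hgm.aestronglyMeasurable fun j => ?_, hk⟩
    -- The block of `V - g` is at most that of `V - W n`, a tail of a convergent series, plus that
    -- of `W n - g`, which is `O(2^{-n})`.
    have t1 := ENNReal.tendsto_sum_nat_add _ (hsum j).ne
    have t2 : Tendsto (fun n : ℕ => 2 ^ (-((j : ℝ) * s)) * (2⁻¹ : ℝ≥0∞) ^ n) atTop (𝓝 0) := by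
      have := ENNReal.Tendsto.const_mul (a := 2 ^ (-((j : ℝ) * s)))
        (ENNReal.tendsto_pow_atTop_nhds_zero_of_lt_one (r := 2⁻¹) (by simp))
        (Or.inr (two_rpow_ne_top _))
      simpa using this
    have t3 := t1.add t2
    rw [add_zero] at t3
    refine le_antisymm (ge_of_tendsto' t3 fun n => ?_) zero_le
    refine (blk_sub_le_sub_add_sub P hp j (measurable_section hVm t).aestronglyMeasurable
      (measurable_section (hWm n) t).aestronglyMeasurable hgm.aestronglyMeasurable).trans ?_
    refine add_le_add ((hVt n j).trans (le_of_eq (tsum_congr fun m => ?_))) (hb n j)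
    rw [add_comm n m]
  refine ⟨V, hVm, ?_, D, fun i => ⟨hDm i, ?_⟩, ?_⟩
  · filter_upwards [hVg] with t ⟨g, hg, hVt, _⟩
    exact hg.congr hVt.symm
  · rw [← fbNorm_eq P s p q (hD i)]; exact hefin i
  · filter_upwards [hVg] with t ⟨g, hg, hVt, hk⟩ ε hε
    obtain ⟨k, hkε⟩ := exists_half_pow_lt hε
    refine ⟨N k t, lt_of_le_of_lt ?_ hkε⟩
    rw [fnNorm_sub_comm]
    refine le_trans (le_of_eq (fnNorm_congr P s p q ?_)) (hk k)
    filter_upwards [hVt] with ξ hξ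
    rw [hξ]

theorem timeNorm_eq_tnorm {u : ℝ → 𝓢'(E3, C3)} {U : ℝ → E3 → C3}
    (h : ∀ᵐ t ∂timeMeasure, HasFourierDensity (u t) (U t)) :
    timeNorm P s p q u = tnorm P s p q U := by
  unfold timeNorm tnorm timeBlk
  congr 1; ext1 j
  refine eLpNorm_congr_ae ?_
  filter_upwards [h] with t ht
  exact blockNorm_eq P p j ht

/-- With `h i t` the distance from `U(t)` to the `i`-th point of a dense sequence, the minimizing
indices produce the simple functions required by `BochnerMeasurable`. -/
theorem exists_nearest_index {h : ℕ → ℝ → ℝ≥0∞} (hm : ∀ i, Measurable (h i)) (n : ℕ) :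
    ∃ N : SimpleFunc ℝ ℕ, ∀ t, ∀ i ≤ n, h (N t) t ≤ h i t := by
  induction n with
  | zero => exact ⟨SimpleFunc.const ℝ 0, fun t i hi => by simp [Nat.le_zero.1 hi]⟩
  | succ n ih =>
    obtain ⟨N, hN⟩ := ih
    have h1 : Measurable fun z : ℕ × ℝ => h z.1 z.2 :=
      measurable_from_prod_countable_right fun i => hm i
    have h2 : Measurable fun t => h (N t) t := h1.comp (N.measurable.prodMk measurable_id)
    have h3 : MeasurableSet {t | h (n + 1) t < h (N t) t} := measurableSet_lt (hm (n + 1)) h2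
    refine ⟨SimpleFunc.piecewise _ h3 (SimpleFunc.const ℝ (n + 1)) N, fun t i hi => ?_⟩
    rw [SimpleFunc.coe_piecewise]
    simp only [Set.piecewise, SimpleFunc.const_apply, Set.mem_ofPred_eq]
    split_ifs with ht
    · rcases Nat.le_succ_iff.1 hi with h4 | h4
      · exact ht.le.trans (hN t i h4)
      · rw [h4]
    · rcases Nat.le_succ_iff.1 hi with h4 | h4
      · exact hN t i h4
      · rw [h4]; exact not_lt.1 ht

/-- A jointly measurable, separably valued `U` of finite norm is the Fourier version of an element
of `𝓛^∞(I; FḂ^s_{p,q})`. -/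
theorem exists_memTime (hp : 1 ≤ p) (hq : 1 ≤ q) (hs : 0 < 3 - threeOver p - s)
    {U : ℝ → E3 → C3} (hU : Measurable (Function.uncurry U)) (hsep : SeparablyValued P s p q U)
    (hfin : tnorm P s p q U < ∞) :
    ∃ u : ℝ → 𝓢'(E3, C3), MemTime P s p q u ∧
      ∀ᵐ t ∂timeMeasure, HasFourierDensity (u t) (U t) := by
  classical
  obtain ⟨D, hD, hap⟩ := hsep
  choose d hd using fun i => exists_hasFourierDensity_of_fnNorm P hp hq hs (hD i).1 (hD i).2
  -- At the exceptional times of infinite norm, a null set, the value is `0`.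
  have hex : ∀ t, ∃ f, fnNorm P s p q (U t) < ∞ → HasFourierDensity f (U t) := by
    intro t
    by_cases h : fnNorm P s p q (U t) < ∞
    · obtain ⟨f, hf⟩ := exists_hasFourierDensity_of_fnNorm P hp hq hs (measurable_section hU t) h
      exact ⟨f, fun _ => hf⟩
    · exact ⟨0, fun h' => absurd h' h⟩
  choose u hu using hex
  have hdens : ∀ᵐ t ∂timeMeasure, HasFourierDensity (u t) (U t) := by
    filter_upwards [ae_fnNorm_le_tnorm P (s := s) (p := p) (q := q) U] with t ht
    exact hu t (ht.trans_lt hfin)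
  refine ⟨u, ⟨?_, ?_⟩, hdens⟩
  · have hm : ∀ i, Measurable fun t => fnNorm P s p q (fun ξ => U t ξ - D i ξ) := fun i =>
      measurable_fnNorm P (U := fun t ξ => U t ξ - D i ξ)
        (hU.sub ((hD i).1.comp measurable_snd))
    choose N hN using exists_nearest_index hm
    refine ⟨fun n => (N n).map d, fun n t => ?_, ?_⟩
    · rw [SimpleFunc.map_apply, fbNorm_eq P s p q (hd _)]
      exact (hD _).2
    · filter_upwards [hap, hdens] with t ht hut
      rw [ENNReal.tendsto_nhds_zero]
      intro ε hε
      obtain ⟨i, hi⟩ := ht ε hε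
      filter_upwards [eventually_ge_atTop i] with n hn
      rw [SimpleFunc.map_apply, fbNorm_sub_comm P hq, fbNorm_eq P s p q (hut.sub (hd _))]
      exact (hN n t i hn).trans hi.le
  · rw [timeNorm_eq_tnorm P hdens]; exact hfin

end Versions

section SeparablyValued

variable {P : DyadicPartition} {p q : ℝ≥0∞} {s : ℝ}

theorem SeparablyValued.of_countable {ι : Type*} [Countable ι] [Nonempty ι] {U : ℝ → E3 → C3}
    (D : ι → E3 → C3) (hD : ∀ i, Measurable (D i) ∧ fnNorm P s p q (D i) < ∞)
    (h : ∀ᵐ t ∂timeMeasure, ∀ ε : ℝ≥0∞, 0 < ε → ∃ i, fnNorm P s p q (fun ξ => U t ξ - D i ξ) < ε) :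
    SeparablyValued P s p q U := by
  obtain ⟨e, he⟩ := exists_surjective_nat ι
  refine ⟨fun n => D (e n), fun n => hD _, h.mono fun t ht ε hε => ?_⟩
  obtain ⟨i, hi⟩ := ht ε hε
  obtain ⟨n, rfl⟩ := he i
  exact ⟨n, hi⟩

theorem SeparablyValued.of_approx (hp : 1 ≤ p) (hq : 1 ≤ q) {ι : Type*} [Countable ι] [Nonempty ι]
    {U : ℝ → E3 → C3} {V : ι → ℝ → E3 → C3} (hU : ∀ t, Measurable (U t))
    (hV : ∀ i t, Measurable (V i t)) (hsep : ∀ i, SeparablyValued P s p q (V i))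
    (h : ∀ᵐ t ∂timeMeasure, ∀ ε : ℝ≥0∞, 0 < ε →
      ∃ i, fnNorm P s p q (fun ξ => U t ξ - V i t ξ) < ε) :
    SeparablyValued P s p q U := by
  choose D hD hap using hsep
  refine SeparablyValued.of_countable (ι := ι × ℕ) (fun x => D x.1 x.2) (fun x => hD x.1 x.2) ?_
  filter_upwards [h, ae_all_iff.2 hap] with t h1 h2 ε hε
  obtain ⟨i, hi⟩ := h1 (ε / 2) (ENNReal.half_pos hε.ne')
  obtain ⟨n, hn⟩ := h2 i (ε / 2) (ENNReal.half_pos hε.ne')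
  refine ⟨(i, n), ?_⟩
  refine (fnNorm_sub_le_sub_add_sub P hp hq (hU t).aestronglyMeasurable
    (hV i t).aestronglyMeasurable (hD i n).1.aestronglyMeasurable).trans_lt ?_
  exact (ENNReal.add_lt_add hi hn).trans_eq (ENNReal.add_halves ε)

theorem SeparablyValued.add (hp : 1 ≤ p) (hq : 1 ≤ q) {U V : ℝ → E3 → C3}
    (hU : ∀ t, Measurable (U t)) (hV : ∀ t, Measurable (V t)) (hsU : SeparablyValued P s p q U)
    (hsV : SeparablyValued P s p q V) : SeparablyValued P s p q (fun t ξ => U t ξ + V t ξ) := by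
  obtain ⟨D, hD, hapD⟩ := hsU
  obtain ⟨D', hD', hapD'⟩ := hsV
  refine SeparablyValued.of_countable (ι := ℕ × ℕ) (fun x ξ => D x.1 ξ + D' x.2 ξ)
    (fun x => ⟨(hD _).1.add (hD' _).1, ?_⟩) ?_
  · exact (fnNorm_add_le P hp hq (hD _).1.aestronglyMeasurable
      (hD' _).1.aestronglyMeasurable).trans_lt (ENNReal.add_lt_top.2 ⟨(hD _).2, (hD' _).2⟩)
  · filter_upwards [hapD, hapD'] with t h1 h2 ε hε
    obtain ⟨i, hi⟩ := h1 (ε / 2) (ENNReal.half_pos hε.ne')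
    obtain ⟨n, hn⟩ := h2 (ε / 2) (ENNReal.half_pos hε.ne')
    refine ⟨(i, n), ?_⟩
    refine lt_of_le_of_lt (le_trans (le_of_eq ?_) (fnNorm_add_le P hp hq
      ((hU t).sub (hD i).1).aestronglyMeasurable ((hV t).sub (hD' n).1).aestronglyMeasurable))
      ((ENNReal.add_lt_add hi hn).trans_eq (ENNReal.add_halves ε))
    congr 1; ext1 ξ
    simp only [Pi.sub_apply]
    abel

theorem SeparablyValued.neg {U : ℝ → E3 → C3} (hsU : SeparablyValued P s p q U) :
    SeparablyValued P s p q (fun t ξ => -U t ξ) := by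
  obtain ⟨D, hD, hapD⟩ := hsU
  refine ⟨fun i ξ => -D i ξ, fun i => ⟨(hD i).1.neg, by rw [fnNorm_neg]; exact (hD i).2⟩, ?_⟩
  filter_upwards [hapD] with t h1 ε hε
  obtain ⟨i, hi⟩ := h1 ε hε
  refine ⟨i, ?_⟩
  rw [fnNorm_sub_comm] at hi
  convert hi using 2
  ext1 ξ; abel

theorem SeparablyValued.sub (hp : 1 ≤ p) (hq : 1 ≤ q) {U V : ℝ → E3 → C3}
    (hU : ∀ t, Measurable (U t)) (hV : ∀ t, Measurable (V t)) (hsU : SeparablyValued P s p q U)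
    (hsV : SeparablyValued P s p q V) : SeparablyValued P s p q (fun t ξ => U t ξ - V t ξ) := by
  simp only [sub_eq_add_neg]
  exact hsU.add hp hq hU (fun t => (hV t).neg) hsV.neg

theorem ae_timeMeasure_pos : ∀ᵐ t ∂timeMeasure, 0 < t := ae_restrict_mem measurableSet_Ioi

/-- The values at positive rational times form the countable dense family. -/
theorem SeparablyValued.of_continuous {U : ℝ → E3 → C3} (hU : ∀ t, Measurable (U t))
    (hfin : ∀ t, 0 < t → fnNorm P s p q (U t) < ∞)
    (h : ∀ t, 0 < t → ∀ ε : ℝ≥0∞, 0 < ε → ∀ᶠ r in 𝓝 t,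
      fnNorm P s p q (fun ξ => U t ξ - U r ξ) < ε) : SeparablyValued P s p q U := by
  have : Nonempty {r : ℚ // 0 < r} := ⟨⟨1, one_pos⟩⟩
  refine SeparablyValued.of_countable (ι := {r : ℚ // 0 < r}) (fun r => U r)
    (fun r => ⟨hU _, hfin _ (by exact_mod_cast r.2)⟩) ?_
  filter_upwards [ae_timeMeasure_pos] with t ht ε hε
  have h1 := (h t ht ε hε).and (lt_mem_nhds ht)
  obtain ⟨δ, hδ, hball⟩ := Metric.eventually_nhds_iff.1 h1
  obtain ⟨r, hr1, hr2⟩ := exists_rat_btwn (show t < t + δ by linarith)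
  have h2 := hball (y := r) (by
    rw [Real.dist_eq, abs_lt]; constructor <;> linarith)
  exact ⟨⟨r, by exact_mod_cast h2.2⟩, h2.1⟩

end SeparablyValued

/-! ### The product estimate -/

section Product

variable (P : DyadicPartition) {p q : ℝ≥0∞} {s : ℝ}

/-- The ball of radius `8/3 2^l`, which contains the support of `φ_l`. -/
def dyadicBall (l : ℤ) : Set E3 := Metric.closedBall 0 (8 / 3 * (2 : ℝ) ^ l)

/-- The ball meets only the shells of index at most `l + 1`. Bernstein bounds the `L¹` norm of the
`k`-th piece by a multiple of `2^{kβ}`, and the geometric sum over `k ≤ l + 1` is of the size of its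
largest term. -/
theorem lintegral_dyadicBall_le (hp : 1 ≤ p) (hq : 1 ≤ q) {β : ℝ} (hβ : β = 3 - threeOver p - s)
    {V : E3 → C3} (hV : Measurable V) {a : ℤ → ℝ≥0∞} (ha : ∀ j, blk P p j V ≤ a j) (l : ℤ) :
    ∫⁻ η in dyadicBall l, ‖V η‖ₑ ≤ ballConst p * 2 ^ (((l : ℝ) + 1) * β) *
      (∑' n : ℕ, (2 : ℝ≥0∞) ^ (-((n : ℝ) * β))) * weightedSeqNorm s q a := by
  have h1 : ∫⁻ η in dyadicBall l, ‖V η‖ₑ ≤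
      ∫⁻ η in dyadicBall l, ∑' n : ℕ, ‖P.piece (l + 1 - n) η • V η‖ₑ := by
    refine lintegral_mono_ae ?_
    filter_upwards [ae_restrict_of_ae ae_ne_zero,
      ae_restrict_mem (Metric.isClosed_closedBall.measurableSet)] with η h0 hη
    refine (enorm_le_tsum_piece_smul P V h0).trans (le_of_eq ?_)
    refine (Function.Injective.tsum_eq (g := fun n : ℕ => l + 1 - (n : ℤ))
      (fun x y h => by simpa using h) ?_).symm
    intro k hk
    have hk' : P.piece k η ≠ 0 := fun h => hk (by simp [h])
    have h2 := (norm_bounds_of_piece_ne_zero P hk').1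
    have h3 : ‖η‖ ≤ 8 / 3 * (2 : ℝ) ^ l := by simpa [dyadicBall] using hη
    -- From `3/4 · 2^k ≤ ‖η‖ ≤ 8/3 · 2^l` and `32/9 < 4`.
    have h4 : (2 : ℝ) ^ k < 2 ^ (l + 2) := by
      rw [zpow_add₀ two_ne_zero]
      have : (0 : ℝ) < 2 ^ l := by positivity
      norm_num
      linarith
    have h5 : k < l + 2 := (zpow_lt_zpow_iff_right₀ (by norm_num)).1 h4
    refine ⟨(l + 1 - k).toNat, ?_⟩
    have : 0 ≤ l + 1 - k := by omega
    simp only [Int.toNat_of_nonneg this]; ring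
  refine h1.trans ?_
  rw [lintegral_tsum fun n => ((measurable_piece_smul P _ hV).enorm).aemeasurable]
  rw [mul_assoc, mul_comm (∑' n : ℕ, _), ← mul_assoc, ← ENNReal.tsum_mul_left]
  refine ENNReal.tsum_le_tsum fun n => (setLIntegral_le_lintegral _ _).trans ?_
  refine (lintegral_piece_smul_le P hp _ hV.aestronglyMeasurable).trans ?_
  calc ballConst p * 2 ^ (((l + 1 - n : ℤ) : ℝ) * (3 - threeOver p)) * blk P p (l + 1 - n) V
      ≤ ballConst p * 2 ^ (((l + 1 - n : ℤ) : ℝ) * (3 - threeOver p)) *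
        (2 ^ (-(((l + 1 - n : ℤ) : ℝ) * s)) * weightedSeqNorm s q a) := by
        gcongr
        exact (ha _).trans (le_wsn' hq a _)
    _ = _ := by
        have : (2 : ℝ≥0∞) ^ (((l : ℝ) + 1) * β) * 2 ^ (-((n : ℝ) * β)) =
            2 ^ (((l + 1 - n : ℤ) : ℝ) * (3 - threeOver p)) *
              2 ^ (-(((l + 1 - n : ℤ) : ℝ) * s)) := by
          rw [← two_rpow_add, ← two_rpow_add]
          congr 1
          rw [hβ]; push_cast; ring
        calc _ = ballConst p * (2 ^ (((l + 1 - n : ℤ) : ℝ) * (3 - threeOver p)) *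
              2 ^ (-(((l + 1 - n : ℤ) : ℝ) * s))) * weightedSeqNorm s q a := by ring
          _ = _ := by rw [← this]; ring

/-- The convolution of `|V|`, restricted to a dyadic ball, with a dyadic piece of `|W|`. -/
def convPiece (V W : E3 → C3) (l : ℤ) (ξ : E3) : ℝ≥0∞ :=
  ∫⁻ η in dyadicBall l, ‖V η‖ₑ * ‖P.piece l (ξ - η) • W (ξ - η)‖ₑ

/-- The convolution of `|V|` and `|W|`. -/
def absConv (V W : E3 → C3) (ξ : E3) : ℝ≥0∞ := ∫⁻ η, ‖V η‖ₑ * ‖W (ξ - η)‖ₑ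

variable {V W : E3 → C3}

theorem measurable_convPiece_integrand (hV : Measurable V) (hW : Measurable W) (l : ℤ) :
    Measurable (Function.uncurry fun (ξ η : E3) =>
      ‖V η‖ₑ * ‖P.piece l (ξ - η) • W (ξ - η)‖ₑ) :=
  (hV.comp measurable_snd).enorm.mul
    ((measurable_piece_smul P l hW).comp (measurable_fst.sub measurable_snd)).enorm

theorem measurable_convPiece (hV : Measurable V) (hW : Measurable W) (l : ℤ) :
    Measurable (convPiece P V W l) :=
  (measurable_convPiece_integrand P hV hW l).lintegral_prod_right'

/-- Young's inequality `L¹ * L^p ⊆ L^p`, obtained from Minkowski's inequality and translation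
invariance. -/
theorem eLpNorm_convPiece_le (hp : 1 ≤ p) (hV : Measurable V) (hW : Measurable W) (l : ℤ) :
    eLpNorm (convPiece P V W l) p volume ≤ (∫⁻ η in dyadicBall l, ‖V η‖ₑ) * blk P p l W := by
  refine (eLpNorm_lintegral_le volume (volume.restrict (dyadicBall l)) hp
    (measurable_convPiece_integrand P hV hW l)).trans ?_
  rw [← lintegral_mul_const _ hV.enorm]
  refine lintegral_mono fun η => ?_
  have hm : Measurable fun ξ => ‖P.piece l (ξ - η) • W (ξ - η)‖ₑ :=
    ((measurable_piece_smul P l hW).comp (measurable_id.sub_const η)).enorm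
  rw [eLpNorm_mul_const _ _ _ hm, blk_eq_eLpNorm_enorm]
  refine le_of_eq ?_
  congr 1
  exact eLpNorm_comp_measurePreserving (g := fun ξ => ‖P.piece l ξ • W ξ‖ₑ)
    (measurable_piece_smul P l hW).enorm.aestronglyMeasurable
    (measurePreserving_sub_right volume η)

/-- In the region `‖η‖ ≤ ‖ξ - η‖` the second factor carries the larger frequency. Decomposing only
that factor puts `η` in the ball attached to its shell, so this one case replaces a low-high and a
high-high term. -/
theorem absConv_half_le (hV : Measurable V) (hW : Measurable W) {j : ℤ} {ξ : E3}
    (hξ : P.piece j ξ ≠ 0) :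
    ∫⁻ η, {η : E3 | ‖η‖ ≤ ‖ξ - η‖}.indicator (fun η => ‖V η‖ₑ * ‖W (ξ - η)‖ₑ) η ≤
      ∑' n : ℕ, convPiece P V W (j - 2 + n) ξ := by
  have hint : ∀ l : ℤ, convPiece P V W l ξ = ∫⁻ η, (dyadicBall l).indicator
      (fun η => ‖V η‖ₑ * ‖P.piece l (ξ - η) • W (ξ - η)‖ₑ) η := fun l =>
    (lintegral_indicator Metric.isClosed_closedBall.measurableSet _).symm
  simp only [hint]
  have hm : ∀ l : ℤ, Measurable ((dyadicBall l).indicator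
      (fun η => ‖V η‖ₑ * ‖P.piece l (ξ - η) • W (ξ - η)‖ₑ)) := fun l =>
    ((measurable_convPiece_integrand P hV hW l).comp
      (measurable_const.prodMk measurable_id)).indicator Metric.isClosed_closedBall.measurableSet
  rw [← lintegral_tsum fun n => (hm _).aemeasurable]
  refine lintegral_mono_ae ?_
  have hne : ∀ᵐ η : E3, η ≠ ξ := by rw [ae_iff]; simp
  filter_upwards [hne] with η hη
  by_cases hle : ‖η‖ ≤ ‖ξ - η‖
  swap
  · rw [indicator_of_notMem (show η ∉ {η : E3 | ‖η‖ ≤ ‖ξ - η‖} from hle)]; exact zero_le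
  rw [indicator_of_mem (show η ∈ {η : E3 | ‖η‖ ≤ ‖ξ - η‖} from hle)]
  have hζ : ξ - η ≠ 0 := sub_ne_zero.2 hη.symm
  have h1 := enorm_le_tsum_piece_smul P W hζ
  have h2 : ∑' k : ℤ, ‖P.piece k (ξ - η) • W (ξ - η)‖ₑ =
      ∑' n : ℕ, ‖P.piece (j - 2 + n) (ξ - η) • W (ξ - η)‖ₑ := by
    refine (Function.Injective.tsum_eq (g := fun n : ℕ => j - 2 + (n : ℤ))
      (fun x y h => by simpa using h) ?_).symm
    intro k hk
    have hk' : P.piece k (ξ - η) ≠ 0 := fun h => hk (by simp [h])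
    have h3 := (norm_bounds_of_piece_ne_zero P hk').2
    have h4 := (norm_bounds_of_piece_ne_zero P hξ).1
    have h5 : ‖ξ‖ ≤ 2 * ‖ξ - η‖ := by
      calc ‖ξ‖ = ‖(ξ - η) + η‖ := by rw [sub_add_cancel]
        _ ≤ ‖ξ - η‖ + ‖η‖ := norm_add_le _ _
        _ ≤ _ := by linarith
    -- From `3/4 · 2^j ≤ ‖ξ‖ ≤ 2‖ξ - η‖ ≤ 16/3 · 2^k` and `64/9 < 8`; this is the origin of the
    -- starting index `j - 2`.
    have h6 : (2 : ℝ) ^ j < 2 ^ (k + 3) := by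
      rw [zpow_add₀ two_ne_zero]
      have : (0 : ℝ) < 2 ^ k := by positivity
      norm_num
      linarith
    have h7 : j < k + 3 := (zpow_lt_zpow_iff_right₀ (by norm_num)).1 h6
    refine ⟨(k - (j - 2)).toNat, ?_⟩
    have : 0 ≤ k - (j - 2) := by omega
    simp only [Int.toNat_of_nonneg this]; ring
  rw [h2] at h1
  refine (mul_le_mul_right h1 ‖V η‖ₑ).trans ?_
  rw [← ENNReal.tsum_mul_left]
  refine ENNReal.tsum_le_tsum fun n => ?_
  by_cases h0 : P.piece (j - 2 + n) (ξ - η) = 0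
  · simp [h0]
  · have h3 := (norm_bounds_of_piece_ne_zero P h0).2
    have : η ∈ dyadicBall (j - 2 + n) := by
      simpa [dyadicBall] using hle.trans h3
    rw [indicator_of_mem this]

/-- The complementary region is carried to the first one by `η ↦ ξ - η`, which exchanges the two
factors. -/
theorem absConv_le (hV : Measurable V) (hW : Measurable W) {j : ℤ} {ξ : E3}
    (hξ : P.piece j ξ ≠ 0) :
    absConv V W ξ ≤ ∑' n : ℕ, (convPiece P V W (j - 2 + n) ξ + convPiece P W V (j - 2 + n) ξ) := by
  rw [ENNReal.tsum_add]
  have hm : ∀ {V W : E3 → C3}, Measurable V → Measurable W →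
      Measurable fun η => ‖V η‖ₑ * ‖W (ξ - η)‖ₑ := fun hV hW =>
    hV.enorm.mul (hW.comp (measurable_const.sub measurable_id)).enorm
  have hset : MeasurableSet {η : E3 | ‖η‖ ≤ ‖ξ - η‖} :=
    measurableSet_le (by fun_prop) (by fun_prop)
  unfold absConv
  rw [← lintegral_add_compl _ hset, ← lintegral_indicator hset, ← lintegral_indicator hset.compl]
  refine add_le_add (absConv_half_le P hV hW hξ) (le_trans ?_ (absConv_half_le P hW hV hξ))
  rw [← lintegral_sub_left_eq_self _ ξ]
  refine lintegral_mono fun η => ?_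
  by_cases h : ξ - η ∈ {η : E3 | ‖η‖ ≤ ‖ξ - η‖}ᶜ
  · rw [indicator_of_mem h]
    have h2 : ¬ ‖ξ - η‖ ≤ ‖ξ - (ξ - η)‖ := h
    rw [sub_sub_cancel, not_le] at h2
    rw [indicator_of_mem (show η ∈ {η : E3 | ‖η‖ ≤ ‖ξ - η‖} from h2.le), sub_sub_cancel, mul_comm]
  · rw [indicator_of_notMem h]; exact zero_le

theorem enorm_apply_le (v : C3) (k : Fin 3) : ‖v k‖ₑ ≤ ‖v‖ₑ := by
  rw [← ofReal_norm, ← ofReal_norm]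
  exact ENNReal.ofReal_le_ofReal (PiLp.norm_apply_le v k)

theorem enorm_le_sum_apply (v : C3) : ‖v‖ₑ ≤ ∑ k, ‖v k‖ₑ := by
  have h : v = ∑ k, EuclideanSpace.single k (v k) := by
    ext i
    simp [Finset.sum_apply]
  calc ‖v‖ₑ = ‖∑ k, EuclideanSpace.single k (v k)‖ₑ := by rw [← h]
    _ ≤ ∑ k, ‖(EuclideanSpace.single k (v k) : C3)‖ₑ := enorm_sum_le _ _
    _ = _ := by
      refine Finset.sum_congr rfl fun k _ => ?_
      rw [← ofReal_norm, PiLp.norm_single, ofReal_norm]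

theorem enorm_tensorHat_le (V W : E3 → C3) (ξ : E3) (m k : Fin 3) :
    ‖tensorHat V W ξ m k‖ₑ ≤ absConv V W ξ := by
  refine (enorm_integral_le_lintegral_enorm _).trans (lintegral_mono fun η => ?_)
  rw [enorm_mul]
  exact mul_le_mul' (enorm_apply_le _ _) (enorm_apply_le _ _)

theorem enorm_divTensorHat_le (V W : E3 → C3) (ξ : E3) :
    ‖divTensorHat V W ξ‖ₑ ≤ 9 * (‖ξ‖ₑ * absConv V W ξ) := by
  refine (enorm_le_sum_apply _).trans ?_
  have h1 : ∀ k : Fin 3, ‖divTensorHat V W ξ k‖ₑ ≤ 3 * (‖ξ‖ₑ * absConv V W ξ) := by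
    intro k
    have : divTensorHat V W ξ k = Complex.I * ∑ m, (ξ m : ℂ) * tensorHat V W ξ m k := rfl
    rw [this, enorm_mul]
    have hI : ‖Complex.I‖ₑ = 1 := by rw [← ofReal_norm]; simp
    rw [hI, one_mul]
    refine (enorm_sum_le _ _).trans ((Finset.sum_le_card_nsmul _ _ (‖ξ‖ₑ * absConv V W ξ)
      fun m _ => ?_).trans (by simp))
    rw [enorm_mul]
    refine mul_le_mul' ?_ (enorm_tensorHat_le V W ξ m k)
    rw [← ofReal_norm, ← ofReal_norm, Complex.norm_real]
    exact ENNReal.ofReal_le_ofReal (PiLp.norm_apply_le ξ m)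
  refine (Finset.sum_le_card_nsmul _ _ _ fun k _ => h1 k).trans (le_of_eq ?_)
  simp only [Finset.card_univ, Fintype.card_fin, nsmul_eq_mul]
  rw [← mul_assoc]; norm_num

end Product

section ProductBound

variable (P : DyadicPartition) {p q : ℝ≥0∞} {s : ℝ}

theorem exists_enorm_piece_bound :
    ∃ M : ℝ≥0∞, M ≠ ∞ ∧ ∀ j ξ, ‖P.piece j ξ‖ₑ ≤ M := by
  obtain ⟨M, -, h⟩ := exists_piece_bound P
  refine ⟨ENNReal.ofReal M, ENNReal.ofReal_ne_top, fun j ξ => ?_⟩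
  rw [← ofReal_norm]
  exact ENNReal.ofReal_le_ofReal (h j ξ)

theorem eLpNorm_tsum_convPiece_le (hp : 1 ≤ p) (hq : 1 ≤ q) {β : ℝ}
    (hβ : β = 3 - threeOver p - s) (a b : ℤ → ℝ≥0∞) {V W : E3 → C3} (hV : Measurable V)
    (hW : Measurable W) (ha : ∀ j, blk P p j V ≤ a j) (hb : ∀ j, blk P p j W ≤ b j) (j : ℤ) :
    eLpNorm (fun ξ => ∑' n : ℕ, (convPiece P V W (j - 2 + n) ξ + convPiece P W V (j - 2 + n) ξ))
      p volume ≤ (ballConst p * ∑' n : ℕ, (2 : ℝ≥0∞) ^ (-((n : ℝ) * β))) *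
        ∑' n : ℕ, 2 ^ (((j - 2 + n : ℤ) + 1 : ℝ) * β) *
          (weightedSeqNorm s q a * b (j - 2 + n) + weightedSeqNorm s q b * a (j - 2 + n)) := by
  refine (eLpNorm_tsum_le _ hp fun n =>
    (measurable_convPiece P hV hW _).add (measurable_convPiece P hW hV _)).trans ?_
  rw [← ENNReal.tsum_mul_left]
  refine ENNReal.tsum_le_tsum fun n => ?_
  refine (eLpNorm_add_le (measurable_convPiece P hV hW _).aestronglyMeasurable
    (measurable_convPiece P hW hV _).aestronglyMeasurable hp).trans ?_
  refine (add_le_add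
    ((eLpNorm_convPiece_le P hp hV hW _).trans (mul_le_mul'
      (lintegral_dyadicBall_le P hp hq hβ hV ha _) (hb _)))
    ((eLpNorm_convPiece_le P hp hW hV _).trans (mul_le_mul'
      (lintegral_dyadicBall_le P hp hq hβ hW hb _) (ha _)))).trans (le_of_eq ?_)
  ring

/-- The product estimate: `div (v ⊗ w)` is bounded from `FḂ^s × FḂ^s` to `FḂ^{s-β-1}`, where
`β = 3 - 3/p - s` and `0 < β < s`; in a form that is uniform in fields with given block norms. -/
theorem exists_divTensorHat_bound (hp : 1 ≤ p) (hq : 1 ≤ q) {β : ℝ}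
    (hβ : β = 3 - threeOver p - s) (hβ0 : 0 < β) (hγ : 0 < s - β) :
    ∃ K : ℝ≥0∞, K ≠ ∞ ∧ ∀ a b : ℤ → ℝ≥0∞, ∃ c : ℤ → ℝ≥0∞,
      weightedSeqNorm (s - β - 1) q c ≤ K * weightedSeqNorm s q a * weightedSeqNorm s q b ∧
      ∀ V W : E3 → C3, Measurable V → Measurable W → (∀ j, blk P p j V ≤ a j) →
        (∀ j, blk P p j W ≤ b j) → ∀ j, blk P p j (divTensorHat V W) ≤ c j := by
  obtain ⟨M, hM, hPM⟩ := exists_enorm_piece_bound P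
  set G := ∑' n : ℕ, (2 : ℝ≥0∞) ^ (-((n : ℝ) * β)) with hG
  set G' := ∑' n : ℕ, (2 : ℝ≥0∞) ^ (-((n : ℝ) * (s - β))) with hG'
  have hGt : G ≠ ∞ := (tsum_two_rpow_neg_lt_top hβ0).ne
  have hGt' : G' ≠ ∞ := (tsum_two_rpow_neg_lt_top hγ).ne
  set C1 : ℝ≥0∞ := M * 9 * ENNReal.ofReal (8 / 3) * (ballConst p * G) with hC1
  have hC1t : C1 ≠ ∞ := ENNReal.mul_ne_top (ENNReal.mul_ne_top (ENNReal.mul_ne_top hM (by simp))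
    ENNReal.ofReal_ne_top) (ENNReal.mul_ne_top (ballConst_ne_top hp) hGt)
  refine ⟨C1 * (2 ^ (β + 2 * (s - β)) * G') * 2, ?_, fun a b => ?_⟩
  · exact ENNReal.mul_ne_top (ENNReal.mul_ne_top hC1t
      (ENNReal.mul_ne_top (two_rpow_ne_top _) hGt')) (by simp)
  set A := weightedSeqNorm s q a with hA
  set B := weightedSeqNorm s q b with hB
  set e : ℤ → ℝ≥0∞ := fun j => A * b j + B * a j with he
  -- The factor `2^j` is the cost of the divergence on the shell, and `2^{(l+1)β}` with `l = j - 2 +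
  -- n` the cost of the low-frequency factor. The sequence depends on the block bounds alone, so it
  -- serves all times at once.
  refine ⟨fun j => C1 * ∑' n : ℕ, 2 ^ (j : ℝ) * (2 ^ (((j - 2 + n : ℤ) + 1 : ℝ) * β) *
    e (j - 2 + n)), ?_, fun V W hV hW ha hb j => ?_⟩
  · rw [wsn_const_mul]
    have hen : weightedSeqNorm s q e ≤ 2 * A * B := by
      refine (wsn_add_le hq _ _).trans (le_of_eq ?_)
      rw [wsn_const_mul, wsn_const_mul, ← hA, ← hB]; ring
    -- The `n`-th term is a translate by `n - 2`, and translation at regularity `s - β - 1` combined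
    -- with the weights leaves the decay `2^{-n(s - β)}`.
    have hterm : ∀ n : ℕ, weightedSeqNorm (s - β - 1) q (fun j : ℤ => 2 ^ (j : ℝ) *
        (2 ^ (((j - 2 + n : ℤ) + 1 : ℝ) * β) * e (j - 2 + n))) =
        2 ^ (-((n : ℝ) * (s - β))) * (2 ^ (β + 2 * (s - β)) * weightedSeqNorm s q e) := by
      intro n
      have h1 : (fun j : ℤ => (2 : ℝ≥0∞) ^ (j : ℝ) *
          (2 ^ (((j - 2 + n : ℤ) + 1 : ℝ) * β) * e (j - 2 + n))) =
          fun j : ℤ => 2 ^ (β - (n - 2)) *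
            (fun i : ℤ => 2 ^ ((i : ℝ) * (1 + β)) * e i) (j + ((n : ℤ) - 2)) := by
        ext1 j
        have : j + ((n : ℤ) - 2) = j - 2 + n := by ring
        simp only [this]
        rw [← mul_assoc, ← mul_assoc, ← two_rpow_add, ← two_rpow_add]
        congr 2; push_cast; ring
      rw [h1, wsn_const_mul, wsn_shift ((n : ℤ) - 2)
        (fun i : ℤ => 2 ^ ((i : ℝ) * (1 + β)) * e i), wsn_weight,
        show s - β - 1 + (1 + β) = s by ring, ← mul_assoc, ← mul_assoc, ← two_rpow_add,
        ← two_rpow_add]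
      congr 2; push_cast; ring
    calc C1 * weightedSeqNorm (s - β - 1) q (fun j : ℤ => ∑' n : ℕ, 2 ^ (j : ℝ) *
          (2 ^ (((j - 2 + n : ℤ) + 1 : ℝ) * β) * e (j - 2 + n)))
        ≤ C1 * ∑' n : ℕ, 2 ^ (-((n : ℝ) * (s - β))) *
          (2 ^ (β + 2 * (s - β)) * weightedSeqNorm s q e) := by
          gcongr
          refine (wsn_tsum_le hq _).trans (le_of_eq ?_)
          simp only [hterm]
      _ = C1 * (G' * (2 ^ (β + 2 * (s - β)) * weightedSeqNorm s q e)) := by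
          rw [ENNReal.tsum_mul_right]
      _ ≤ C1 * (G' * (2 ^ (β + 2 * (s - β)) * (2 * A * B))) := by gcongr
      _ = _ := by ring
  · set Λ : E3 → ℝ≥0∞ := fun ξ =>
      ∑' n : ℕ, (convPiece P V W (j - 2 + n) ξ + convPiece P W V (j - 2 + n) ξ) with hΛ
    have hΛm : Measurable Λ := Measurable.tsum fun n =>
      (measurable_convPiece P hV hW _).add (measurable_convPiece P hW hV _)
    have hΛn := eLpNorm_tsum_convPiece_le P hp hq hβ a b hV hW ha hb j
    set C2 : ℝ≥0∞ := M * 9 * ENNReal.ofReal (8 / 3) * 2 ^ (j : ℝ) with hC2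
    have hpt : ∀ ξ, ‖P.piece j ξ • divTensorHat V W ξ‖ₑ ≤ C2 * Λ ξ := by
      intro ξ
      by_cases h0 : P.piece j ξ = 0
      · simp [h0]
      rw [enorm_smul]
      have h1 : ‖ξ‖ₑ ≤ ENNReal.ofReal (8 / 3) * 2 ^ (j : ℝ) := by
        rw [two_rpow_eq_ofReal, ← ENNReal.ofReal_mul (by norm_num), ← ofReal_norm]
        refine ENNReal.ofReal_le_ofReal ?_
        rw [Real.rpow_intCast]
        exact (norm_bounds_of_piece_ne_zero P h0).2
      calc ‖P.piece j ξ‖ₑ * ‖divTensorHat V W ξ‖ₑ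
          ≤ M * (9 * ((ENNReal.ofReal (8 / 3) * 2 ^ (j : ℝ)) * Λ ξ)) := by
            refine mul_le_mul' (hPM j ξ) ((enorm_divTensorHat_le V W ξ).trans ?_)
            gcongr
            exact absConv_le P hV hW h0
        _ = _ := by rw [hC2]; ring
    rw [blk_eq_eLpNorm_enorm]
    calc eLpNorm (fun ξ => ‖P.piece j ξ • divTensorHat V W ξ‖ₑ) p volume
        ≤ eLpNorm (fun ξ => C2 * Λ ξ) p volume := eLpNorm_mono_enorm fun ξ => by
          simpa using hpt ξ
      _ = C2 * eLpNorm Λ p volume := eLpNorm_mul_const _ _ _ hΛm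
      _ ≤ C2 * ((ballConst p * G) * ∑' n : ℕ, 2 ^ (((j - 2 + n : ℤ) + 1 : ℝ) * β) *
          e (j - 2 + n)) := by gcongr
      _ = _ := by
          beta_reduce
          rw [ENNReal.tsum_mul_left, hC1, hC2]; ring

/-- The majorant of `absConv` on each shell has finite `L^p` norm, hence is finite almost
everywhere; every nonzero frequency lies in some shell. -/
theorem ae_absConv_lt_top (hp : 1 ≤ p) (hq : 1 ≤ q) (hβ0 : 0 < 3 - threeOver p - s)
    (hγ : 0 < s - (3 - threeOver p - s)) {V W : E3 → C3} (hV : Measurable V) (hW : Measurable W)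
    (hVn : fnNorm P s p q V < ∞) (hWn : fnNorm P s p q W < ∞) :
    ∀ᵐ ξ, absConv V W ξ < ∞ := by
  set β := 3 - threeOver p - s with hβ
  set a := fun j => blk P p j V with ha
  set b := fun j => blk P p j W with hb
  have hfin : ∀ j : ℤ, ∀ᵐ ξ, ∑' n : ℕ,
      (convPiece P V W (j - 2 + n) ξ + convPiece P W V (j - 2 + n) ξ) < ∞ := by
    intro j
    refine ae_lt_top_of_eLpNorm_lt_top hp (Measurable.tsum fun n =>
      (measurable_convPiece P hV hW _).add (measurable_convPiece P hW hV _)) ?_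
    refine (eLpNorm_tsum_convPiece_le P hp hq hβ a b hV hW (fun _ => le_rfl)
      (fun _ => le_rfl) j).trans_lt ?_
    refine ENNReal.mul_lt_top (ENNReal.mul_lt_top (ballConst_ne_top hp).lt_top
      (tsum_two_rpow_neg_lt_top hβ0)) ?_
    set A := weightedSeqNorm s q a with hA
    set B := weightedSeqNorm s q b with hB
    refine lt_of_le_of_lt (b := ∑' n : ℕ, (2 : ℝ≥0∞) ^ (-((n : ℝ) * (s - β))) *
      (2 ^ (β + (2 - j) * (s - β)) * (A * B + B * A))) (ENNReal.tsum_le_tsum fun n => ?_) ?_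
    · calc 2 ^ (((j - 2 + n : ℤ) + 1 : ℝ) * β) * (A * b (j - 2 + n) + B * a (j - 2 + n))
          ≤ 2 ^ (((j - 2 + n : ℤ) + 1 : ℝ) * β) *
            (A * (2 ^ (-(((j - 2 + n : ℤ) : ℝ) * s)) * B) +
              B * (2 ^ (-(((j - 2 + n : ℤ) : ℝ) * s)) * A)) := by
            gcongr
            · exact le_wsn' hq b _
            · exact le_wsn' hq a _
        _ = (2 ^ (((j - 2 + n : ℤ) + 1 : ℝ) * β) * 2 ^ (-(((j - 2 + n : ℤ) : ℝ) * s))) *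
            (A * B + B * A) := by ring
        _ = (2 ^ (-((n : ℝ) * (s - β))) * 2 ^ (β + (2 - j) * (s - β))) * (A * B + B * A) := by
            rw [← two_rpow_add, ← two_rpow_add]
            congr 2; push_cast; ring
        _ = _ := by ring
    · rw [ENNReal.tsum_mul_right]
      refine ENNReal.mul_lt_top (tsum_two_rpow_neg_lt_top hγ)
        (ENNReal.mul_lt_top (two_rpow_ne_top _).lt_top ?_)
      exact ENNReal.add_lt_top.2 ⟨ENNReal.mul_lt_top hVn hWn, ENNReal.mul_lt_top hWn hVn⟩
  filter_upwards [ae_all_iff.2 hfin, ae_ne_zero] with ξ h1 h2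
  obtain ⟨j, hj⟩ := exists_piece_ne_zero P h2
  exact (absConv_le P hV hW hj).trans_lt (h1 j)

theorem integrable_conv {V W : E3 → C3} (hV : Measurable V) (hW : Measurable W) {ξ : E3}
    (h : absConv V W ξ < ∞) (m k : Fin 3) : Integrable (fun η => V η m * W (ξ - η) k) := by
  have hm : Measurable fun η => V η m * W (ξ - η) k := by
    have h1 : Measurable fun η => V η m := (EuclideanSpace.proj (𝕜 := ℂ) m).measurable.comp hV
    have h2 : Measurable fun η => W (ξ - η) k :=
      (EuclideanSpace.proj (𝕜 := ℂ) k).measurable.comp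
        (hW.comp (measurable_const.sub measurable_id))
    exact h1.mul h2
  refine ⟨hm.aestronglyMeasurable, lt_of_le_of_lt (lintegral_mono fun η => ?_) h⟩
  rw [enorm_mul]
  exact mul_le_mul' (enorm_apply_le _ _) (enorm_apply_le _ _)

/-- The mixed convolution of `V'` and `W` is added and subtracted, so its absolute convergence is
needed too. -/
theorem divTensorHat_sub {V V' W W' : E3 → C3} (hV : Measurable V) (hV' : Measurable V')
    (hW : Measurable W) (hW' : Measurable W') {ξ : E3} (h1 : absConv V W ξ < ∞)
    (h2 : absConv V' W' ξ < ∞) (h3 : absConv V' W ξ < ∞) :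
    divTensorHat V W ξ - divTensorHat V' W' ξ =
      divTensorHat (fun η => V η - V' η) W ξ + divTensorHat V' (fun η => W η - W' η) ξ := by
  have key : ∀ m k, tensorHat V W ξ m k - tensorHat V' W' ξ m k =
      tensorHat (fun η => V η - V' η) W ξ m k + tensorHat V' (fun η => W η - W' η) ξ m k := by
    intro m k
    simp only [tensorHat, Matrix.of_apply, PiLp.sub_apply, sub_mul, mul_sub]
    rw [integral_sub (integrable_conv hV hW h1 m k) (integrable_conv hV' hW h3 m k),
      integral_sub (integrable_conv hV' hW h3 m k) (integrable_conv hV' hW' h2 m k)]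
    ring
  ext k
  have e : ∀ (V W : E3 → C3), divTensorHat V W ξ k =
      Complex.I * ∑ m, (ξ m : ℂ) * tensorHat V W ξ m k := fun _ _ => rfl
  rw [PiLp.sub_apply, PiLp.add_apply, e, e, e, e, ← mul_sub, ← mul_add, ← Finset.sum_sub_distrib,
    ← Finset.sum_add_distrib]
  congr 1
  refine Finset.sum_congr rfl fun m _ => ?_
  rw [← mul_sub, key, mul_add]

theorem tensorHat_congr {V V' W W' : E3 → C3} (hV : V =ᵐ[volume] V') (hW : W =ᵐ[volume] W')
    (ξ : E3) : tensorHat V W ξ = tensorHat V' W' ξ := by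
  ext m k
  refine integral_congr_ae ?_
  have h2 : ∀ᵐ η : E3, W (ξ - η) = W' (ξ - η) :=
    (Measure.measurePreserving_sub_left volume ξ).quasiMeasurePreserving.ae hW
  filter_upwards [hV, h2] with η h3 h4
  rw [h3, h4]

theorem divTensorHat_congr {V V' W W' : E3 → C3} (hV : V =ᵐ[volume] V') (hW : W =ᵐ[volume] W') :
    divTensorHat V W = divTensorHat V' W' := by
  ext1 ξ
  simp only [divTensorHat, tensorHat_congr hV hW]

theorem measurable_divTensorHat {V W : ℝ → E3 → C3} (hV : Measurable (Function.uncurry V))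
    (hW : Measurable (Function.uncurry W)) :
    Measurable (Function.uncurry fun τ => divTensorHat (V τ) (W τ)) := by
  have hT : ∀ m k, Measurable fun z : ℝ × E3 => tensorHat (V z.1) (W z.1) z.2 m k := by
    intro m k
    have h1 : Measurable fun y : (ℝ × E3) × E3 => V y.1.1 y.2 m * W y.1.1 (y.1.2 - y.2) k := by
      refine Measurable.mul ?_ ?_
      · exact (EuclideanSpace.proj (𝕜 := ℂ) m).measurable.comp
          (hV.comp ((measurable_fst.comp measurable_fst).prodMk measurable_snd))
      · exact (EuclideanSpace.proj (𝕜 := ℂ) k).measurable.comp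
          (hW.comp ((measurable_fst.comp measurable_fst).prodMk
            ((measurable_snd.comp measurable_fst).sub measurable_snd)))
    exact (h1.stronglyMeasurable.integral_prod_right (ν := (volume : Measure E3))).measurable
  have h2 : Measurable fun z : ℝ × E3 => fun k : Fin 3 =>
      Complex.I * ∑ m, (z.2 m : ℂ) * tensorHat (V z.1) (W z.1) z.2 m k := by
    refine measurable_pi_lambda _ fun k => Measurable.const_mul
      (Finset.measurable_sum _ fun m _ => Measurable.mul ?_ (hT m k)) _
    exact Complex.measurable_ofReal.comp
      ((EuclideanSpace.proj (𝕜 := ℝ) m).measurable.comp measurable_snd)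
  exact (WithLp.measurable_toLp 2 _).comp h2

end ProductBound

section ProductTime

variable (P : DyadicPartition) {p q : ℝ≥0∞} {s : ℝ}

/-- Both bounds come from the uniform form of the product estimate, with the blocks at a fixed time
and with their suprema in time as block bounds. -/
theorem exists_divTensorHat_norm_bound (hp : 1 ≤ p) (hq : 1 ≤ q) {β : ℝ}
    (hβ : β = 3 - threeOver p - s) (hβ0 : 0 < β) (hγ : 0 < s - β) :
    ∃ K : ℝ≥0∞, K ≠ ∞ ∧
      (∀ V W : E3 → C3, Measurable V → Measurable W →
        fnNorm P (s - β - 1) p q (divTensorHat V W) ≤ K * fnNorm P s p q V * fnNorm P s p q W) ∧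
      ∀ V W : ℝ → E3 → C3, (∀ t, Measurable (V t)) → (∀ t, Measurable (W t)) →
        tnorm P (s - β - 1) p q (fun t => divTensorHat (V t) (W t)) ≤
          K * tnorm P s p q V * tnorm P s p q W := by
  obtain ⟨K, hK, h⟩ := exists_divTensorHat_bound P hp hq hβ hβ0 hγ
  refine ⟨K, hK, fun V W hV hW => ?_, fun V W hV hW => ?_⟩
  · obtain ⟨c, hc, hcj⟩ := h (fun j => blk P p j V) (fun j => blk P p j W)
    exact (wsn_mono fun j => hcj V W hV hW (fun _ => le_rfl) (fun _ => le_rfl) j).trans hc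
  · obtain ⟨c, hc, hcj⟩ := h (timeBlk P p V) (timeBlk P p W)
    refine (tnorm_le P (a := c) ?_).trans hc
    filter_upwards [ae_blk_le_timeBlk P p V, ae_blk_le_timeBlk P p W] with t h1 h2
    exact hcj _ _ (hV t) (hW t) h1 h2

theorem fnNorm_divTensorHat_sub_le (hp : 1 ≤ p) (hq : 1 ≤ q) {β : ℝ}
    (hβ : β = 3 - threeOver p - s) (hβ0 : 0 < β) (hγ : 0 < s - β) {K : ℝ≥0∞}
    (hK : ∀ V W : E3 → C3, Measurable V → Measurable W →
        fnNorm P (s - β - 1) p q (divTensorHat V W) ≤ K * fnNorm P s p q V * fnNorm P s p q W)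
    {V V' W W' : E3 → C3} (hV : Measurable V) (hV' : Measurable V') (hW : Measurable W)
    (hW' : Measurable W') (hVn : fnNorm P s p q V < ∞) (hVn' : fnNorm P s p q V' < ∞)
    (hWn : fnNorm P s p q W < ∞) (hWn' : fnNorm P s p q W' < ∞) :
    fnNorm P (s - β - 1) p q (fun ξ => divTensorHat V W ξ - divTensorHat V' W' ξ) ≤
      K * fnNorm P s p q (fun ξ => V ξ - V' ξ) * fnNorm P s p q W +
        K * fnNorm P s p q V' * fnNorm P s p q (fun ξ => W ξ - W' ξ) := by
  subst hβ
  have hm : ∀ {X Y : E3 → C3}, Measurable X → Measurable Y → Measurable (divTensorHat X Y) :=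
    fun {X Y} hX hY => measurable_section (U := fun _ : ℝ => divTensorHat X Y)
      (measurable_divTensorHat (V := fun _ => X) (W := fun _ => Y) (hX.comp measurable_snd)
        (hY.comp measurable_snd)) 0
  refine le_trans (le_of_eq ?_) ((fnNorm_add_le P hp hq
    (hm (hV.sub hV') hW).aestronglyMeasurable
    (hm hV' (hW.sub hW')).aestronglyMeasurable).trans
    (add_le_add (hK _ _ (hV.sub hV') hW) (hK _ _ hV' (hW.sub hW'))))
  refine fnNorm_congr P _ p q ?_
  filter_upwards [ae_absConv_lt_top P hp hq hβ0 hγ hV hW hVn hWn,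
    ae_absConv_lt_top P hp hq hβ0 hγ hV' hW' hVn' hWn',
    ae_absConv_lt_top P hp hq hβ0 hγ hV' hW hVn' hWn] with ξ h1 h2 h3
  exact divTensorHat_sub hV hV' hW hW' h1 h2 h3

theorem SeparablyValued.divTensorHat (hp : 1 ≤ p) (hq : 1 ≤ q) {β : ℝ}
    (hβ : β = 3 - threeOver p - s) (hβ0 : 0 < β) (hγ : 0 < s - β)
    {V W : ℝ → E3 → C3} (hV : ∀ t, Measurable (V t)) (hW : ∀ t, Measurable (W t))
    (hVn : tnorm P s p q V < ∞) (hWn : tnorm P s p q W < ∞)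
    (hVs : SeparablyValued P s p q V) (hWs : SeparablyValued P s p q W) :
    SeparablyValued P (s - β - 1) p q (fun t => divTensorHat (V t) (W t)) := by
  obtain ⟨K, hK, hK1, -⟩ := exists_divTensorHat_norm_bound P hp hq hβ hβ0 hγ
  obtain ⟨D, hD, hapD⟩ := hVs
  obtain ⟨D', hD', hapD'⟩ := hWs
  have hm : ∀ {X Y : E3 → C3}, Measurable X → Measurable Y → Measurable (FNSC.divTensorHat X Y) :=
    fun {X Y} hX hY => measurable_section (U := fun _ : ℝ => FNSC.divTensorHat X Y)
      (measurable_divTensorHat (V := fun _ => X) (W := fun _ => Y) (hX.comp measurable_snd)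
        (hY.comp measurable_snd)) 0
  refine SeparablyValued.of_countable (ι := ℕ × ℕ)
    (fun x => FNSC.divTensorHat (D x.1) (D' x.2)) (fun x => ⟨hm (hD _).1 (hD' _).1,
    (hK1 _ _ (hD _).1 (hD' _).1).trans_lt (ENNReal.mul_lt_top (ENNReal.mul_lt_top hK.lt_top
      (hD _).2) (hD' _).2)⟩) ?_
  filter_upwards [hapD, hapD', ae_fnNorm_le_tnorm P (p := p) (q := q) (s := s) V,
    ae_fnNorm_le_tnorm P (p := p) (q := q) (s := s) W] with t h1 h2 h3 h4 ε hε
  have h3' := h3.trans_lt hVn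
  have h4' := h4.trans_lt hWn
  have hε2 : ε / 2 ≠ 0 := (ENNReal.half_pos hε.ne').ne'
  -- The index `i` is fixed first, against the norm of `W t`; the tolerance for `k` may then depend
  -- on the norm of `D i`.
  obtain ⟨δ, hδ0, hδ⟩ := ENNReal.exists_nnreal_pos_mul_lt
    (ENNReal.mul_ne_top hK h4'.ne) hε2
  obtain ⟨i, hi⟩ := h1 δ (by exact_mod_cast hδ0)
  obtain ⟨δ', hδ0', hδ'⟩ := ENNReal.exists_nnreal_pos_mul_lt
    (ENNReal.mul_ne_top hK (hD i).2.ne) hε2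
  obtain ⟨k, hk⟩ := h2 δ' (by exact_mod_cast hδ0')
  refine ⟨(i, k), ?_⟩
  refine (fnNorm_divTensorHat_sub_le P hp hq hβ hβ0 hγ hK1 (hV t) (hD i).1 (hW t) (hD' k).1
    h3' (hD i).2 h4' (hD' k).2).trans_lt ?_
  refine (ENNReal.add_lt_add ?_ ?_).trans_eq (ENNReal.add_halves ε)
  · refine lt_of_le_of_lt ?_ hδ
    rw [mul_right_comm, mul_comm]; gcongr
  · refine lt_of_le_of_lt ?_ hδ'
    rw [mul_comm]; gcongr

end ProductTime

/-! ### Pointwise bounds and measurability of the symbols -/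

section Symbols

theorem norm_act_le {A : Matrix (Fin 3) (Fin 3) ℂ} {c : ℝ} (hA : ∀ i k, ‖A i k‖ ≤ c) (v : C3) :
    ‖act A v‖ ≤ 9 * c * ‖v‖ := by
  have hc : 0 ≤ c := (norm_nonneg _).trans (hA 0 0)
  have h1 : ∀ i, ‖act A v i‖ ≤ 3 * c * ‖v‖ := by
    intro i
    calc ‖act A v i‖ = ‖∑ k, A i k * v k‖ := rfl
      _ ≤ ∑ k : Fin 3, ‖A i k * v k‖ := norm_sum_le _ _
      _ ≤ ∑ _k : Fin 3, c * ‖v‖ := by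
          refine Finset.sum_le_sum fun k _ => ?_
          rw [norm_mul]
          exact mul_le_mul (hA i k) (PiLp.norm_apply_le v k) (norm_nonneg _) hc
      _ = 3 * c * ‖v‖ := by simp; ring
  have h2 : ‖act A v‖ₑ ≤ ∑ i, ‖act A v i‖ₑ := enorm_le_sum_apply _
  have h3 : ∑ i, ‖act A v i‖ₑ ≤ ENNReal.ofReal (9 * c * ‖v‖) := by
    calc ∑ i, ‖act A v i‖ₑ ≤ ∑ _i : Fin 3, ENNReal.ofReal (3 * c * ‖v‖) := by
          refine Finset.sum_le_sum fun i _ => ?_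
          rw [← ofReal_norm]; exact ENNReal.ofReal_le_ofReal (h1 i)
      _ = ENNReal.ofReal (9 * c * ‖v‖) := by
          rw [Finset.sum_const, Finset.card_univ, Fintype.card_fin, nsmul_eq_mul,
            Nat.cast_ofNat, ← ENNReal.ofReal_ofNat 3, ← ENNReal.ofReal_mul (by norm_num)]
          congr 1; ring
  have h4 := h2.trans h3
  rwa [← ofReal_norm, ENNReal.ofReal_le_ofReal_iff (by positivity)] at h4

theorem act_sub_right (A : Matrix (Fin 3) (Fin 3) ℂ) (v w : C3) :
    act A (v - w) = act A v - act A w := by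
  ext i
  simp [act, Matrix.mulVec_sub]

theorem act_sub_left (A B : Matrix (Fin 3) (Fin 3) ℂ) (v : C3) :
    act (A - B) v = act A v - act B v := by
  ext i
  simp [act, Matrix.sub_mulVec]

theorem abs_apply_div_norm_le (ξ : E3) (i : Fin 3) : |ξ i / ‖ξ‖| ≤ 1 := by
  rw [abs_div, abs_norm]
  refine div_le_one_of_le₀ ?_ (norm_nonneg _)
  simpa using PiLp.norm_apply_le ξ i

theorem norm_rotMatrix_le (ξ : E3) (i k : Fin 3) : ‖rotMatrix ξ i k‖ ≤ 1 := by
  have h : ∀ l, ‖ξ‖⁻¹ * |ξ l| ≤ 1 := fun l => by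
    have := abs_apply_div_norm_le ξ l
    rwa [abs_div, abs_norm, div_eq_inv_mul] at this
  fin_cases i <;> fin_cases k <;> simp [rotMatrix, h]

theorem norm_leraySymbol_le (ξ : E3) (i k : Fin 3) : ‖leraySymbol ξ i k‖ ≤ 2 := by
  have h1 : ‖(if i = k then (1 : ℂ) else 0)‖ ≤ 1 := by split_ifs <;> simp
  have h2 : ‖((ξ i * ξ k / ‖ξ‖ ^ 2 : ℝ) : ℂ)‖ ≤ 1 := by
    rw [Complex.norm_real, Real.norm_eq_abs, show ξ i * ξ k / ‖ξ‖ ^ 2 = ξ i / ‖ξ‖ * (ξ k / ‖ξ‖) by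
      rw [div_mul_div_comm, sq], abs_mul]
    exact mul_le_one₀ (abs_apply_div_norm_le ξ i) (abs_nonneg _) (abs_apply_div_norm_le ξ k)
  calc ‖leraySymbol ξ i k‖ ≤ ‖(if i = k then (1 : ℂ) else 0)‖ + ‖((ξ i * ξ k / ‖ξ‖ ^ 2 : ℝ) : ℂ)‖ :=
        norm_sub_le _ _
    _ ≤ 2 := by linarith

theorem norm_act_leraySymbol_le (ξ : E3) (v : C3) : ‖act (leraySymbol ξ) v‖ ≤ 18 * ‖v‖ :=
  (norm_act_le (norm_leraySymbol_le ξ) v).trans_eq (by ring)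

theorem norm_combination_le (x y : ℝ) {c : ℝ} (hx : |x| ≤ c) (hy : |y| ≤ c) (ξ : E3)
    (i k : Fin 3) :
    ‖((x : ℂ) • (1 : Matrix (Fin 3) (Fin 3) ℂ) + (y : ℂ) • rotMatrix ξ) i k‖ ≤ 2 * c := by
  have hc : 0 ≤ c := (abs_nonneg _).trans hx
  have h1 : ‖(1 : Matrix (Fin 3) (Fin 3) ℂ) i k‖ ≤ 1 := by
    rw [Matrix.one_apply]; split_ifs <;> simp
  rw [Matrix.add_apply, Matrix.smul_apply, Matrix.smul_apply, smul_eq_mul, smul_eq_mul]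
  refine (norm_add_le _ _).trans ?_
  rw [norm_mul, norm_mul, Complex.norm_real, Complex.norm_real, Real.norm_eq_abs, Real.norm_eq_abs]
  have := mul_le_mul hx h1 (norm_nonneg _) hc
  have := mul_le_mul hy (norm_rotMatrix_le ξ i k) (norm_nonneg _) hc
  linarith

variable {ν α Ω : ℝ}

/-- The rotation enters only through a sine, a cosine and `rotMatrix`, all bounded by one: this is
where independence of `Ω` comes from. The constant is `9 · 2`, and with the same one for the Leray
symbol the Duhamel integrand gets `18² = 324`. -/
theorem norm_act_semigroupSymbol_le (ν α Ω t : ℝ) (ξ : E3) (v : C3) :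
    ‖act (semigroupSymbol ν α Ω t ξ) v‖ ≤ 18 * Real.exp (-(ν * t * ‖ξ‖ ^ (2 * α))) * ‖v‖ := by
  refine (norm_act_le (c := 2 * Real.exp (-(ν * t * ‖ξ‖ ^ (2 * α)))) (fun i k => ?_) v).trans_eq
    (by ring)
  refine norm_combination_le _ _ ?_ ?_ ξ i k
  · rw [abs_mul, Real.abs_exp]
    exact mul_le_of_le_one_left (Real.exp_pos _).le (Real.abs_cos_le_one _)
  · rw [abs_mul, Real.abs_exp]
    exact mul_le_of_le_one_left (Real.exp_pos _).le (Real.abs_sin_le_one _)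

theorem abs_osc_mul_exp_sub_le {g : ℝ → ℝ} (hg : ∀ x, |g x| ≤ 1)
    (hg' : ∀ x y, |g x - g y| ≤ |x - y|) {a c b r t : ℝ} (ha : |a| ≤ c) (hb : 0 ≤ b) (hr : r ≤ t) :
    |g (a * t) * Real.exp (-(b * t)) - g (a * r) * Real.exp (-(b * r))| ≤
      (c + b) * (t - r) * Real.exp (-(b * r)) := by
  have h1 : Real.exp (-(b * t)) ≤ Real.exp (-(b * r)) :=
    Real.exp_le_exp.2 (neg_le_neg (mul_le_mul_of_nonneg_left hr hb))
  have h2 : Real.exp (-(b * r)) - Real.exp (-(b * t)) ≤ b * (t - r) * Real.exp (-(b * r)) := by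
    have h3 : Real.exp (-(b * t)) = Real.exp (-(b * (t - r))) * Real.exp (-(b * r)) := by
      rw [← Real.exp_add]; congr 1; ring
    have h4 := Real.add_one_le_exp (-(b * (t - r)))
    rw [h3]
    nlinarith [Real.exp_pos (-(b * r))]
  have h5 : |g (a * t) - g (a * r)| ≤ c * (t - r) := by
    refine (hg' _ _).trans ?_
    rw [← mul_sub, abs_mul, abs_of_nonneg (sub_nonneg.2 hr)]
    exact mul_le_mul_of_nonneg_right ha (sub_nonneg.2 hr)
  have h0 : 0 ≤ c * (t - r) := (abs_nonneg _).trans h5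
  calc |g (a * t) * Real.exp (-(b * t)) - g (a * r) * Real.exp (-(b * r))|
      = |(g (a * t) - g (a * r)) * Real.exp (-(b * t)) +
          g (a * r) * (Real.exp (-(b * t)) - Real.exp (-(b * r)))| := by ring_nf
    _ ≤ |g (a * t) - g (a * r)| * Real.exp (-(b * t)) +
          |g (a * r)| * (Real.exp (-(b * r)) - Real.exp (-(b * t))) := by
        refine (abs_add_le _ _).trans_eq ?_
        rw [abs_mul, abs_mul, Real.abs_exp, abs_sub_comm (Real.exp _),
          abs_of_nonneg (sub_nonneg.2 h1)]
    _ ≤ c * (t - r) * Real.exp (-(b * r)) +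
          1 * (b * (t - r) * Real.exp (-(b * r))) :=
        add_le_add (mul_le_mul h5 h1 (Real.exp_pos _).le h0)
          (mul_le_mul (hg _) h2 (sub_nonneg.2 h1) zero_le_one)
    _ = _ := by ring

/-- This serves only for continuity in time, hence for separability. Its dependence on `Ω` does not
reach the constants `K` and `C`. -/
theorem norm_act_semigroupSymbol_sub_le (hν : 0 ≤ ν) (α Ω : ℝ) {r t : ℝ} (hr : r ≤ t) (ξ : E3)
    (v : C3) :
    ‖act (semigroupSymbol ν α Ω t ξ) v - act (semigroupSymbol ν α Ω r ξ) v‖ ≤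
      18 * ((|Ω| + ν * ‖ξ‖ ^ (2 * α)) * (t - r) * Real.exp (-(ν * r * ‖ξ‖ ^ (2 * α)))) * ‖v‖ := by
  rw [← act_sub_left]
  set b := ν * ‖ξ‖ ^ (2 * α) with hb
  have hb0 : 0 ≤ b := by positivity
  have ha : |Ω * (ξ 2 / ‖ξ‖)| ≤ |Ω| := by
    rw [abs_mul]
    exact mul_le_of_le_one_right (abs_nonneg _) (abs_apply_div_norm_le ξ 2)
  have e : ∀ t, ν * t * ‖ξ‖ ^ (2 * α) = b * t := fun t => by rw [hb]; ring
  have e' : ∀ t, Ω * t * (ξ 2 / ‖ξ‖) = Ω * (ξ 2 / ‖ξ‖) * t := fun t => by ring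
  refine (norm_act_le (c := 2 * ((|Ω| + b) * (t - r) * Real.exp (-(ν * r * ‖ξ‖ ^ (2 * α)))))
    (fun i k => ?_) v).trans_eq (by ring)
  have hs : semigroupSymbol ν α Ω t ξ - semigroupSymbol ν α Ω r ξ =
      ((Real.cos (Ω * t * (ξ 2 / ‖ξ‖)) * Real.exp (-(ν * t * ‖ξ‖ ^ (2 * α))) -
        Real.cos (Ω * r * (ξ 2 / ‖ξ‖)) * Real.exp (-(ν * r * ‖ξ‖ ^ (2 * α))) : ℝ) : ℂ) •
        (1 : Matrix (Fin 3) (Fin 3) ℂ) +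
      ((Real.sin (Ω * t * (ξ 2 / ‖ξ‖)) * Real.exp (-(ν * t * ‖ξ‖ ^ (2 * α))) -
        Real.sin (Ω * r * (ξ 2 / ‖ξ‖)) * Real.exp (-(ν * r * ‖ξ‖ ^ (2 * α))) : ℝ) : ℂ) •
        rotMatrix ξ := by
    rw [semigroupSymbol, semigroupSymbol, Complex.ofReal_sub, Complex.ofReal_sub, sub_smul,
      sub_smul]
    abel
  rw [hs]
  refine norm_combination_le _ _ ?_ ?_ ξ i k
  · rw [e, e, e', e']
    exact abs_osc_mul_exp_sub_le Real.abs_cos_le_one Real.abs_cos_sub_cos_le ha hb0 hr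
  · rw [e, e, e', e']
    exact abs_osc_mul_exp_sub_le Real.abs_sin_le_one Real.abs_sin_sub_sin_le ha hb0 hr

theorem Measurable.act {X : Type*} [MeasurableSpace X] {A : X → Matrix (Fin 3) (Fin 3) ℂ}
    {v : X → C3} (hA : ∀ i k, Measurable fun x => A x i k) (hv : Measurable v) :
    Measurable fun x => act (A x) (v x) := by
  have : ∀ i, Measurable fun x => ∑ k, A x i k * v x k := fun i =>
    Finset.measurable_sum _ fun k _ => (hA i k).mul
      ((EuclideanSpace.proj (𝕜 := ℂ) k).measurable.comp hv)
  exact (PiLp.continuous_toLp 2 _).measurable.comp (measurable_pi_lambda _ this)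

theorem measurable_apply (k : Fin 3) : Measurable fun ξ : E3 => ξ k :=
  (EuclideanSpace.proj (𝕜 := ℝ) k).measurable

theorem measurable_rotMatrix (i k : Fin 3) : Measurable fun ξ : E3 => rotMatrix ξ i k := by
  have h : ∀ l, Measurable fun ξ : E3 => ((ξ l : ℝ) : ℂ) := fun l =>
    Complex.measurable_ofReal.comp (measurable_apply l)
  have h' : Measurable fun ξ : E3 => ((‖ξ‖⁻¹ : ℝ) : ℂ) :=
    Complex.measurable_ofReal.comp measurable_norm.inv
  unfold rotMatrix
  fin_cases i <;> fin_cases k <;>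
    first
    | exact h'.mul measurable_const
    | exact h'.mul (h _)
    | exact h'.mul (h _).neg

theorem measurable_leraySymbol (i k : Fin 3) : Measurable fun ξ : E3 => leraySymbol ξ i k := by
  refine Measurable.sub measurable_const (Complex.measurable_ofReal.comp ?_)
  exact ((measurable_apply i).mul (measurable_apply k)).div (measurable_norm.pow_const 2)

theorem measurable_semigroupSymbol (ν α Ω : ℝ) {X : Type*} [MeasurableSpace X] {t : X → ℝ}
    {ξ : X → E3} (ht : Measurable t) (hξ : Measurable ξ) (i k : Fin 3) :
    Measurable fun x => semigroupSymbol ν α Ω (t x) (ξ x) i k := by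
  have h1 : Measurable fun x => Ω * t x * (ξ x 2 / ‖ξ x‖) :=
    (measurable_const.mul ht).mul (((measurable_apply 2).comp hξ).div hξ.norm)
  have h2 : Measurable fun x => Real.exp (-(ν * t x * ‖ξ x‖ ^ (2 * α))) :=
    Real.measurable_exp.comp ((measurable_const.mul ht).mul (hξ.norm.pow_const _)).neg
  refine Measurable.add ?_ ?_
  · exact (Complex.measurable_ofReal.comp ((Real.measurable_cos.comp h1).mul h2)).mul
      measurable_const
  · exact (Complex.measurable_ofReal.comp ((Real.measurable_sin.comp h1).mul h2)).mul
      ((measurable_rotMatrix i k).comp hξ)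

end Symbols

/-! ### Block norms of time integrals against a scalar kernel -/

section Kernel

variable (P : DyadicPartition) {p : ℝ≥0∞}

theorem blk_le_const_mul (p : ℝ≥0∞) (j : ℤ) {g g' : E3 → C3} (hg' : Measurable g') {c : ℝ≥0∞}
    (h : ∀ᵐ ξ, P.piece j ξ ≠ 0 → ‖g ξ‖ₑ ≤ c * ‖g' ξ‖ₑ) : blk P p j g ≤ c * blk P p j g' := by
  rw [blk_eq_eLpNorm_enorm, blk_eq_eLpNorm_enorm,
    ← eLpNorm_mul_const _ _ _ (measurable_piece_smul P j hg').enorm]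
  refine eLpNorm_mono_enorm_ae (h.mono fun ξ hξ => ?_)
  rw [enorm_eq_self, enorm_eq_self, enorm_smul, enorm_smul]
  by_cases h0 : P.piece j ξ = 0
  · simp [h0]
  · rw [mul_left_comm]
    gcongr
    exact hξ h0

/-- Minkowski's inequality moves the `L^p` norm inside the time integral. The domination of `g` is
asked only on the shell, where the kernel may use the size of `ξ`. -/
theorem blk_le_lintegral_kernel (hp : 1 ≤ p) (j : ℤ) {G : ℝ → E3 → C3}
    (hG : Measurable (Function.uncurry G)) {k : ℝ → ℝ≥0∞} (hk : Measurable k) {A : ℝ → ℝ≥0∞}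
    (hA : ∀ᵐ τ ∂timeMeasure, blk P p j (G τ) ≤ A τ) {g : E3 → C3}
    (h : ∀ᵐ ξ, P.piece j ξ ≠ 0 → ‖g ξ‖ₑ ≤ ∫⁻ τ, k τ * ‖G τ ξ‖ₑ ∂timeMeasure) :
    blk P p j g ≤ ∫⁻ τ, k τ * A τ ∂timeMeasure := by
  have hpm : Measurable fun z : E3 × ℝ => ‖P.piece j z.1 • G z.2 z.1‖ₑ :=
    (((measurable_piece P j).comp measurable_fst).smul (hG.comp measurable_swap)).enorm
  have hm : Measurable (Function.uncurry fun (ξ : E3) (τ : ℝ) =>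
      k τ * ‖P.piece j ξ • G τ ξ‖ₑ) := (hk.comp measurable_snd).mul hpm
  have : SFinite timeMeasure := by unfold timeMeasure; infer_instance
  calc blk P p j g
      ≤ eLpNorm (fun ξ => ∫⁻ τ, k τ * ‖P.piece j ξ • G τ ξ‖ₑ ∂timeMeasure) p volume := by
        rw [blk_eq_eLpNorm_enorm]
        refine eLpNorm_mono_enorm_ae (h.mono fun ξ hξ => ?_)
        rw [enorm_eq_self, enorm_eq_self, enorm_smul]
        by_cases h0 : P.piece j ξ = 0
        · simp [h0]
        · simp only [enorm_smul, mul_left_comm (k _)]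
          rw [lintegral_const_mul' _ _ enorm_ne_top]
          gcongr
          exact hξ h0
    _ ≤ ∫⁻ τ, eLpNorm (fun ξ => k τ * ‖P.piece j ξ • G τ ξ‖ₑ) p volume ∂timeMeasure :=
        eLpNorm_lintegral_le volume timeMeasure hp hm
    _ = ∫⁻ τ, k τ * blk P p j (G τ) ∂timeMeasure := by
        refine lintegral_congr fun τ => ?_
        rw [blk_eq_eLpNorm_enorm, eLpNorm_mul_const _ _ _
          (measurable_piece_smul P j (measurable_section hG τ)).enorm]
    _ ≤ _ := lintegral_mono_ae (hA.mono fun τ hτ => by gcongr)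

/-- On the finite interval `(0, t)` a block that is bounded in time is integrable; Minkowski
transfers this to almost every frequency. -/
theorem ae_lintegral_lt_top (hp : 1 ≤ p) {G : ℝ → E3 → C3}
    (hG : Measurable (Function.uncurry G)) (hGf : ∀ j, timeBlk P p G j < ∞) (t : ℝ) :
    ∀ᵐ ξ, ∫⁻ τ in Ioo 0 t, ‖G τ ξ‖ₑ < ∞ := by
  have hj : ∀ j : ℤ, ∀ᵐ ξ, ∫⁻ τ in Ioo 0 t, ‖P.piece j ξ • G τ ξ‖ₑ < ∞ := by
    intro j
    have hpm : Measurable fun z : E3 × ℝ => ‖P.piece j z.1 • G z.2 z.1‖ₑ :=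
      (((measurable_piece P j).comp measurable_fst).smul (hG.comp measurable_swap)).enorm
    refine ae_lt_top_of_eLpNorm_lt_top hp hpm.lintegral_prod_right' ?_
    refine (eLpNorm_lintegral_le volume (volume.restrict (Ioo 0 t)) hp hpm).trans_lt ?_
    have h1 : ∀ᵐ τ ∂(volume.restrict (Ioo 0 t)), eLpNorm (fun ξ => ‖P.piece j ξ • G τ ξ‖ₑ) p volume
        ≤ timeBlk P p G j := by
      have h2 := ae_blk_le_timeBlk P p G
      have h3 : (volume.restrict (Ioo 0 t)) ≤ timeMeasure :=
        Measure.restrict_mono Ioo_subset_Ioi_self le_rfl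
      filter_upwards [(Measure.absolutelyContinuous_of_le h3) h2] with τ hτ
      rw [← blk_eq_eLpNorm_enorm]
      exact hτ j
    refine (lintegral_mono_ae h1).trans_lt ?_
    rw [lintegral_const]
    refine ENNReal.mul_lt_top (hGf j) ?_
    simp
  filter_upwards [ae_all_iff.2 hj, ae_ne_zero] with ξ h1 h2
  obtain ⟨j, hj⟩ := exists_piece_ne_zero P h2
  have h3 := h1 j
  simp only [enorm_smul] at h3
  rw [lintegral_const_mul' _ _ enorm_ne_top] at h3
  exact ENNReal.lt_top_of_mul_ne_top_right h3.ne (enorm_ne_zero.2 hj)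

end Kernel

/-! ### The Duhamel integral gains `2α` derivatives -/

section Duhamel

variable (P : DyadicPartition) {p q : ℝ≥0∞} {s ν α : ℝ}

theorem measurable_duhamelIntegrand (ν α Ω : ℝ) {G : ℝ → E3 → C3}
    (hG : Measurable (Function.uncurry G)) :
    Measurable fun z : (ℝ × E3) × ℝ => duhamelIntegrand ν α Ω G z.1.1 z.1.2 z.2 := by
  have ht : Measurable fun z : (ℝ × E3) × ℝ => z.1.1 := measurable_fst.comp measurable_fst
  have hξ : Measurable fun z : (ℝ × E3) × ℝ => z.1.2 := measurable_snd.comp measurable_fst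
  refine Measurable.act (fun i k => measurable_semigroupSymbol ν α Ω
    (ht.sub measurable_snd) hξ i k) (Measurable.act (fun i k =>
    (measurable_leraySymbol i k).comp hξ) ?_)
  exact hG.comp (measurable_snd.prodMk hξ)

theorem measurable_duhamelHat (ν α Ω : ℝ) {G : ℝ → E3 → C3}
    (hG : Measurable (Function.uncurry G)) :
    Measurable (Function.uncurry (duhamelHat ν α Ω G)) := by
  have hset : MeasurableSet {z : (ℝ × E3) × ℝ | z.2 ∈ Ioo 0 z.1.1} :=
    (measurableSet_lt measurable_const measurable_snd).inter
      (measurableSet_lt measurable_snd (measurable_fst.comp measurable_fst))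
  have h1 : StronglyMeasurable fun z : (ℝ × E3) × ℝ =>
      {z : (ℝ × E3) × ℝ | z.2 ∈ Ioo 0 z.1.1}.indicator
        (fun z => duhamelIntegrand ν α Ω G z.1.1 z.1.2 z.2) z :=
    ((measurable_duhamelIntegrand ν α Ω hG).indicator hset).stronglyMeasurable
  have h2 : Function.uncurry (duhamelHat ν α Ω G) = fun z : ℝ × E3 =>
      ∫ τ, {z : (ℝ × E3) × ℝ | z.2 ∈ Ioo 0 z.1.1}.indicator
        (fun z => duhamelIntegrand ν α Ω G z.1.1 z.1.2 z.2) (z, τ) := by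
    ext1 z
    rw [Function.uncurry, duhamelHat, ← integral_indicator measurableSet_Ioo]
    rfl
  rw [h2]
  exact (h1.integral_prod_right' (ν := (volume : Measure ℝ))).measurable

theorem enorm_duhamelIntegrand_le (ν α Ω : ℝ) (G : ℝ → E3 → C3) (t : ℝ) (ξ : E3) (τ : ℝ) :
    ‖duhamelIntegrand ν α Ω G t ξ τ‖ₑ ≤
      ENNReal.ofReal (324 * Real.exp (-(ν * (t - τ) * ‖ξ‖ ^ (2 * α)))) * ‖G τ ξ‖ₑ := by
  rw [← ofReal_norm, ← ofReal_norm, ← ENNReal.ofReal_mul (by positivity)]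
  refine ENNReal.ofReal_le_ofReal ?_
  refine (norm_act_semigroupSymbol_le ν α Ω (t - τ) ξ _).trans ?_
  have := norm_act_leraySymbol_le ξ (G τ ξ)
  calc _ ≤ 18 * Real.exp (-(ν * (t - τ) * ‖ξ‖ ^ (2 * α))) * (18 * ‖G τ ξ‖) := by gcongr
    _ = _ := by ring

theorem enorm_duhamelIntegrand_le_const (hν : 0 ≤ ν) (α Ω : ℝ) (G : ℝ → E3 → C3) {t : ℝ} (ξ : E3)
    {τ : ℝ} (h : τ ≤ t) : ‖duhamelIntegrand ν α Ω G t ξ τ‖ₑ ≤ 324 * ‖G τ ξ‖ₑ := by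
  refine (enorm_duhamelIntegrand_le ν α Ω G t ξ τ).trans ?_
  gcongr
  rw [← ENNReal.ofReal_ofNat 324]
  refine ENNReal.ofReal_le_ofReal ?_
  have h1 : 0 ≤ ν * (t - τ) * ‖ξ‖ ^ (2 * α) :=
    mul_nonneg (mul_nonneg hν (sub_nonneg.2 h)) (by positivity)
  have := Real.exp_le_one_iff.2 (neg_nonpos.2 h1)
  linarith

theorem integrableOn_duhamelIntegrand (hν : 0 ≤ ν) (α Ω : ℝ) {G : ℝ → E3 → C3}
    (hG : Measurable (Function.uncurry G)) {t : ℝ} {ξ : E3}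
    (h : ∫⁻ τ in Ioo 0 t, ‖G τ ξ‖ₑ < ∞) :
    IntegrableOn (duhamelIntegrand ν α Ω G t ξ) (Ioo 0 t) := by
  refine ⟨((measurable_duhamelIntegrand ν α Ω hG).comp
    (measurable_const.prodMk measurable_id : Measurable fun τ : ℝ => ((t, ξ), τ))).aestronglyMeasurable,
    ?_⟩
  refine lt_of_le_of_lt (setLIntegral_mono' measurableSet_Ioo fun τ hτ =>
    enorm_duhamelIntegrand_le_const hν α Ω G ξ hτ.2.le) ?_
  rw [lintegral_const_mul' _ _ (by norm_num)]
  exact ENNReal.mul_lt_top (by norm_num) h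

theorem duhamelConverges (hp : 1 ≤ p) (hν : 0 ≤ ν) (α Ω : ℝ) {G : ℝ → E3 → C3}
    (hG : Measurable (Function.uncurry G)) (hGf : ∀ j, timeBlk P p G j < ∞) :
    DuhamelConverges ν α Ω G :=
  Eventually.of_forall fun t => (ae_lintegral_lt_top P hp hG hGf t).mono fun _ hξ =>
    integrableOn_duhamelIntegrand hν α Ω hG hξ

theorem duhamelHat_sub (hν : 0 ≤ ν) (α Ω : ℝ) {G H : ℝ → E3 → C3}
    (hG : Measurable (Function.uncurry G)) (hH : Measurable (Function.uncurry H)) {t : ℝ} {ξ : E3}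
    (h1 : ∫⁻ τ in Ioo 0 t, ‖G τ ξ‖ₑ < ∞) (h2 : ∫⁻ τ in Ioo 0 t, ‖H τ ξ‖ₑ < ∞) :
    duhamelHat ν α Ω (fun τ η => G τ η - H τ η) t ξ =
      duhamelHat ν α Ω G t ξ - duhamelHat ν α Ω H t ξ := by
  rw [duhamelHat, duhamelHat, duhamelHat, ← integral_sub
    (integrableOn_duhamelIntegrand hν α Ω hG h1) (integrableOn_duhamelIntegrand hν α Ω hH h2)]
  simp only [duhamelIntegrand, act_sub_right]

/-- The decay rate of the semigroup on the `j`-th dyadic shell. -/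
def decayRate (ν α : ℝ) (j : ℤ) : ℝ := ν * (3 / 4 * (2 : ℝ) ^ j) ^ (2 * α)

theorem decayRate_eq (ν α : ℝ) (j : ℤ) :
    decayRate ν α j = ν * (3 / 4) ^ (2 * α) * 2 ^ ((j : ℝ) * (2 * α)) := by
  rw [decayRate, Real.mul_rpow (by norm_num) (by positivity), ← Real.rpow_intCast,
    ← Real.rpow_mul (by norm_num), mul_assoc]

theorem decayRate_pos (hν : 0 < ν) (α : ℝ) (j : ℤ) : 0 < decayRate ν α j := by
  unfold decayRate; positivity

theorem decayRate_le (hν : 0 ≤ ν) (hα : 0 ≤ α) {j : ℤ} {ξ : E3} (h : P.piece j ξ ≠ 0) :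
    decayRate ν α j ≤ ν * ‖ξ‖ ^ (2 * α) := by
  unfold decayRate
  gcongr
  exact (norm_bounds_of_piece_ne_zero P h).1

theorem lintegral_exp_decay_le {c : ℝ} (hc : 0 < c) (t : ℝ) :
    ∫⁻ τ in Iic t, ENNReal.ofReal (Real.exp (-(c * (t - τ)))) = ENNReal.ofReal (1 / c) := by
  have h1 : ∀ τ, Real.exp (-(c * (t - τ))) = Real.exp (-(c * t)) * Real.exp (c * τ) := fun τ => by
    rw [← Real.exp_add]; congr 1; ring
  simp only [h1]
  rw [← ofReal_integral_eq_lintegral_ofReal ((integrableOn_exp_mul_Iic hc t).const_mul _)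
    (Eventually.of_forall fun τ => by positivity), integral_const_mul, integral_exp_mul_Iic hc,
    ← mul_div_assoc, ← Real.exp_add, neg_add_cancel, Real.exp_zero]

/-- On the shell the heat factor decays at least at the rate `decayRate`. The bound `A` may vary
with time: a constant gives the norm estimate, a variable one is used in the density argument for `q
= ∞`. -/
theorem blk_duhamelHat_le_lintegral (hp : 1 ≤ p) (hν : 0 ≤ ν) (hα : 0 ≤ α) (Ω : ℝ)
    {G : ℝ → E3 → C3} (hG : Measurable (Function.uncurry G)) (j : ℤ) {A : ℝ → ℝ≥0∞}
    (hA : ∀ᵐ τ ∂timeMeasure, blk P p j (G τ) ≤ A τ) (t : ℝ) :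
    blk P p j (duhamelHat ν α Ω G t) ≤
      324 * ∫⁻ τ in Ioo 0 t, ENNReal.ofReal (Real.exp (-(decayRate ν α j * (t - τ)))) * A τ := by
  have hkm : Measurable fun τ : ℝ =>
      324 * ENNReal.ofReal (Real.exp (-(decayRate ν α j * (t - τ)))) := by fun_prop
  have hr : ∀ f : ℝ → ℝ≥0∞, ∫⁻ τ, (Ioo 0 t).indicator f τ ∂timeMeasure = ∫⁻ τ in Ioo 0 t, f τ := by
    intro f
    rw [lintegral_indicator measurableSet_Ioo, timeMeasure, Measure.restrict_restrict
      measurableSet_Ioo, inter_eq_left.2 Ioo_subset_Ioi_self]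
  refine (blk_le_lintegral_kernel P hp j hG (hkm.indicator (measurableSet_Ioo (a := 0) (b := t)))
    hA ?_).trans (le_of_eq ?_)
  · refine Eventually.of_forall fun ξ hξ => ?_
    have e : ∀ τ, (Ioo 0 t).indicator (fun τ =>
        324 * ENNReal.ofReal (Real.exp (-(decayRate ν α j * (t - τ))))) τ * ‖G τ ξ‖ₑ =
        (Ioo 0 t).indicator (fun τ =>
        324 * ENNReal.ofReal (Real.exp (-(decayRate ν α j * (t - τ)))) * ‖G τ ξ‖ₑ) τ :=
      fun τ => (indicator_mul_left _ _ fun τ => ‖G τ ξ‖ₑ).symm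
    simp only [e]
    rw [hr]
    refine (enorm_integral_le_lintegral_enorm _).trans ?_
    refine setLIntegral_mono' measurableSet_Ioo fun τ hτ => ?_
    refine (enorm_duhamelIntegrand_le ν α Ω G t ξ τ).trans ?_
    gcongr
    rw [← ENNReal.ofReal_ofNat 324, ← ENNReal.ofReal_mul (by norm_num)]
    refine ENNReal.ofReal_le_ofReal ?_
    refine mul_le_mul_of_nonneg_left (Real.exp_le_exp.2 (neg_le_neg ?_)) (by norm_num)
    have h1 := mul_le_mul_of_nonneg_right (decayRate_le P hν hα hξ) (sub_nonneg.2 hτ.2.le)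
    linarith
  · have e : ∀ τ, (Ioo 0 t).indicator (fun τ =>
        324 * ENNReal.ofReal (Real.exp (-(decayRate ν α j * (t - τ))))) τ * A τ =
        (Ioo 0 t).indicator (fun τ =>
        324 * ENNReal.ofReal (Real.exp (-(decayRate ν α j * (t - τ)))) * A τ) τ :=
      fun τ => (indicator_mul_left _ _ _).symm
    simp only [e]
    rw [hr, ← lintegral_const_mul' _ _ (by norm_num)]
    simp only [mul_assoc]

/-- The constant in the maximal regularity estimate of the Duhamel term. -/
def duhamelConst (ν α : ℝ) : ℝ≥0∞ := 324 * ENNReal.ofReal (1 / (ν * (3 / 4) ^ (2 * α)))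

theorem duhamelConst_ne_top : duhamelConst ν α ≠ ∞ :=
  ENNReal.mul_ne_top (by norm_num) ENNReal.ofReal_ne_top

theorem ofReal_inv_decayRate (hν : 0 < ν) (α : ℝ) (j : ℤ) :
    324 * ENNReal.ofReal (1 / decayRate ν α j) =
      duhamelConst ν α * 2 ^ (-((j : ℝ) * (2 * α))) := by
  rw [duhamelConst, mul_assoc, two_rpow_eq_ofReal, ← ENNReal.ofReal_mul (by positivity),
    decayRate_eq, Real.rpow_neg (by norm_num), one_div_mul_eq_div, one_div, mul_inv]
  congr 2
  exact (div_eq_inv_mul _ _).symm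

/-- The exponential kernel has mass `1 / decayRate`, which is proportional to `2^{-2αj}` and does
not depend on `t`. -/
theorem blk_duhamelHat_le (hp : 1 ≤ p) (hν : 0 < ν) (hα : 0 ≤ α) (Ω : ℝ)
    {G : ℝ → E3 → C3} (hG : Measurable (Function.uncurry G)) (j : ℤ) (t : ℝ) :
    blk P p j (duhamelHat ν α Ω G t) ≤
      duhamelConst ν α * (2 ^ (-((j : ℝ) * (2 * α))) * timeBlk P p G j) := by
  refine (blk_duhamelHat_le_lintegral P hp hν.le hα Ω hG j (A := fun _ => timeBlk P p G j)
    ((ae_blk_le_timeBlk P p G).mono fun τ hτ => hτ j) t).trans ?_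
  rw [lintegral_mul_const _ (by fun_prop), ← mul_assoc, ← mul_assoc, ← ofReal_inv_decayRate hν]
  gcongr
  rw [← lintegral_exp_decay_le (decayRate_pos hν α j) t]
  exact lintegral_mono_set fun τ hτ => hτ.2.le

theorem tnorm_duhamelHat_le (hp : 1 ≤ p) (hν : 0 < ν) (hα : 0 ≤ α) (Ω : ℝ)
    {G : ℝ → E3 → C3} (hG : Measurable (Function.uncurry G)) :
    tnorm P s p q (duhamelHat ν α Ω G) ≤ duhamelConst ν α * tnorm P (s - 2 * α) p q G := by
  refine (tnorm_le P (Eventually.of_forall fun t j =>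
    blk_duhamelHat_le P hp hν hα Ω hG j t)).trans (le_of_eq ?_)
  rw [wsn_const_mul]
  congr 1
  have e : ∀ j : ℤ, -((j : ℝ) * (2 * α)) = j * -(2 * α) := fun j => by ring
  simp only [e]
  rw [wsn_weight, ← sub_eq_add_neg]
  rfl

theorem measurable_semigroup (ν α Ω : ℝ) {U₀ : E3 → C3} (hU : Measurable U₀) :
    Measurable (Function.uncurry fun (t : ℝ) ξ => act (semigroupSymbol ν α Ω t ξ) (U₀ ξ)) :=
  Measurable.act (fun i k => measurable_semigroupSymbol ν α Ω measurable_fst measurable_snd i k)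
    (hU.comp measurable_snd)

theorem blk_semigroup_le (hν : 0 ≤ ν) (α Ω : ℝ) {U₀ : E3 → C3} (hU : Measurable U₀) {t : ℝ}
    (ht : 0 ≤ t) (j : ℤ) :
    blk P p j (fun ξ => act (semigroupSymbol ν α Ω t ξ) (U₀ ξ)) ≤ 18 * blk P p j U₀ := by
  refine blk_le_const_mul P p j hU (Eventually.of_forall fun ξ _ => ?_)
  rw [← ofReal_norm, ← ofReal_norm, ← ENNReal.ofReal_ofNat 18, ← ENNReal.ofReal_mul (by norm_num)]
  refine ENNReal.ofReal_le_ofReal ((norm_act_semigroupSymbol_le ν α Ω t ξ _).trans ?_)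
  gcongr
  have h1 : 0 ≤ ν * t * ‖ξ‖ ^ (2 * α) := by positivity
  have := Real.exp_le_one_iff.2 (neg_nonpos.2 h1)
  linarith

theorem fnNorm_semigroup_le (hν : 0 ≤ ν) (α Ω : ℝ) {U₀ : E3 → C3} (hU : Measurable U₀) {t : ℝ}
    (ht : 0 ≤ t) :
    fnNorm P s p q (fun ξ => act (semigroupSymbol ν α Ω t ξ) (U₀ ξ)) ≤ 18 * fnNorm P s p q U₀ := by
  refine (wsn_mono fun j => blk_semigroup_le P hν α Ω hU ht j).trans (le_of_eq ?_)
  exact wsn_const_mul _ _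

theorem tnorm_semigroup_le (hν : 0 ≤ ν) (α Ω : ℝ) {U₀ : E3 → C3} (hU : Measurable U₀) :
    tnorm P s p q (fun t ξ => act (semigroupSymbol ν α Ω t ξ) (U₀ ξ)) ≤
      18 * fnNorm P s p q U₀ := by
  refine (tnorm_le P (a := fun j => 18 * blk P p j U₀)
    (ae_timeMeasure_pos.mono fun t ht j => blk_semigroup_le P hν α Ω hU ht.le j)).trans (le_of_eq ?_)
  exact wsn_const_mul _ _

end Duhamel

/-! ### Lipschitz continuity in time of the free evolution and of Duhamel integrals with constant
source -/

section Lipschitz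

variable (P : DyadicPartition) {p q : ℝ≥0∞} {s ν α : ℝ}

theorem SeparablyValued.of_lipschitz {P : DyadicPartition} {U : ℝ → E3 → C3}
    (hU : ∀ t, Measurable (U t)) (hfin : ∀ t, 0 < t → fnNorm P s p q (U t) < ∞)
    (h : ∀ a b : ℝ, 0 < a → ∃ C : ℝ≥0∞, C ≠ ∞ ∧ ∀ r t, a ≤ r → r ≤ t → t ≤ b →
      fnNorm P s p q (fun ξ => U t ξ - U r ξ) ≤ C * ENNReal.ofReal (t - r)) :
    SeparablyValued P s p q U := by
  refine SeparablyValued.of_continuous hU hfin fun t ht ε hε => ?_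
  obtain ⟨C, hC, hb⟩ := h (t / 2) (2 * t) (by positivity)
  obtain ⟨δ, hδ0, hδ⟩ := ENNReal.exists_nnreal_pos_mul_lt hC hε.ne'
  have hδ0' : (0 : ℝ) < δ := hδ0
  have key : ∀ x : ℝ, x < δ → C * ENNReal.ofReal x < ε := by
    intro x hx
    refine lt_of_le_of_lt ?_ hδ
    rw [mul_comm]
    gcongr
    rw [← ENNReal.ofReal_coe_nnreal]
    exact ENNReal.ofReal_le_ofReal hx.le
  filter_upwards [Ioo_mem_nhds (show t - min (δ : ℝ) (t / 2) < t by
      have := lt_min hδ0' (half_pos ht); linarith)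
    (show t < t + min (δ : ℝ) (t / 2) by have := lt_min hδ0' (half_pos ht); linarith)] with r hr
  have h1 := min_le_left (δ : ℝ) (t / 2)
  have h2 := min_le_right (δ : ℝ) (t / 2)
  rcases le_total r t with hrt | hrt
  · exact (hb r t (by linarith [hr.1]) hrt (by linarith)).trans_lt (key _ (by linarith [hr.1]))
  · rw [fnNorm_sub_comm]
    exact (hb t r (by linarith) hrt (by linarith [hr.2])).trans_lt (key _ (by linarith [hr.2]))

theorem fnNorm_le_of_blk_le {g : E3 → C3} {c : ℝ≥0∞} {a : ℤ → ℝ≥0∞}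
    (h : ∀ j, blk P p j g ≤ c * a j) : fnNorm P s p q g ≤ c * weightedSeqNorm s q a :=
  (wsn_mono h).trans_eq (wsn_const_mul _ _)

theorem mul_exp_neg_le {m y : ℝ} (hm : 0 < m) : y * Real.exp (-(m * y)) ≤ 1 / m := by
  have h1 := Real.add_one_le_exp (m * y)
  rw [Real.exp_neg, ← div_eq_mul_inv, div_le_div_iff₀ (Real.exp_pos _) hm]
  linarith

/-- Parabolic smoothing: `y exp(-r y) ≤ 1/r ≤ 1/a` absorbs the unbounded factor `ν|ξ|^{2α}`, so the
evolution is Lipschitz in the norm of the data for times at least `a > 0`. -/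
theorem separablyValued_semigroup (hν : 0 < ν) (α Ω : ℝ) {U₀ : E3 → C3} (hU : Measurable U₀)
    (hfin : fnNorm P s p q U₀ < ∞) :
    SeparablyValued P s p q (fun t ξ => act (semigroupSymbol ν α Ω t ξ) (U₀ ξ)) := by
  refine SeparablyValued.of_lipschitz (measurable_section (measurable_semigroup ν α Ω hU))
    (fun t ht => (fnNorm_semigroup_le P hν.le α Ω hU ht.le).trans_lt
      (ENNReal.mul_lt_top (by norm_num) hfin)) fun a b ha => ?_
  refine ⟨ENNReal.ofReal (18 * (|Ω| + 1 / a)) * fnNorm P s p q U₀,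
    ENNReal.mul_ne_top ENNReal.ofReal_ne_top hfin.ne, fun r t har hrt _ => ?_⟩
  rw [mul_right_comm]
  refine fnNorm_le_of_blk_le P fun j => blk_le_const_mul P p j hU
    (Eventually.of_forall fun ξ _ => ?_)
  rw [← ENNReal.ofReal_mul (by positivity), ← ofReal_norm, ← ofReal_norm,
    ← ENNReal.ofReal_mul (mul_nonneg (by positivity) (sub_nonneg.2 hrt))]
  refine ENNReal.ofReal_le_ofReal
    ((norm_act_semigroupSymbol_sub_le hν.le α Ω hrt ξ (U₀ ξ)).trans ?_)
  refine mul_le_mul_of_nonneg_right ?_ (norm_nonneg _)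
  set y := ν * ‖ξ‖ ^ (2 * α) with hy
  have hy0 : 0 ≤ y := by positivity
  have hr : 0 < r := ha.trans_le har
  rw [show ν * r * ‖ξ‖ ^ (2 * α) = r * y by rw [hy]; ring]
  have h1 : y * Real.exp (-(r * y)) ≤ 1 / a :=
    (mul_exp_neg_le hr).trans (one_div_le_one_div_of_le ha har)
  have h2 : Real.exp (-(r * y)) ≤ 1 :=
    Real.exp_le_one_iff.2 (neg_nonpos.2 (mul_nonneg hr.le hy0))
  have h3 : |Ω| * Real.exp (-(r * y)) ≤ |Ω| := mul_le_of_le_one_right (abs_nonneg _) h2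
  calc 18 * ((|Ω| + y) * (t - r) * Real.exp (-(r * y)))
      = 18 * (|Ω| * Real.exp (-(r * y)) + y * Real.exp (-(r * y))) * (t - r) := by ring
    _ ≤ 18 * (|Ω| + 1 / a) * (t - r) := by
        refine mul_le_mul_of_nonneg_right ?_ (sub_nonneg.2 hrt)
        linarith

theorem fnNorm_duhamelHat_le (hp : 1 ≤ p) (hν : 0 < ν) (hα : 0 ≤ α) (Ω : ℝ)
    {G : ℝ → E3 → C3} (hG : Measurable (Function.uncurry G)) (t : ℝ) :
    fnNorm P s p q (duhamelHat ν α Ω G t) ≤ duhamelConst ν α * tnorm P (s - 2 * α) p q G := by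
  refine (fnNorm_le_of_blk_le P fun j =>
    blk_duhamelHat_le P hp hν hα Ω hG j t).trans (le_of_eq ?_)
  congr 1
  have e : ∀ j : ℤ, -((j : ℝ) * (2 * α)) = j * -(2 * α) := fun j => by ring
  simp only [e]
  rw [wsn_weight, ← sub_eq_add_neg]
  rfl

theorem tnorm_const_le (D : E3 → C3) :
    tnorm P s p q (fun _ => D) ≤ fnNorm P s p q D :=
  tnorm_le P (a := fun j => blk P p j D) (Eventually.of_forall fun _ _ => le_rfl)

theorem continuous_act_semigroupSymbol (ν α Ω : ℝ) (ξ : E3) (w : C3) :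
    Continuous fun t => act (semigroupSymbol ν α Ω t ξ) w := by
  refine (PiLp.continuous_toLp 2 _).comp (continuous_pi fun i => ?_)
  suffices h : ∀ k, Continuous fun t => semigroupSymbol ν α Ω t ξ i k by
    have h' : Continuous fun t => ∑ k, semigroupSymbol ν α Ω t ξ i k * w k :=
      continuous_finsetSum _ fun k _ => (h k).mul continuous_const
    exact h'
  intro k
  refine Continuous.add ?_ ?_
  · refine Continuous.mul (Complex.continuous_ofReal.comp ?_) continuous_const
    fun_prop
  · refine Continuous.mul (Complex.continuous_ofReal.comp ?_) continuous_const
    fun_prop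

/-- Substituting `σ = t - τ` leaves `t` only as an endpoint, so the increment between two times is
an integral over the interval between them. -/
theorem duhamelHat_const_eq (ν α Ω : ℝ) (D : E3 → C3) {t : ℝ} (ht : 0 ≤ t) (ξ : E3) :
    duhamelHat ν α Ω (fun _ => D) t ξ =
      ∫ σ in (0 : ℝ)..t, act (semigroupSymbol ν α Ω σ ξ) (act (leraySymbol ξ) (D ξ)) := by
  have h := intervalIntegral.integral_comp_sub_left (a := 0) (b := t)
    (fun σ => act (semigroupSymbol ν α Ω σ ξ) (act (leraySymbol ξ) (D ξ))) t
  rw [sub_self, sub_zero] at h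
  rw [← h, intervalIntegral.integral_of_le ht, integral_Ioc_eq_integral_Ioo]
  rfl

/-- On the shell `exp(-σ y) ≤ (1/a)(1/decayRate)` for `σ ≥ a`. The factor `1/decayRate` is the gain
of `2α` derivatives, and the length of the interval gives the Lipschitz bound. -/
theorem separablyValued_duhamelHat_const (hp : 1 ≤ p) (hν : 0 < ν) (hα : 0 ≤ α) (Ω : ℝ)
    {D : E3 → C3} (hD : Measurable D) (hfin : fnNorm P (s - 2 * α) p q D < ∞) :
    SeparablyValued P s p q (duhamelHat ν α Ω (fun _ => D)) := by
  have hDm : Measurable (Function.uncurry fun _ : ℝ => D) := hD.comp measurable_snd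
  refine SeparablyValued.of_lipschitz (measurable_section (measurable_duhamelHat ν α Ω hDm))
    (fun t _ => (fnNorm_duhamelHat_le P hp hν hα Ω hDm t).trans_lt (ENNReal.mul_lt_top
      duhamelConst_ne_top.lt_top ((tnorm_const_le P D).trans_lt hfin))) fun a b ha => ?_
  refine ⟨ENNReal.ofReal (1 / a) * (duhamelConst ν α * fnNorm P (s - 2 * α) p q D),
    ENNReal.mul_ne_top ENNReal.ofReal_ne_top (ENNReal.mul_ne_top duhamelConst_ne_top hfin.ne),
    fun r t har hrt _ => ?_⟩
  have hr : 0 < r := ha.trans_le har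
  have hw : fnNorm P (s - 2 * α) p q D =
      weightedSeqNorm s q (fun j => 2 ^ (-((j : ℝ) * (2 * α))) * blk P p j D) := by
    have e : ∀ j : ℤ, -((j : ℝ) * (2 * α)) = j * -(2 * α) := fun j => by ring
    simp only [e]
    rw [wsn_weight, ← sub_eq_add_neg]
    rfl
  rw [hw, ← mul_assoc, mul_right_comm]
  refine fnNorm_le_of_blk_le P fun j => ?_
  rw [← mul_assoc, mul_right_comm _ (duhamelConst ν α), mul_assoc _ (duhamelConst ν α),
    ← ofReal_inv_decayRate hν]
  refine blk_le_const_mul P p j hD (Eventually.of_forall fun ξ hξ => ?_)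
  rw [duhamelHat_const_eq ν α Ω D (hr.le.trans hrt), duhamelHat_const_eq ν α Ω D hr.le]
  have hc := continuous_act_semigroupSymbol ν α Ω ξ (act (leraySymbol ξ) (D ξ))
  rw [intervalIntegral.integral_interval_sub_left (hc.intervalIntegrable _ _)
    (hc.intervalIntegrable _ _)]
  have hd := decayRate_pos hν α j
  have hb : ∀ σ ∈ uIoc r t, ‖act (semigroupSymbol ν α Ω σ ξ) (act (leraySymbol ξ) (D ξ))‖ ≤
      324 * (1 / a * (1 / decayRate ν α j)) * ‖D ξ‖ := by
    intro σ hσ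
    rw [uIoc_of_le hrt] at hσ
    have hσa : a ≤ σ := har.trans hσ.1.le
    have hσ0 : 0 < σ := ha.trans_le hσa
    set y := ν * ‖ξ‖ ^ (2 * α) with hy
    have h0 : decayRate ν α j ≤ y := decayRate_le P hν.le hα hξ
    have h1 : Real.exp (-(ν * σ * ‖ξ‖ ^ (2 * α))) ≤ 1 / a * (1 / decayRate ν α j) := by
      rw [show ν * σ * ‖ξ‖ ^ (2 * α) = σ * y by rw [hy]; ring]
      have h2 : decayRate ν α j * Real.exp (-(σ * y)) ≤ 1 / a :=
        (mul_le_mul_of_nonneg_right h0 (Real.exp_pos _).le).trans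
          ((mul_exp_neg_le hσ0).trans (one_div_le_one_div_of_le ha hσa))
      rw [mul_one_div, le_div_iff₀ hd]
      linarith
    calc _ ≤ 18 * Real.exp (-(ν * σ * ‖ξ‖ ^ (2 * α))) * ‖act (leraySymbol ξ) (D ξ)‖ :=
          norm_act_semigroupSymbol_le _ _ _ _ _ _
      _ ≤ 18 * (1 / a * (1 / decayRate ν α j)) * (18 * ‖D ξ‖) := by
          gcongr
          exact norm_act_leraySymbol_le ξ (D ξ)
      _ = _ := by ring
  have h3 := intervalIntegral.norm_integral_le_of_norm_le_const hb
  rw [abs_of_nonneg (sub_nonneg.2 hrt)] at h3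
  rw [← ENNReal.ofReal_ofNat 324, ← ENNReal.ofReal_mul (one_div_nonneg.2 ha.le),
    ← ENNReal.ofReal_mul (p := OfNat.ofNat 324) (by norm_num), ← ENNReal.ofReal_mul (mul_nonneg
      (one_div_nonneg.2 ha.le) (sub_nonneg.2 hrt)), ← ofReal_norm, ← ofReal_norm, ← ENNReal.ofReal_mul
      (mul_nonneg (mul_nonneg (one_div_nonneg.2 ha.le) (sub_nonneg.2 hrt)) (by positivity))]
  refine ENNReal.ofReal_le_ofReal (h3.trans_eq ?_)
  ring

end Lipschitz

/-! ### Low-frequency truncations of the Duhamel integral -/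

section Cutoffs

variable (P : DyadicPartition) {p q : ℝ≥0∞} {s ν α : ℝ}

/-- The part of `g` at the frequencies `|ξ| ≤ 2ⁿ`. -/
def lowFreq (n : ℕ) (g : E3 → C3) (ξ : E3) : C3 := {ξ : E3 | ‖ξ‖ ≤ 2 ^ n}.indicator g ξ

theorem measurableSet_norm_le (c : ℝ) : MeasurableSet {ξ : E3 | ‖ξ‖ ≤ c} :=
  measurableSet_le measurable_norm measurable_const

theorem measurable_lowFreq (n : ℕ) {g : E3 → C3} (hg : Measurable g) : Measurable (lowFreq n g) :=
  hg.indicator (measurableSet_norm_le _)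

theorem enorm_lowFreq_le (n : ℕ) (g : E3 → C3) (ξ : E3) : ‖lowFreq n g ξ‖ₑ ≤ ‖g ξ‖ₑ :=
  enorm_indicator_le_enorm_self _ _

theorem fnNorm_lowFreq_le (n : ℕ) (g : E3 → C3) :
    fnNorm P s p q (lowFreq n g) ≤ fnNorm P s p q g :=
  wsn_mono fun j => blk_mono P p j (Eventually.of_forall fun ξ _ => enorm_lowFreq_le n g ξ)

theorem index_le_of_piece_ne_zero {j : ℤ} {ξ : E3} (h : P.piece j ξ ≠ 0) {n : ℕ}
    (hξ : ‖ξ‖ ≤ 2 ^ n) : j ≤ n := by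
  by_contra hcon
  have h1 : (2 : ℝ) ^ ((n : ℤ) + 1) ≤ 2 ^ j := zpow_le_zpow_right₀ (by norm_num) (by lia)
  have h2 := (norm_bounds_of_piece_ne_zero P h).1
  rw [zpow_add_one₀ (by norm_num), zpow_natCast] at h1
  have : (0 : ℝ) < 2 ^ n := by positivity
  linarith

theorem le_index_of_piece_ne_zero {j : ℤ} {ξ : E3} (h : P.piece j ξ ≠ 0) {n : ℕ}
    (hξ : ¬ ‖ξ‖ ≤ 2 ^ n) : (n : ℤ) - 1 ≤ j := by
  by_contra hcon
  have h1 : (2 : ℝ) ^ (j + 2) ≤ 2 ^ (n : ℤ) := zpow_le_zpow_right₀ (by norm_num) (by lia)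
  have h2 := (norm_bounds_of_piece_ne_zero P h).2
  rw [zpow_add₀ (by norm_num), zpow_natCast] at h1
  have : (0 : ℝ) < 2 ^ j := by positivity
  norm_num at h1
  linarith

theorem blk_sub_lowFreq_le (p : ℝ≥0∞) (n : ℕ) (g : E3 → C3) (j : ℤ) :
    blk P p j (fun ξ => g ξ - lowFreq n g ξ) ≤
      {j : ℤ | (n : ℤ) - 1 ≤ j}.indicator (fun j => blk P p j g) j := by
  by_cases hj : (n : ℤ) - 1 ≤ j
  · rw [indicator_of_mem (by exact hj)]
    refine blk_mono P p j (Eventually.of_forall fun ξ _ => ?_)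
    by_cases h : ‖ξ‖ ≤ 2 ^ n
    · have : lowFreq n g ξ = g ξ := indicator_of_mem (by exact h) g
      simp [this]
    · have : lowFreq n g ξ = 0 := indicator_of_notMem (by exact h) g
      simp [this]
  · refine (blk_mono P p j (g' := fun _ => 0) (Eventually.of_forall fun ξ hξ => ?_)).trans
      ((blk_zero P p j).le.trans zero_le)
    have : lowFreq n g ξ = g ξ := indicator_of_mem (s := {ξ : E3 | ‖ξ‖ ≤ 2 ^ n}) (by
      by_contra h
      exact hj (le_index_of_piece_ne_zero P hξ h)) g
    simp [this]

/-- For `|ξ| ≤ 2^n` the time derivative of the symbol is bounded, so the truncated integral is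
Lipschitz on bounded time intervals. Its blocks are controlled at regularity `s - 2α`, and passing
to `s` costs at most `2^{2αn}` because only `j ≤ n` contribute. -/
theorem separablyValued_lowFreq_duhamelHat (hp : 1 ≤ p) (hq : 1 ≤ q) (hν : 0 < ν) (hα : 0 ≤ α)
    (Ω : ℝ) {G : ℝ → E3 → C3} (hG : Measurable (Function.uncurry G))
    (hfin : tnorm P (s - 2 * α) p q G < ∞) (n : ℕ) :
    SeparablyValued P s p q (fun t => lowFreq n (duhamelHat ν α Ω G t)) := by
  have hm := measurable_section (measurable_duhamelHat ν α Ω hG)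
  have hGf : ∀ j, timeBlk P p G j < ∞ := lt_top_of_wsn hq hfin
  refine SeparablyValued.of_lipschitz (fun t => measurable_lowFreq n (hm t))
    (fun t _ => (fnNorm_lowFreq_le P n _).trans_lt
      ((fnNorm_duhamelHat_le P hp hν hα Ω hG t).trans_lt (ENNReal.mul_lt_top
      duhamelConst_ne_top.lt_top hfin))) fun a b ha => ?_
  set L : ℝ := 324 * ((|Ω| + ν * (2 ^ n) ^ (2 * α)) * b + 1) with hL
  refine ⟨ENNReal.ofReal L * 2 ^ ((n : ℝ) * (2 * α)) * tnorm P (s - 2 * α) p q G,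
    ENNReal.mul_ne_top (ENNReal.mul_ne_top ENNReal.ofReal_ne_top (two_rpow_ne_top _)) hfin.ne,
    fun r t har hrt htb => ?_⟩
  have hr0 : 0 < r := ha.trans_le har
  have hb0 : 0 < b := by linarith
  have htr : 0 ≤ t - r := sub_nonneg.2 hrt
  have hw : tnorm P (s - 2 * α) p q G =
      weightedSeqNorm s q (fun j => 2 ^ (-((j : ℝ) * (2 * α))) * timeBlk P p G j) := by
    have e : ∀ j : ℤ, -((j : ℝ) * (2 * α)) = j * -(2 * α) := fun j => by ring
    simp only [e]
    rw [wsn_weight, ← sub_eq_add_neg]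
    rfl
  rw [hw, mul_right_comm]
  refine fnNorm_le_of_blk_le P fun j => ?_
  by_cases hj : j ≤ n
  swap
  · refine (blk_mono P p j (g' := fun _ => 0) (Eventually.of_forall fun ξ hξ => ?_)).trans
      ((blk_zero P p j).le.trans zero_le)
    have hξ' : ξ ∉ {ξ : E3 | ‖ξ‖ ≤ 2 ^ n} := fun h => hj (index_le_of_piece_ne_zero P hξ h)
    simp [lowFreq, indicator_of_notMem hξ']
  set κ : ℝ := 324 * ((|Ω| + ν * (2 ^ n) ^ (2 * α)) * (t - r)) with hκ
  have hκ0 : 0 ≤ κ := by positivity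
  -- Before `r` the increment comes from the change of the symbol, of size `κ`; on `[r, t)` it is
  -- the newly added part of the integral, with integrand bounded by `324 |G|`. Both parts have mass
  -- `O(t - r)`.
  set k : ℝ → ℝ≥0∞ := fun τ => (Ioo 0 r).indicator (fun _ => ENNReal.ofReal κ) τ +
    (Ico r t).indicator (fun _ => 324) τ with hk
  have hkm : Measurable k := (measurable_const.indicator measurableSet_Ioo).add
    (measurable_const.indicator measurableSet_Ico)
  have hr' : ∀ (E : Set ℝ) (_ : MeasurableSet E) (_ : E ⊆ Ioi 0) (f : ℝ → ℝ≥0∞),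
      ∫⁻ τ, E.indicator f τ ∂timeMeasure = ∫⁻ τ in E, f τ := by
    intro E hE hE' f
    rw [lintegral_indicator hE, timeMeasure, Measure.restrict_restrict hE, inter_eq_left.2 hE']
  have hS1 : Ioo 0 r ⊆ Ioi (0 : ℝ) := Ioo_subset_Ioi_self
  have hS2 : Ico r t ⊆ Ioi 0 := fun x hx => hr0.trans_le hx.1
  have hkint : ∫⁻ τ, k τ * timeBlk P p G j ∂timeMeasure ≤
      ENNReal.ofReal L * ENNReal.ofReal (t - r) * timeBlk P p G j := by
    rw [lintegral_mul_const _ hkm]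
    gcongr
    rw [hk, lintegral_add_left (measurable_const.indicator measurableSet_Ioo),
      hr' _ measurableSet_Ioo hS1, hr' _ measurableSet_Ico hS2, setLIntegral_const,
      setLIntegral_const, Real.volume_Ioo, Real.volume_Ico, ← ENNReal.ofReal_mul hκ0,
      ← ENNReal.ofReal_ofNat 324, ← ENNReal.ofReal_mul (by norm_num),
      ← ENNReal.ofReal_add (by positivity) (by positivity), ← ENNReal.ofReal_mul (by positivity)]
    refine ENNReal.ofReal_le_ofReal ?_
    rw [sub_zero, hL]
    have : κ * r ≤ κ * b := mul_le_mul_of_nonneg_left (hrt.trans htb) hκ0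
    calc κ * r + 324 * (t - r) ≤ κ * b + 324 * (t - r) := by linarith
      _ = _ := by rw [hκ]; ring
  have hblk : blk P p j (fun ξ => lowFreq n (duhamelHat ν α Ω G t) ξ -
      lowFreq n (duhamelHat ν α Ω G r) ξ) ≤ ∫⁻ τ, k τ * timeBlk P p G j ∂timeMeasure := by
    refine blk_le_lintegral_kernel P hp j hG hkm (A := fun _ => timeBlk P p G j)
      ((ae_blk_le_timeBlk P p G).mono fun τ hτ => hτ j) ?_
    filter_upwards [ae_lintegral_lt_top P hp hG hGf t] with ξ hξ _
    by_cases hξn : ‖ξ‖ ≤ 2 ^ n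
    swap
    · have hξ' : ξ ∉ {ξ : E3 | ‖ξ‖ ≤ 2 ^ n} := hξn
      simp [lowFreq, indicator_of_notMem hξ']
    have hξ' : ξ ∈ {ξ : E3 | ‖ξ‖ ≤ 2 ^ n} := hξn
    simp only [lowFreq, indicator_of_mem hξ']
    have hsub : Ioo 0 r ⊆ Ioo 0 t := Ioo_subset_Ioo_right hrt
    have hsub2 : Ico r t ⊆ Ioo 0 t := fun x hx => ⟨hr0.trans_le hx.1, hx.2⟩
    have hi := integrableOn_duhamelIntegrand hν.le α Ω hG hξ
    have hi' := integrableOn_duhamelIntegrand hν.le α Ω hG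
      ((lintegral_mono_set hsub).trans_lt hξ)
    have hsplit : duhamelHat ν α Ω G t ξ - duhamelHat ν α Ω G r ξ =
        (∫ τ in Ioo 0 r, (duhamelIntegrand ν α Ω G t ξ τ - duhamelIntegrand ν α Ω G r ξ τ)) +
          ∫ τ in Ico r t, duhamelIntegrand ν α Ω G t ξ τ := by
      rw [integral_sub (hi.mono_set hsub) hi', duhamelHat, duhamelHat,
        ← Ioo_union_Ico_eq_Ioo hr0 hrt, setIntegral_union (by
          rw [Set.disjoint_left]; intro x hx hx'; exact absurd hx.2 (not_lt.2 hx'.1))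
          measurableSet_Ico (hi.mono_set hsub) (hi.mono_set hsub2)]
      abel
    have e1 : ∀ τ, k τ * ‖G τ ξ‖ₑ =
        (Ioo 0 r).indicator (fun τ => ENNReal.ofReal κ * ‖G τ ξ‖ₑ) τ +
        (Ico r t).indicator (fun τ => 324 * ‖G τ ξ‖ₑ) τ := by
      intro τ
      rw [hk, add_mul, indicator_mul_left _ _ (fun τ => ‖G τ ξ‖ₑ),
        indicator_mul_left _ _ (fun τ => ‖G τ ξ‖ₑ)]
    have hGm : Measurable fun τ => ‖G τ ξ‖ₑ :=
      (hG.comp (measurable_id.prodMk measurable_const)).enorm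
    rw [hsplit]
    simp only [e1]
    have hm1 : Measurable ((Ioo 0 r).indicator fun τ => ENNReal.ofReal κ * ‖G τ ξ‖ₑ) :=
      (hGm.const_mul _).indicator measurableSet_Ioo
    rw [lintegral_add_left hm1,
      hr' _ measurableSet_Ioo hS1, hr' _ measurableSet_Ico hS2]
    refine (enorm_add_le _ _).trans (add_le_add ?_ ?_)
    · refine (enorm_integral_le_lintegral_enorm _).trans
        (setLIntegral_mono' measurableSet_Ioo fun τ hτ => ?_)
      rw [← ofReal_norm, ← ofReal_norm, ← ENNReal.ofReal_mul hκ0]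
      refine ENNReal.ofReal_le_ofReal ?_
      refine (norm_act_semigroupSymbol_sub_le hν.le α Ω (sub_le_sub_right hrt τ) ξ _).trans ?_
      have h1 : Real.exp (-(ν * (r - τ) * ‖ξ‖ ^ (2 * α))) ≤ 1 := by
        refine Real.exp_le_one_iff.2 (neg_nonpos.2 ?_)
        have := sub_nonneg.2 hτ.2.le
        positivity
      have h2 : ‖ξ‖ ^ (2 * α) ≤ (2 ^ n) ^ (2 * α) := by gcongr
      calc 18 * ((|Ω| + ν * ‖ξ‖ ^ (2 * α)) * (t - τ - (r - τ)) *
            Real.exp (-(ν * (r - τ) * ‖ξ‖ ^ (2 * α)))) * ‖act (leraySymbol ξ) (G τ ξ)‖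
          ≤ 18 * ((|Ω| + ν * (2 ^ n) ^ (2 * α)) * (t - r) * 1) * (18 * ‖G τ ξ‖) := by
            rw [show t - τ - (r - τ) = t - r by ring]
            gcongr
            exact norm_act_leraySymbol_le ξ _
        _ = _ := by rw [hκ]; ring
    · refine (enorm_integral_le_lintegral_enorm _).trans
        (setLIntegral_mono' measurableSet_Ico fun τ hτ => ?_)
      exact enorm_duhamelIntegrand_le_const hν.le α Ω G ξ hτ.2.le
  refine hblk.trans (hkint.trans ?_)
  have h1 : (1 : ℝ≥0∞) ≤ 2 ^ ((n : ℝ) * (2 * α)) * 2 ^ (-((j : ℝ) * (2 * α))) := by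
    rw [← two_rpow_add]
    have h2 : (j : ℝ) ≤ n := by exact_mod_cast hj
    refine (ENNReal.rpow_zero (x := 2)).symm.le.trans
      (ENNReal.rpow_le_rpow_of_exponent_le (by norm_num) ?_)
    nlinarith
  calc ENNReal.ofReal L * ENNReal.ofReal (t - r) * timeBlk P p G j
      = ENNReal.ofReal L * ENNReal.ofReal (t - r) * (1 * timeBlk P p G j) := by rw [one_mul]
    _ ≤ ENNReal.ofReal L * ENNReal.ofReal (t - r) *
        ((2 ^ ((n : ℝ) * (2 * α)) * 2 ^ (-((j : ℝ) * (2 * α)))) * timeBlk P p G j) := by gcongr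
    _ = _ := by ring

end Cutoffs

/-! ### Exponential kernels at points of density -/

section Density

/-- At a point where the set `E` has density zero, the normalized exponential kernels put
asymptotically no mass on `E`. -/
theorem eventually_kernel_mass_le {E : Set ℝ} (hE : MeasurableSet E) {t : ℝ}
    (h : Tendsto (fun r => volume (E ∩ Metric.closedBall t r) / volume (Metric.closedBall t r))
      (𝓝[>] 0) (𝓝 0)) {δ : ℝ} (hδ : 0 < δ) :
    ∀ᶠ c : ℝ in atTop, ∫⁻ τ in Iic t ∩ E, ENNReal.ofReal (Real.exp (-(c * (t - τ)))) ≤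
      ENNReal.ofReal δ * ENNReal.ofReal (1 / c) := by
  -- The kernel lives at distance `1/c`. Beyond distance `R/c` half of the exponent gives
  -- `exp(-R/2)`, and the other half still has mass `2/c`.
  obtain ⟨R, hR0, hR⟩ : ∃ R : ℝ, 0 < R ∧ 2 * Real.exp (-(R / 2)) ≤ δ / 2 := by
    have h1 : Tendsto (fun R : ℝ => 2 * Real.exp (-(R / 2))) atTop (𝓝 (2 * 0)) :=
      (Real.tendsto_exp_neg_atTop_nhds_zero.comp
        (tendsto_id.atTop_div_const (by norm_num : (0 : ℝ) < 2))).const_mul 2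
    rw [mul_zero] at h1
    obtain ⟨R, h2, h3⟩ := ((h1.eventually_le_const (half_pos hδ)).and (eventually_gt_atTop 0)).exists
    exact ⟨R, h3, h2⟩
  have h1 : Tendsto (fun c : ℝ => R / c) atTop (𝓝[>] 0) := by
    refine tendsto_nhdsWithin_iff.2 ⟨tendsto_const_nhds.div_atTop tendsto_id, ?_⟩
    filter_upwards [eventually_gt_atTop 0] with c hc
    exact div_pos hR0 hc
  -- The ball of radius `R/c` has length `2R/c`, so a share `δ/(4R)` of it measures `(δ/2)(1/c)`.
  have hη : (0 : ℝ≥0∞) < ENNReal.ofReal (δ / (4 * R)) := ENNReal.ofReal_pos.2 (by positivity)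
  filter_upwards [(h.comp h1).eventually_le_const hη, eventually_gt_atTop 0] with c hc hc0
  have hρ : 0 < R / c := div_pos hR0 hc0
  have hvol : volume (E ∩ Metric.closedBall t (R / c)) ≤
      ENNReal.ofReal (δ / 2) * ENNReal.ofReal (1 / c) := by
    have h2 : volume (Metric.closedBall t (R / c)) = ENNReal.ofReal (2 * (R / c)) :=
      Real.volume_closedBall t _
    rw [Function.comp_apply, ENNReal.div_le_iff (by rw [h2]; simpa using hρ)
      (by rw [h2]; exact ENNReal.ofReal_ne_top)] at hc
    refine hc.trans (le_of_eq ?_)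
    rw [h2, ← ENNReal.ofReal_mul (by positivity), ← ENNReal.ofReal_mul (by positivity)]
    congr 1
    field_simp
    ring
  have hsub : Iic t ∩ E ⊆ (E ∩ Metric.closedBall t (R / c)) ∪ Iic (t - R / c) := by
    rintro τ ⟨h3, h4⟩
    by_cases h5 : τ ≤ t - R / c
    · exact Or.inr h5
    · refine Or.inl ⟨h4, ?_⟩
      rw [Metric.mem_closedBall, Real.dist_eq, abs_sub_comm, abs_of_nonneg (sub_nonneg.2 h3)]
      linarith [not_le.1 h5]
  have hlow : ∫⁻ τ in E ∩ Metric.closedBall t (R / c) ∩ Iic t,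
      ENNReal.ofReal (Real.exp (-(c * (t - τ)))) ≤ ENNReal.ofReal (δ / 2) * ENNReal.ofReal (1 / c) := by
    refine le_trans (setLIntegral_mono' ((hE.inter measurableSet_closedBall).inter measurableSet_Iic)
      (g := fun _ => 1) fun τ hτ => ?_) ?_
    · refine ENNReal.ofReal_le_one.2 (Real.exp_le_one_iff.2 (neg_nonpos.2 ?_))
      exact mul_nonneg hc0.le (sub_nonneg.2 hτ.2)
    · rw [setLIntegral_const, one_mul]
      exact (measure_mono inter_subset_left).trans hvol
  have hfar : ∫⁻ τ in Iic (t - R / c), ENNReal.ofReal (Real.exp (-(c * (t - τ)))) ≤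
      ENNReal.ofReal (δ / 2) * ENNReal.ofReal (1 / c) := by
    calc ∫⁻ τ in Iic (t - R / c), ENNReal.ofReal (Real.exp (-(c * (t - τ))))
        ≤ ∫⁻ τ in Iic (t - R / c), ENNReal.ofReal (Real.exp (-(R / 2))) *
            ENNReal.ofReal (Real.exp (-(c / 2 * (t - τ)))) := by
          refine setLIntegral_mono' measurableSet_Iic fun τ hτ => ?_
          rw [← ENNReal.ofReal_mul (by positivity), ← Real.exp_add]
          refine ENNReal.ofReal_le_ofReal (Real.exp_le_exp.2 ?_)
          have h6 : R / c ≤ t - τ := by linarith [show τ ≤ t - R / c from hτ]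
          rw [div_le_iff₀ hc0] at h6
          nlinarith
      _ ≤ ENNReal.ofReal (Real.exp (-(R / 2))) * ENNReal.ofReal (1 / (c / 2)) := by
          rw [lintegral_const_mul' _ _ ENNReal.ofReal_ne_top, ← lintegral_exp_decay_le (half_pos hc0) t]
          gcongr
          linarith
      _ ≤ _ := by
          rw [← ENNReal.ofReal_mul (by positivity), ← ENNReal.ofReal_mul (by positivity)]
          refine ENNReal.ofReal_le_ofReal ?_
          calc Real.exp (-(R / 2)) * (1 / (c / 2)) = 2 * Real.exp (-(R / 2)) * (1 / c) := by
                field_simp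
            _ ≤ δ / 2 * (1 / c) := by gcongr
  calc ∫⁻ τ in Iic t ∩ E, ENNReal.ofReal (Real.exp (-(c * (t - τ))))
      ≤ ∫⁻ τ in (E ∩ Metric.closedBall t (R / c) ∩ Iic t) ∪ Iic (t - R / c),
          ENNReal.ofReal (Real.exp (-(c * (t - τ)))) := by
        refine lintegral_mono_set fun τ hτ => ?_
        rcases hsub hτ with h3 | h3
        · exact Or.inl ⟨h3, hτ.1⟩
        · exact Or.inr h3
    _ ≤ _ := lintegral_union_le _ _ _
    _ ≤ ENNReal.ofReal (δ / 2) * ENNReal.ofReal (1 / c) +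
        ENNReal.ofReal (δ / 2) * ENNReal.ofReal (1 / c) := add_le_add hlow hfar
    _ = _ := by
        rw [← add_mul, ← ENNReal.ofReal_add (by positivity) (by positivity), add_halves]

theorem ae_density_compl {E : Set ℝ} (hE : MeasurableSet E) :
    ∀ᵐ t : ℝ, t ∈ E → Tendsto (fun r => volume (Eᶜ ∩ Metric.closedBall t r) /
      volume (Metric.closedBall t r)) (𝓝[>] 0) (𝓝 0) := by
  filter_upwards [Besicovitch.ae_tendsto_measure_inter_div_of_measurableSet volume hE.compl]
    with t ht htE
  rwa [indicator_of_notMem (not_not_intro htE)] at ht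

end Density

/-! ### The Duhamel integral has separable values -/

section DuhamelSeparable

variable (P : DyadicPartition) {p q : ℝ≥0∞} {s ν α : ℝ}

/-- For `q < ∞` the tails of a convergent `ℓ^q` norm vanish, so low-frequency truncations converge
at every time. -/
theorem separablyValued_duhamelHat_of_ne_top (hp : 1 ≤ p) (hq : 1 ≤ q) (hq' : q ≠ ∞) (hν : 0 < ν)
    (hα : 0 ≤ α) (Ω : ℝ) {G : ℝ → E3 → C3} (hG : Measurable (Function.uncurry G))
    (hfin : tnorm P (s - 2 * α) p q G < ∞) :
    SeparablyValued P s p q (duhamelHat ν α Ω G) := by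
  have hm := measurable_section (measurable_duhamelHat ν α Ω hG)
  refine SeparablyValued.of_approx hp hq (ι := ℕ) hm (fun n t => measurable_lowFreq n (hm t))
    (fun n => separablyValued_lowFreq_duhamelHat P hp hq hν hα Ω hG hfin n)
    (Eventually.of_forall fun t ε hε => ?_)
  have hU : fnNorm P s p q (duhamelHat ν α Ω G t) < ∞ :=
    (fnNorm_duhamelHat_le P hp hν hα Ω hG t).trans_lt (ENNReal.mul_lt_top
      duhamelConst_ne_top.lt_top hfin)
  have h1 := tendsto_wsn_tail hq hq' hU (fun n : ℕ => {j : ℤ | (n : ℤ) - 1 ≤ j}) fun j => by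
    filter_upwards [eventually_gt_atTop (j + 1).toNat] with n hn
    show ¬ ((n : ℤ) - 1 ≤ j)
    lia
  obtain ⟨n, hn⟩ := (h1.eventually_lt_const hε).exists
  exact ⟨n, (wsn_mono fun j => blk_sub_lowFreq_le P p n _ j).trans_lt hn⟩

theorem tendsto_decayRate (hν : 0 < ν) (hα : 0 < α) : Tendsto (decayRate ν α) atTop atTop := by
  have h1 : Tendsto (fun x : ℝ => (2 : ℝ) ^ x) atTop atTop :=
    tendsto_rpow_atTop_of_base_gt_one 2 (by norm_num)
  have h2 : Tendsto (fun j : ℤ => (j : ℝ) * (2 * α)) atTop atTop :=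
    tendsto_intCast_atTop_atTop.atTop_mul_const (by positivity)
  have h3 := (h1.comp h2).const_mul_atTop (r := ν * (3 / 4) ^ (2 * α)) (by positivity)
  exact h3.congr fun j => (decayRate_eq ν α j).symm

/-- The source is split over `E`, where it is at most `ε`, and its complement, where only the bound
`M` holds but the kernel has relative mass at most `δ`. The powers of `2^j` cancel. -/
theorem blk_duhamelHat_le_of_small (hp : 1 ≤ p) (hν : 0 < ν) (hα : 0 ≤ α) (Ω : ℝ)
    {H : ℝ → E3 → C3} (hH : Measurable (Function.uncurry H)) {M ε : ℝ≥0∞}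
    (hM : ∀ᵐ τ ∂timeMeasure, fnNorm P (s - 2 * α) p ∞ (H τ) ≤ M) {E : Set ℝ}
    (hE : MeasurableSet E) (hEε : ∀ τ ∈ E, fnNorm P (s - 2 * α) p ∞ (H τ) ≤ ε) {t δ : ℝ} {j : ℤ}
    (hδ : ∫⁻ τ in Iic t ∩ Eᶜ, ENNReal.ofReal (Real.exp (-(decayRate ν α j * (t - τ)))) ≤
      ENNReal.ofReal δ * ENNReal.ofReal (1 / decayRate ν α j)) :
    2 ^ ((j : ℝ) * s) * blk P p j (duhamelHat ν α Ω H t) ≤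
      duhamelConst ν α * (ε + M * ENNReal.ofReal δ) := by
  set w : ℝ≥0∞ := 2 ^ (-((j : ℝ) * (s - 2 * α))) with hw
  set e : ℝ → ℝ≥0∞ := fun τ => ENNReal.ofReal (Real.exp (-(decayRate ν α j * (t - τ)))) with he
  have hem : Measurable e := by rw [he]; fun_prop
  have hA : ∀ᵐ τ ∂timeMeasure, blk P p j (H τ) ≤ w * (ε + Eᶜ.indicator (fun _ => M) τ) := by
    filter_upwards [hM] with τ hτ
    refine (le_wsn' (s := s - 2 * α) le_top (fun j => blk P p j (H τ)) j).trans ?_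
    gcongr
    by_cases hτE : τ ∈ E
    · exact (hEε τ hτE).trans le_self_add
    · rw [indicator_of_mem (show τ ∈ Eᶜ from hτE)]
      exact hτ.trans le_add_self
  have hd := decayRate_pos hν α j
  have h1 : ∫⁻ τ in Ioo 0 t, e τ * (w * (ε + Eᶜ.indicator (fun _ => M) τ)) ≤
      w * (ENNReal.ofReal (1 / decayRate ν α j) * (ε + M * ENNReal.ofReal δ)) := by
    calc ∫⁻ τ in Ioo 0 t, e τ * (w * (ε + Eᶜ.indicator (fun _ => M) τ))
        ≤ ∫⁻ τ in Iic t, e τ * (w * (ε + Eᶜ.indicator (fun _ => M) τ)) :=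
          lintegral_mono_set fun τ hτ => hτ.2.le
      _ = ∫⁻ τ in Iic t, w * (ε * e τ + Eᶜ.indicator (fun τ => M * e τ) τ) := by
          refine lintegral_congr fun τ => ?_
          by_cases hτ : τ ∈ Eᶜ
          · simp only [indicator_of_mem hτ]; ring
          · simp only [indicator_of_notMem hτ]; ring
      _ = w * (ε * ENNReal.ofReal (1 / decayRate ν α j) + M * ∫⁻ τ in Iic t ∩ Eᶜ, e τ) := by
          rw [lintegral_const_mul' _ _ (two_rpow_ne_top _),
            lintegral_add_left (hem.const_mul _), lintegral_const_mul _ hem,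
            lintegral_exp_decay_le hd, lintegral_indicator hE.compl,
            Measure.restrict_restrict hE.compl, inter_comm, lintegral_const_mul _ hem]
      _ ≤ w * (ε * ENNReal.ofReal (1 / decayRate ν α j) +
          M * (ENNReal.ofReal δ * ENNReal.ofReal (1 / decayRate ν α j))) := by gcongr
      _ = _ := by ring
  calc 2 ^ ((j : ℝ) * s) * blk P p j (duhamelHat ν α Ω H t)
      ≤ 2 ^ ((j : ℝ) * s) * (324 * (w * (ENNReal.ofReal (1 / decayRate ν α j) *
          (ε + M * ENNReal.ofReal δ)))) := by
        gcongr
        exact (blk_duhamelHat_le_lintegral P hp hν.le hα Ω hH j hA t).trans (by gcongr)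
    _ = 2 ^ ((j : ℝ) * s) * w * (324 * ENNReal.ofReal (1 / decayRate ν α j)) *
          (ε + M * ENNReal.ofReal δ) := by ring
    _ = duhamelConst ν α * (2 ^ ((j : ℝ) * s) * (w * 2 ^ (-((j : ℝ) * (2 * α))))) *
          (ε + M * ENNReal.ofReal δ) := by rw [ofReal_inv_decayRate hν]; ring
    _ = _ := by
        rw [hw, ← two_rpow_add, ← two_rpow_add]
        have : (j : ℝ) * s + (-((j : ℝ) * (s - 2 * α)) + -((j : ℝ) * (2 * α))) = 0 := by ring
        rw [this, ENNReal.rpow_zero, mul_one]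

/-- In `ℓ^∞` high-frequency tails need not be small. At almost every `t` pick `D i` close to `G t`;
then `H = G - D i` is small on a set having `t` as a density point. As `j → ∞` the kernel
concentrates at `t`, so the high blocks of the Duhamel integral of `H` are small. What remains, a
truncation and a Duhamel integral with constant source, is already known to be separably valued. -/
theorem separablyValued_duhamelHat_top (hp : 1 ≤ p) (hν : 0 < ν)
    (hα : 0 < α) (Ω : ℝ) {G : ℝ → E3 → C3} (hG : Measurable (Function.uncurry G))
    (hfin : tnorm P (s - 2 * α) p ∞ G < ∞) (hsep : SeparablyValued P (s - 2 * α) p ∞ G) :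
    SeparablyValued P s p ∞ (duhamelHat ν α Ω G) := by
  obtain ⟨D, hD, hap⟩ := hsep
  have hm := measurable_section (measurable_duhamelHat ν α Ω hG)
  have hDu : ∀ i, Measurable (Function.uncurry fun _ : ℝ => D i) :=
    fun i => (hD i).1.comp measurable_snd
  set H : ℕ → ℝ → E3 → C3 := fun i τ ξ => G τ ξ - D i ξ with hH
  have hHm : ∀ i, Measurable (Function.uncurry (H i)) := fun i => hG.sub (hDu i)
  have hDfin : ∀ i, tnorm P (s - 2 * α) p ∞ (fun _ : ℝ => D i) < ∞ :=
    fun i => (tnorm_const_le P (D i)).trans_lt (hD i).2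
  have hHfin : ∀ i, tnorm P (s - 2 * α) p ∞ (H i) < ∞ := fun i =>
    (tnorm_sub_le P hp le_top (Eventually.of_forall fun t =>
      (measurable_section hG t).aestronglyMeasurable) (Eventually.of_forall fun t =>
      (hD i).1.aestronglyMeasurable)).trans_lt (ENNReal.add_lt_top.2 ⟨hfin, hDfin i⟩)
  have hmD : ∀ i, ∀ t, Measurable (duhamelHat ν α Ω (fun _ => D i) t) :=
    fun i => measurable_section (measurable_duhamelHat ν α Ω (hDu i))
  have hmH : ∀ i, ∀ t, Measurable (duhamelHat ν α Ω (H i) t) :=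
    fun i => measurable_section (measurable_duhamelHat ν α Ω (hHm i))
  set E : ℕ → ℕ → Set ℝ := fun i k => {τ | fnNorm P (s - 2 * α) p ∞ (H i τ) < (2⁻¹ : ℝ≥0∞) ^ k}
    with hE
  have hEm : ∀ i k, MeasurableSet (E i k) := fun i k =>
    measurableSet_lt (measurable_fnNorm P (hHm i)) measurable_const
  have hdens : ∀ᵐ t ∂timeMeasure, ∀ i k, t ∈ E i k →
      Tendsto (fun r => volume ((E i k)ᶜ ∩ Metric.closedBall t r) /
        volume (Metric.closedBall t r)) (𝓝[>] 0) (𝓝 0) :=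
    ae_restrict_of_ae (ae_all_iff.2 fun i => ae_all_iff.2 fun k => ae_density_compl (hEm i k))
  refine SeparablyValued.of_approx hp le_top (ι := ℕ × ℕ)
    (V := fun x t ξ => lowFreq x.2 (duhamelHat ν α Ω (H x.1) t) ξ +
      duhamelHat ν α Ω (fun _ => D x.1) t ξ) hm
    (fun x t => (measurable_lowFreq _ (hmH _ t)).add (hmD _ t))
    (fun x => SeparablyValued.add hp le_top (fun t => measurable_lowFreq _ (hmH _ t))
      (hmD _) (separablyValued_lowFreq_duhamelHat P hp le_top hν hα.le Ω (hHm _) (hHfin _) _)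
      (separablyValued_duhamelHat_const P hp hν hα.le Ω (hD _).1 (hD _).2)) ?_
  filter_upwards [hdens, hap] with t ht1 ht2 ε hε
  have hε2 : ε / 2 ≠ 0 := (ENNReal.half_pos hε.ne').ne'
  obtain ⟨η, hη0, hη⟩ := ENNReal.exists_nnreal_pos_mul_lt
    (duhamelConst_ne_top (ν := ν) (α := α)) hε2
  -- Order of choices: the level `k`, then `i` with `t ∈ E i k`, then `δ` against the norm of `H i`,
  -- and last the frequency `J` beyond which the kernel has relative mass at most `δ` off `E i k`.
  obtain ⟨k, hk⟩ := exists_half_pow_lt (show (0 : ℝ≥0∞) < η by exact_mod_cast hη0)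
  obtain ⟨i, hi⟩ := ht2 ((2⁻¹ : ℝ≥0∞) ^ k) (ENNReal.pow_pos (by norm_num) k)
  obtain ⟨δ, hδ0, hδ⟩ := ENNReal.exists_nnreal_pos_mul_lt
    (ENNReal.mul_ne_top (duhamelConst_ne_top (ν := ν) (α := α)) (hHfin i).ne) hε2
  have hev := (tendsto_decayRate hν hα).eventually
    (eventually_kernel_mass_le (hEm i k).compl (ht1 i k hi) (NNReal.coe_pos.2 hδ0))
  obtain ⟨J, hJ⟩ := eventually_atTop.1 hev
  refine ⟨(i, (J + 1).toNat), ?_⟩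
  set n := (J + 1).toNat with hn
  have hsplit : fnNorm P s p ∞ (fun ξ => duhamelHat ν α Ω G t ξ -
      (lowFreq n (duhamelHat ν α Ω (H i) t) ξ + duhamelHat ν α Ω (fun _ => D i) t ξ)) =
      fnNorm P s p ∞ (fun ξ => duhamelHat ν α Ω (H i) t ξ -
        lowFreq n (duhamelHat ν α Ω (H i) t) ξ) := by
    refine fnNorm_congr P s p ∞ ?_
    filter_upwards [ae_lintegral_lt_top P hp hG (lt_top_of_wsn le_top hfin) t,
      ae_lintegral_lt_top P hp (hDu i) (lt_top_of_wsn le_top (hDfin i)) t] with ξ h1 h2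
    rw [hH, duhamelHat_sub hν.le α Ω hG (hDu i) h1 h2]
    abel
  rw [hsplit]
  refine lt_of_le_of_lt (wsn_top_le (c := duhamelConst ν α * ((2⁻¹ : ℝ≥0∞) ^ k +
    tnorm P (s - 2 * α) p ∞ (H i) * ENNReal.ofReal δ)) fun j => ?_) ?_
  · refine (mul_le_mul_right (blk_sub_lowFreq_le P p n _ j) _).trans ?_
    by_cases hj : (n : ℤ) - 1 ≤ j
    · rw [indicator_of_mem (by exact hj)]
      exact blk_duhamelHat_le_of_small P hp hν hα.le Ω (hHm i) (ae_fnNorm_le_tnorm P (H i))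
        (hEm i k) (fun τ hτ => le_of_lt hτ) (hJ j (by lia))
    · rw [indicator_of_notMem (by exact hj), mul_zero]
      exact zero_le
  · rw [mul_add]
    refine (ENNReal.add_lt_add ?_ ?_).trans_eq (ENNReal.add_halves ε)
    · refine lt_of_le_of_lt ?_ hη
      rw [mul_comm]; gcongr
    · refine lt_of_le_of_lt (le_of_eq ?_) hδ
      rw [ENNReal.ofReal_coe_nnreal]; ring

theorem separablyValued_duhamelHat (hp : 1 ≤ p) (hq : 1 ≤ q) (hν : 0 < ν)
    (hα : 0 < α) (Ω : ℝ) {G : ℝ → E3 → C3} (hG : Measurable (Function.uncurry G))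
    (hfin : tnorm P (s - 2 * α) p q G < ∞) (hsep : SeparablyValued P (s - 2 * α) p q G) :
    SeparablyValued P s p q (duhamelHat ν α Ω G) := by
  by_cases hq' : q = ∞
  · subst hq'
    exact separablyValued_duhamelHat_top P hp hν hα Ω hG hfin hsep
  · exact separablyValued_duhamelHat_of_ne_top P hp hq hq' hν hα.le Ω hG hfin

end DuhamelSeparable

/-! ### Frequency-side representatives and their stability -/

section Paths

variable {P : DyadicPartition} {p q : ℝ≥0∞} {s ν α : ℝ}

/-- Jointly measurable frequency-side representatives of the elements of `𝓛^∞(I; FḂ^s_{p,q})`. -/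
structure IsPath (P : DyadicPartition) (s : ℝ) (p q : ℝ≥0∞) (U : ℝ → E3 → C3) : Prop where
  measurable : Measurable (Function.uncurry U)
  finite : tnorm P s p q U < ∞
  separable : SeparablyValued P s p q U

theorem IsPath.sections {U : ℝ → E3 → C3} (h : IsPath P s p q U) (t : ℝ) : Measurable (U t) :=
  measurable_section h.measurable t

theorem IsPath.aesections {U : ℝ → E3 → C3} (h : IsPath P s p q U) :
    ∀ᵐ t ∂timeMeasure, AEStronglyMeasurable (U t) volume :=
  Eventually.of_forall fun t => (h.sections t).aestronglyMeasurable

theorem IsPath.timeBlk_lt_top (hq : 1 ≤ q) {U : ℝ → E3 → C3} (h : IsPath P s p q U) (j : ℤ) :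
    timeBlk P p U j < ∞ := lt_top_of_wsn hq h.finite j

theorem IsPath.add (hp : 1 ≤ p) (hq : 1 ≤ q) {U V : ℝ → E3 → C3} (hU : IsPath P s p q U)
    (hV : IsPath P s p q V) : IsPath P s p q (fun t ξ => U t ξ + V t ξ) where
  measurable := hU.measurable.add hV.measurable
  finite := (tnorm_add_le P hp hq hU.aesections hV.aesections).trans_lt
    (ENNReal.add_lt_top.2 ⟨hU.finite, hV.finite⟩)
  separable := hU.separable.add hp hq hU.sections hV.sections hV.separable

theorem IsPath.sub (hp : 1 ≤ p) (hq : 1 ≤ q) {U V : ℝ → E3 → C3} (hU : IsPath P s p q U)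
    (hV : IsPath P s p q V) : IsPath P s p q (fun t ξ => U t ξ - V t ξ) where
  measurable := hU.measurable.sub hV.measurable
  finite := (tnorm_sub_le P hp hq hU.aesections hV.aesections).trans_lt
    (ENNReal.add_lt_top.2 ⟨hU.finite, hV.finite⟩)
  separable := hU.separable.sub hp hq hU.sections hV.sections hV.separable

theorem IsPath.neg {U : ℝ → E3 → C3} (hU : IsPath P s p q U) :
    IsPath P s p q (fun t ξ => -U t ξ) where
  measurable := hU.measurable.neg
  finite := by rw [tnorm_neg]; exact hU.finite
  separable := hU.separable.neg

theorem isPath_semigroup (hν : 0 < ν) (α Ω : ℝ) {U₀ : E3 → C3} (hU : Measurable U₀)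
    (hfin : fnNorm P s p q U₀ < ∞) :
    IsPath P s p q (fun t ξ => act (semigroupSymbol ν α Ω t ξ) (U₀ ξ)) where
  measurable := measurable_semigroup ν α Ω hU
  finite := (tnorm_semigroup_le P hν.le α Ω hU).trans_lt (ENNReal.mul_lt_top (by norm_num) hfin)
  separable := separablyValued_semigroup P hν α Ω hU hfin

theorem IsPath.duhamelHat (hp : 1 ≤ p) (hq : 1 ≤ q) (hν : 0 < ν) (hα : 0 < α) (Ω : ℝ)
    {G : ℝ → E3 → C3} (hG : IsPath P (s - 2 * α) p q G) :
    IsPath P s p q (duhamelHat ν α Ω G) where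
  measurable := measurable_duhamelHat ν α Ω hG.measurable
  finite := (tnorm_duhamelHat_le P hp hν hα.le Ω hG.measurable).trans_lt
    (ENNReal.mul_lt_top duhamelConst_ne_top.lt_top hG.finite)
  separable := separablyValued_duhamelHat P hp hq hν hα Ω hG.measurable hG.finite hG.separable

theorem tnorm_duhamelHat_sub_le (hp : 1 ≤ p) (hq : 1 ≤ q) (hν : 0 < ν) (hα : 0 < α) (Ω : ℝ)
    {G H : ℝ → E3 → C3} (hG : IsPath P (s - 2 * α) p q G) (hH : IsPath P (s - 2 * α) p q H) :
    tnorm P s p q (fun t ξ => FNSC.duhamelHat ν α Ω G t ξ - FNSC.duhamelHat ν α Ω H t ξ) ≤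
      duhamelConst ν α * tnorm P (s - 2 * α) p q (fun t ξ => G t ξ - H t ξ) := by
  refine le_trans (le_of_eq (tnorm_congr P (Eventually.of_forall fun t => ?_)))
    (tnorm_duhamelHat_le P hp hν hα.le Ω (hG.sub hp hq hH).measurable)
  filter_upwards [ae_lintegral_lt_top P hp hG.measurable (hG.timeBlk_lt_top hq) t,
    ae_lintegral_lt_top P hp hH.measurable (hH.timeBlk_lt_top hq) t] with ξ h1 h2
  exact (duhamelHat_sub hν.le α Ω hG.measurable hH.measurable h1 h2).symm

end Paths

/-! ### The bilinear operator -/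

section Bilinear

variable {P : DyadicPartition} {p q : ℝ≥0∞} {ν α : ℝ}

theorem velReg_sub (α : ℝ) (p : ℝ≥0∞) : velReg α p - 2 * α = forceReg α p := by
  unfold velReg forceReg; ring

/-- The mapping properties of the bilinear operator, with the bound `K`. -/
structure BilinearBound (P : DyadicPartition) (p q : ℝ≥0∞) (ν α : ℝ) (K : ℝ≥0∞) : Prop where
  isPath : ∀ (Ω : ℝ) {V W : ℝ → E3 → C3}, IsPath P (velReg α p) p q V →
    IsPath P (velReg α p) p q W → IsPath P (velReg α p) p q (bilinearHat ν α Ω V W)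
  converges : ∀ (Ω : ℝ) {V W : ℝ → E3 → C3}, IsPath P (velReg α p) p q V →
    IsPath P (velReg α p) p q W → BilinearConverges ν α Ω V W
  bound : ∀ (Ω : ℝ) {V W : ℝ → E3 → C3}, IsPath P (velReg α p) p q V →
    IsPath P (velReg α p) p q W → tnorm P (velReg α p) p q (bilinearHat ν α Ω V W) ≤
      K * tnorm P (velReg α p) p q V * tnorm P (velReg α p) p q W
  bound_sub : ∀ (Ω : ℝ) {V W V' W' : ℝ → E3 → C3}, IsPath P (velReg α p) p q V →
    IsPath P (velReg α p) p q W → IsPath P (velReg α p) p q V' →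
    IsPath P (velReg α p) p q W' →
    tnorm P (velReg α p) p q (fun t ξ => bilinearHat ν α Ω V W t ξ - bilinearHat ν α Ω V' W' t ξ) ≤
      K * tnorm P (velReg α p) p q (fun t ξ => V t ξ - V' t ξ) * tnorm P (velReg α p) p q W +
      K * tnorm P (velReg α p) p q V' * tnorm P (velReg α p) p q (fun t ξ => W t ξ - W' t ξ)

/-- The product estimate is used with `β = 2α - 1`, positive for `α > 1/2`, and `s - β = 5 - 4α -
3/p`, positive by the upper bound on `α`. It lands at regularity `s - 2α`, which the Duhamel
integral raises back to `s`. -/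
theorem exists_bilinearBound (P : DyadicPartition) (hp : 1 ≤ p) (hq : 1 ≤ q) (hν : 0 < ν)
    (hα : 1 / 2 < α) (hα' : α < (5 - threeOver p) / 4) :
    ∃ K : ℝ≥0∞, K ≠ ∞ ∧ BilinearBound P p q ν α K := by
  have hβ : 2 * α - 1 = 3 - threeOver p - velReg α p := by unfold velReg; ring
  have hβ0 : 0 < 2 * α - 1 := by linarith
  have hγ : 0 < velReg α p - (2 * α - 1) := by unfold velReg; linarith
  have hr : velReg α p - (2 * α - 1) - 1 = velReg α p - 2 * α := by ring
  have hα0 : 0 < α := by linarith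
  obtain ⟨K, hK, -, hK2⟩ := exists_divTensorHat_norm_bound P hp hq hβ hβ0 hγ
  rw [hr] at hK2
  have hdiv : ∀ {V W : ℝ → E3 → C3}, IsPath P (velReg α p) p q V →
      IsPath P (velReg α p) p q W →
      IsPath P (velReg α p - 2 * α) p q (fun τ => divTensorHat (V τ) (W τ)) := by
    intro V W hV hW
    refine ⟨measurable_divTensorHat hV.measurable hW.measurable,
      (hK2 V W hV.sections hW.sections).trans_lt (ENNReal.mul_lt_top
      (ENNReal.mul_lt_top hK.lt_top hV.finite) hW.finite), ?_⟩
    rw [← hr]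
    exact SeparablyValued.divTensorHat P hp hq hβ hβ0 hγ hV.sections hW.sections hV.finite
      hW.finite hV.separable hW.separable
  have hconv : ∀ {V W : ℝ → E3 → C3}, IsPath P (velReg α p) p q V →
      IsPath P (velReg α p) p q W → ∀ᵐ τ ∂timeMeasure, ∀ᵐ ξ, absConv (V τ) (W τ) ξ < ∞ := by
    intro V W hV hW
    filter_upwards [ae_fnNorm_le_tnorm P (p := p) (q := q) (s := velReg α p) V,
      ae_fnNorm_le_tnorm P (p := p) (q := q) (s := velReg α p) W] with τ h1 h2
    exact ae_absConv_lt_top P hp hq (hβ ▸ hβ0) (hβ ▸ hγ) (hV.sections τ) (hW.sections τ)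
      (h1.trans_lt hV.finite) (h2.trans_lt hW.finite)
  refine ⟨duhamelConst ν α * K, ENNReal.mul_ne_top duhamelConst_ne_top hK,
    fun Ω V W hV hW => ((hdiv hV hW).duhamelHat hp hq hν hα0 Ω).neg, fun Ω V W hV hW => ⟨?_,
      duhamelConverges P hp hν.le α Ω (hdiv hV hW).measurable ((hdiv hV hW).timeBlk_lt_top hq)⟩,
    fun Ω V W hV hW => ?_, fun Ω V W V' W' hV hW hV' hW' => ?_⟩
  · filter_upwards [hconv hV hW] with τ hτ
    filter_upwards [hτ] with ξ hξ m k
    exact integrable_conv (hV.sections τ) (hW.sections τ) hξ m k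
  · refine (tnorm_neg P _).le.trans ((tnorm_duhamelHat_le P hp hν hα0.le Ω
      (hdiv hV hW).measurable).trans ?_)
    rw [mul_assoc, mul_assoc, ← mul_assoc K]
    gcongr
    exact hK2 V W hV.sections hW.sections
  · have h1 : tnorm P (velReg α p) p q
        (fun t ξ => bilinearHat ν α Ω V W t ξ - bilinearHat ν α Ω V' W' t ξ) =
        tnorm P (velReg α p) p q (fun t ξ =>
          duhamelHat ν α Ω (fun τ => divTensorHat (V τ) (W τ)) t ξ -
          duhamelHat ν α Ω (fun τ => divTensorHat (V' τ) (W' τ)) t ξ) := by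
      rw [← tnorm_neg]
      congr 1
      ext1 t; ext1 ξ
      simp only [bilinearHat]
      abel
    have h2 : tnorm P (velReg α p - 2 * α) p q
        (fun τ ξ => divTensorHat (V τ) (W τ) ξ - divTensorHat (V' τ) (W' τ) ξ) ≤
        tnorm P (velReg α p - 2 * α) p q (fun τ => divTensorHat (fun η => V τ η - V' τ η) (W τ)) +
        tnorm P (velReg α p - 2 * α) p q
          (fun τ => divTensorHat (V' τ) (fun η => W τ η - W' τ η)) := by
      refine le_trans (le_of_eq (tnorm_congr P ?_)) (tnorm_add_le P hp hq
        (hdiv (hV.sub hp hq hV') hW).aesections (hdiv hV' (hW.sub hp hq hW')).aesections)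
      filter_upwards [hconv hV hW, hconv hV' hW', hconv hV' hW] with τ h3 h4 h5
      filter_upwards [h3, h4, h5] with ξ h6 h7 h8
      exact divTensorHat_sub (hV.sections τ) (hV'.sections τ) (hW.sections τ) (hW'.sections τ)
        h6 h7 h8
    rw [h1]
    refine (tnorm_duhamelHat_sub_le hp hq hν hα0 Ω (hdiv hV hW) (hdiv hV' hW')).trans ?_
    calc _ ≤ duhamelConst ν α *
          (K * tnorm P (velReg α p) p q (fun t ξ => V t ξ - V' t ξ) * tnorm P (velReg α p) p q W +
            K * tnorm P (velReg α p) p q V' *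
              tnorm P (velReg α p) p q (fun t ξ => W t ξ - W' t ξ)) := by
          gcongr
          exact h2.trans (add_le_add
            (hK2 _ _ (hV.sub hp hq hV').sections hW.sections)
            (hK2 _ _ hV'.sections (hW.sub hp hq hW').sections))
      _ = _ := by ring

theorem BilinearBound.mono {K K' : ℝ≥0∞} (h : BilinearBound P p q ν α K) (hK : K ≤ K') :
    BilinearBound P p q ν α K' where
  isPath := h.isPath
  converges := h.converges
  bound := fun Ω _ _ hV hW => (h.bound Ω hV hW).trans (by gcongr)
  bound_sub := fun Ω _ _ _ _ hV hW hV' hW' => (h.bound_sub Ω hV hW hV' hW').trans (by gcongr)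

end Bilinear

/-! ### Independence of the chosen Fourier versions -/

section Versions

variable {P : DyadicPartition} {p q : ℝ≥0∞} {s ν α Ω : ℝ}

theorem MemTime.exists_isPath (hp : 1 ≤ p) (hq : 1 ≤ q) {u : ℝ → 𝓢'(E3, C3)}
    (hu : MemTime P s p q u) : ∃ U, IsPath P s p q U ∧
      (∀ᵐ t ∂timeMeasure, HasFourierDensity (u t) (U t)) ∧
      timeNorm P s p q u = tnorm P s p q U := by
  obtain ⟨U, hU, hd, hs⟩ := exists_measurable_version P hp hq hu.1
  have h := timeNorm_eq_tnorm P (p := p) (q := q) (s := s) hd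
  exact ⟨U, ⟨hU, h ▸ hu.2, hs⟩, hd, h⟩

theorem IsFourierVersion.ae_eq {u : ℝ → 𝓢'(E3, C3)} {U V : ℝ → E3 → C3}
    (hU : IsFourierVersion u U) (hV : ∀ᵐ t ∂timeMeasure, HasFourierDensity (u t) (V t)) :
    ∀ᵐ t ∂timeMeasure, U t =ᵐ[volume] V t := by
  filter_upwards [hU.2, hV] with t h1 h2
  exact h1.unique h2

theorem duhamelHat_congr {G H : ℝ → E3 → C3} {ξ : E3}
    (h : ∀ᵐ τ ∂timeMeasure, G τ ξ = H τ ξ) (t : ℝ) :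
    duhamelHat ν α Ω G t ξ = duhamelHat ν α Ω H t ξ := by
  refine integral_congr_ae ?_
  have h1 := ae_restrict_of_ae_restrict_of_subset (s := Ioo 0 t) Ioo_subset_Ioi_self h
  filter_upwards [h1] with τ hτ
  simp only [duhamelIntegrand, hτ]

/-- The Duhamel integral runs over `τ` at fixed `ξ`, so the quantifiers "almost every" must be
exchanged. Fubini needs a measurable set of agreement, hence the detour through a measurable
modification of `G`. -/
theorem ae_ae_eq_of_versions {G H : ℝ → E3 → C3}
    (hG : AEStronglyMeasurable (Function.uncurry G) (timeMeasure.prod (volume : Measure E3)))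
    (hH : Measurable (Function.uncurry H)) (h : ∀ᵐ t ∂timeMeasure, G t =ᵐ[volume] H t) :
    ∀ᵐ ξ : E3, ∀ᵐ τ ∂timeMeasure, G τ ξ = H τ ξ := by
  have : SFinite timeMeasure := by unfold timeMeasure; infer_instance
  have hm := hG.stronglyMeasurable_mk.measurable
  set M := hG.mk (Function.uncurry G) with hM
  have h1 : ∀ᵐ z ∂timeMeasure.prod (volume : Measure E3), G z.1 z.2 = M z := hG.ae_eq_mk
  have h2 : ∀ᵐ ξ : E3, ∀ᵐ τ ∂timeMeasure, G τ ξ = M (τ, ξ) := by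
    have h3 : ∀ᵐ z ∂(volume : Measure E3).prod timeMeasure, G z.2 z.1 = M (z.2, z.1) :=
      Measure.measurePreserving_swap.quasiMeasurePreserving.ae h1
    exact Measure.ae_ae_of_ae_prod h3
  have h4 : ∀ᵐ τ ∂timeMeasure, ∀ᵐ ξ : E3, M (τ, ξ) = H τ ξ := by
    filter_upwards [h, Measure.ae_ae_of_ae_prod h1] with τ h5 h6
    filter_upwards [h5, h6] with ξ h7 h8
    rw [← h8, h7]
  have h5 : ∀ᵐ ξ : E3, ∀ᵐ τ ∂timeMeasure, M (τ, ξ) = H τ ξ :=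
    (Measure.ae_ae_comm (p := fun τ ξ => M (τ, ξ) = H τ ξ)
      (measurableSet_eq_fun hm hH)).1 h4
  filter_upwards [h2, h5] with ξ h6 h7
  filter_upwards [h6, h7] with τ h8 h9
  rw [h8, h9]

/-- No exchange of null sets is needed: convolutions depend only on almost everywhere classes and
therefore agree at every `ξ`. -/
theorem bilinearHat_congr {V V' W W' : ℝ → E3 → C3}
    (hV : ∀ᵐ t ∂timeMeasure, V t =ᵐ[volume] V' t) (hW : ∀ᵐ t ∂timeMeasure, W t =ᵐ[volume] W' t)
    (t : ℝ) (ξ : E3) : bilinearHat ν α Ω V W t ξ = bilinearHat ν α Ω V' W' t ξ := by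
  unfold bilinearHat
  congr 1
  refine duhamelHat_congr ?_ t
  filter_upwards [hV, hW] with τ h1 h2
  rw [divTensorHat_congr h1 h2]

/-- The integral equation for frequency-side functions. -/
def MildEquation (ν α Ω : ℝ) (U₀ : E3 → C3) (G U : ℝ → E3 → C3) : Prop :=
  ∀ᵐ t ∂timeMeasure, U t =ᵐ[volume] fun ξ => act (semigroupSymbol ν α Ω t ξ) (U₀ ξ) +
    bilinearHat ν α Ω U U t ξ + duhamelHat ν α Ω G t ξ

/-- `IsMildSolution` provides some versions of the data and the solution; the equation transfers to
the measurable ones for which estimates are available. -/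
theorem IsMildSolution.mildEquation {u₀ : 𝓢'(E3, C3)} {F u : ℝ → 𝓢'(E3, C3)}
    (h : IsMildSolution ν α Ω u₀ F u) {U₀ : E3 → C3} {G U : ℝ → E3 → C3}
    (hU₀ : HasFourierDensity u₀ U₀) (hG : Measurable (Function.uncurry G))
    (hFG : ∀ᵐ t ∂timeMeasure, HasFourierDensity (F t) (G t))
    (hU : ∀ᵐ t ∂timeMeasure, HasFourierDensity (u t) (U t)) : MildEquation ν α Ω U₀ G U := by
  obtain ⟨U₀', G', U', hU₀', hG', hU', -, -, heq⟩ := h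
  have h1 := hU₀'.unique hU₀
  have h2 := hU'.ae_eq hU
  have h3 := ae_ae_eq_of_versions hG'.1 hG (hG'.ae_eq hFG)
  filter_upwards [heq, h2] with t h4 h5
  filter_upwards [h4, h5, h1, h3] with ξ h6 h7 h8 h9
  rw [← h7, h6, h8, duhamelHat_congr h9, bilinearHat_congr h2 h2]

theorem MildEquation.isMildSolution {K : ℝ≥0∞} (hB : BilinearBound P p q ν α K)
    (hp : 1 ≤ p) (hq : 1 ≤ q) (hν : 0 < ν) {u₀ : 𝓢'(E3, C3)} {F u : ℝ → 𝓢'(E3, C3)}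
    {U₀ : E3 → C3} {G U : ℝ → E3 → C3}
    (h : MildEquation ν α Ω U₀ G U) (hU₀ : HasFourierDensity u₀ U₀)
    (hG : IsPath P s p q G)
    (hFG : ∀ᵐ t ∂timeMeasure, HasFourierDensity (F t) (G t))
    (hU : IsPath P (velReg α p) p q U)
    (huU : ∀ᵐ t ∂timeMeasure, HasFourierDensity (u t) (U t)) : IsMildSolution ν α Ω u₀ F u :=
  ⟨U₀, G, U, hU₀, ⟨hG.measurable.aestronglyMeasurable, hFG⟩,
    ⟨hU.measurable.aestronglyMeasurable, huU⟩,
    duhamelConverges P hp hν.le α Ω hG.measurable (hG.timeBlk_lt_top hq),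
    hB.converges Ω hU hU, h⟩

end Versions

/-! ### Picard iteration -/

section Picard

variable {P : DyadicPartition} {p q : ℝ≥0∞} {ν α Ω : ℝ} {K e : ℝ≥0∞}

/-- The Picard iterates for `U = A + B(U, U)`. -/
def picardIterate (ν α Ω : ℝ) (A : ℝ → E3 → C3) : ℕ → ℝ → E3 → C3
  | 0 => A
  | n + 1 => fun t ξ => A t ξ +
      bilinearHat ν α Ω (picardIterate ν α Ω A n) (picardIterate ν α Ω A n) t ξ

theorem isPath_picardIterate (hB : BilinearBound P p q ν α K) (hp : 1 ≤ p) (hq : 1 ≤ q)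
    {A : ℝ → E3 → C3} (hA : IsPath P (velReg α p) p q A) (hAe : tnorm P (velReg α p) p q A ≤ e)
    (hKe : K * (4 * e) ≤ 1) (n : ℕ) :
    IsPath P (velReg α p) p q (picardIterate ν α Ω A n) ∧
      tnorm P (velReg α p) p q (picardIterate ν α Ω A n) ≤ 2 * e := by
  induction n with
  | zero => exact ⟨hA, hAe.trans (by rw [two_mul]; exact le_self_add)⟩
  | succ n ih =>
    have hBp := hB.isPath Ω ih.1 ih.1
    refine ⟨hA.add hp hq hBp, (tnorm_add_le P hp hq hA.aesections hBp.aesections).trans ?_⟩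
    calc _ ≤ e + K * (2 * e) * (2 * e) := by
          refine add_le_add hAe ((hB.bound Ω ih.1 ih.1).trans ?_)
          gcongr
          · exact ih.2
          · exact ih.2
      -- The ball of radius `2e` is preserved because `e + K(2e)² ≤ 2e` when `4Ke ≤ 1`.
      _ = e + K * (4 * e) * e := by ring
      _ ≤ e + 1 * e := by gcongr
      _ = 2 * e := by ring

theorem tnorm_bilinearHat_self_sub_le (hB : BilinearBound P p q ν α K) {U V : ℝ → E3 → C3}
    (hU : IsPath P (velReg α p) p q U) (hV : IsPath P (velReg α p) p q V)
    (hUe : tnorm P (velReg α p) p q U ≤ 2 * e) (hVe : tnorm P (velReg α p) p q V ≤ 2 * e) :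
    tnorm P (velReg α p) p q (fun t ξ => bilinearHat ν α Ω U U t ξ - bilinearHat ν α Ω V V t ξ) ≤
      K * (4 * e) * tnorm P (velReg α p) p q (fun t ξ => U t ξ - V t ξ) := by
  refine (hB.bound_sub Ω hU hU hV hV).trans ?_
  set d := tnorm P (velReg α p) p q (fun t ξ => U t ξ - V t ξ)
  calc _ ≤ K * d * (2 * e) + K * (2 * e) * d := by gcongr
    _ = _ := by ring

theorem exists_fixedPoint (hB : BilinearBound P p q ν α K) (hp : 1 ≤ p) (hq : 1 ≤ q)
    {A : ℝ → E3 → C3} (hA : IsPath P (velReg α p) p q A) (hAe : tnorm P (velReg α p) p q A ≤ e)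
    (he : e ≠ ∞) (hKe : K * (4 * e) < 1) :
    ∃ V, IsPath P (velReg α p) p q V ∧ tnorm P (velReg α p) p q V ≤ 2 * e ∧
      ∀ᵐ t ∂timeMeasure, V t =ᵐ[volume] fun ξ => A t ξ + bilinearHat ν α Ω V V t ξ := by
  set s := velReg α p with hs
  set U := picardIterate ν α Ω A with hU
  have hUn := isPath_picardIterate (Ω := Ω) hB hp hq hA hAe hKe.le
  set d : ℕ → ℝ≥0∞ := fun n => tnorm P s p q (fun t ξ => U (n + 1) t ξ - U n t ξ) with hd
  have hd_succ : ∀ n, d (n + 1) ≤ K * (4 * e) * d n := by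
    intro n
    have h1 : (fun t ξ => U (n + 1 + 1) t ξ - U (n + 1) t ξ) = fun t ξ =>
        bilinearHat ν α Ω (U (n + 1)) (U (n + 1)) t ξ - bilinearHat ν α Ω (U n) (U n) t ξ := by
      ext1 t; ext1 ξ
      exact add_sub_add_left_eq_sub _ _ _
    show tnorm P s p q (fun t ξ => U (n + 1 + 1) t ξ - U (n + 1) t ξ) ≤ _
    rw [h1]
    exact tnorm_bilinearHat_self_sub_le hB (hUn (n + 1)).1 (hUn n).1 (hUn (n + 1)).2 (hUn n).2
  have hd_le : ∀ n, d n ≤ (K * (4 * e)) ^ n * d 0 := by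
    intro n
    induction n with
    | zero => simp
    | succ n ih =>
      refine (hd_succ n).trans ?_
      rw [pow_succ', mul_assoc (K * (4 * e))]
      gcongr
  have hd_sum : ∑' n, d n ≠ ∞ := by
    refine ((ENNReal.tsum_le_tsum hd_le).trans_lt ?_).ne
    rw [ENNReal.tsum_mul_right, ENNReal.tsum_geometric]
    refine ENNReal.mul_lt_top (ENNReal.inv_lt_top.2 (tsub_pos_of_lt hKe)) ?_
    exact ((hUn 1).1.sub hp hq (hUn 0).1).finite
  have hblk : ∀ᵐ t ∂timeMeasure, ∀ n j, blk P p j (fun ξ => U (n + 1) t ξ - U n t ξ) ≤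
      timeBlk P p (fun t ξ => U (n + 1) t ξ - U n t ξ) j :=
    ae_all_iff.2 fun n => ae_blk_le_timeBlk P p _
  obtain ⟨V, hVm, hV⟩ := exists_limit_of_tsum_blk P hp (fun n => (hUn n).1.measurable) (by
    filter_upwards [hblk] with t ht j
    refine (ENNReal.tsum_le_tsum fun n => (ht n j).trans
      (le_wsn' (s := s) hq (timeBlk P p fun t ξ => U (n + 1) t ξ - U n t ξ) j)).trans_lt ?_
    rw [ENNReal.tsum_mul_left]
    exact ENNReal.mul_lt_top (two_rpow_ne_top _).lt_top hd_sum.lt_top)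
  have hVs := measurable_section hVm
  -- Convergence holds in `tnorm` and not only at fixed times, since the telescoping bound is taken
  -- block by block before the `ℓ^q` norm.
  have htail : ∀ n, tnorm P s p q (fun t ξ => V t ξ - U n t ξ) ≤ ∑' m, d (m + n) := by
    intro n
    refine (tnorm_le P (a := fun j => ∑' m, timeBlk P p
      (fun t ξ => U (n + m + 1) t ξ - U (n + m) t ξ) j) ?_).trans ?_
    · filter_upwards [hV, hblk] with t h1 h2 j
      exact (h1 n j).trans (ENNReal.tsum_le_tsum fun m => h2 (n + m) j)
    · refine (wsn_tsum_le hq _).trans (ENNReal.tsum_le_tsum fun m => ?_)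
      rw [add_comm m n]
      exact le_rfl
  have htend : Tendsto (fun n => ∑' m, d (m + n)) atTop (𝓝 0) :=
    ENNReal.tendsto_sum_nat_add d hd_sum
  have hVae : ∀ᵐ t ∂timeMeasure, AEStronglyMeasurable (V t) volume :=
    Eventually.of_forall fun t => (hVs t).aestronglyMeasurable
  have hVe : tnorm P s p q V ≤ 2 * e := by
    have h1 : ∀ n, tnorm P s p q V ≤ (∑' m, d (m + n)) + 2 * e := by
      intro n
      calc tnorm P s p q V = tnorm P s p q (fun t ξ => (V t ξ - U n t ξ) + U n t ξ) := by
            simp only [sub_add_cancel]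
        _ ≤ _ := tnorm_add_le P hp hq (Eventually.of_forall fun t =>
            ((hVs t).sub ((hUn n).1.sections t)).aestronglyMeasurable) (hUn n).1.aesections
        _ ≤ _ := add_le_add (htail n) (hUn n).2
    have h2 := htend.add_const (2 * e)
    rw [zero_add] at h2
    exact ge_of_tendsto' h2 h1
  have hVp : IsPath P s p q V := by
    refine ⟨hVm, hVe.trans_lt (ENNReal.mul_lt_top (by norm_num) he.lt_top),
      SeparablyValued.of_approx hp hq (ι := ℕ) hVs (fun n => (hUn n).1.sections)
      (fun n => (hUn n).1.separable) ?_⟩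
    have h1 : ∀ᵐ t ∂timeMeasure, ∀ n, fnNorm P s p q (fun ξ => V t ξ - U n t ξ) ≤
        tnorm P s p q (fun t ξ => V t ξ - U n t ξ) :=
      ae_all_iff.2 fun n => ae_fnNorm_le_tnorm P _
    filter_upwards [h1] with t ht ε hε
    obtain ⟨n, hn⟩ := (htend.eventually_lt_const hε).exists
    exact ⟨n, (ht n).trans_lt ((htail n).trans_lt hn)⟩
  refine ⟨V, hVp, hVe, ?_⟩
  have hBV := hB.isPath Ω hVp hVp
  have hABV := hA.add hp hq hBV
  refine ae_eq_of_tnorm_sub_eq_zero P (s := s) hp hq hVp.aesections hABV.aesections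
    (le_antisymm ?_ zero_le)
  -- The residual of `V` is compared with the vanishing one of the scheme `U (n + 1) = A + B(U n, U
  -- n)`; both differences tend to zero.
  have h1 : ∀ n, tnorm P s p q (fun t ξ => V t ξ - (A t ξ + bilinearHat ν α Ω V V t ξ)) ≤
      (∑' m, d (m + (n + 1))) + ∑' m, d (m + n) := by
    intro n
    have h2 : (fun t ξ => V t ξ - (A t ξ + bilinearHat ν α Ω V V t ξ)) = fun t ξ =>
        (V t ξ - U (n + 1) t ξ) - (bilinearHat ν α Ω V V t ξ -
          bilinearHat ν α Ω (U n) (U n) t ξ) := by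
      ext1 t; ext1 ξ
      have : U (n + 1) t ξ = A t ξ + bilinearHat ν α Ω (U n) (U n) t ξ := rfl
      rw [this]
      abel
    rw [h2]
    refine (tnorm_sub_le P hp hq (hVp.sub hp hq (hUn (n + 1)).1).aesections
      (hBV.sub hp hq (hB.isPath Ω (hUn n).1 (hUn n).1)).aesections).trans
      (add_le_add (htail _) ?_)
    refine (tnorm_bilinearHat_self_sub_le hB hVp (hUn n).1 hVe (hUn n).2).trans ?_
    calc _ ≤ 1 * ∑' m, d (m + n) := by
          gcongr
          exact htail n
      _ = _ := one_mul _
  have h3 := (htend.comp (tendsto_add_atTop_nat 1)).add htend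
  rw [add_zero] at h3
  exact ge_of_tendsto' h3 h1

end Picard

/-! ### Existence and the difference inequality for the mild equation -/

section Dependence

variable {P : DyadicPartition} {p q : ℝ≥0∞} {ν α Ω : ℝ} {K e : ℝ≥0∞}

/-- The constant in the linear estimates. -/
def dataConst (ν α : ℝ) : ℝ≥0∞ := 18 + duhamelConst ν α

theorem dataConst_ne_top : dataConst ν α ≠ ∞ :=
  ENNReal.add_ne_top.2 ⟨by norm_num, duhamelConst_ne_top⟩

theorem data_bound (a b : ℝ≥0∞) :
    18 * a + duhamelConst ν α * b ≤ dataConst ν α * (a + b) := by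
  rw [dataConst, mul_add]
  gcongr
  · exact le_self_add
  · exact le_add_self

/-- Subtracting the two equations leaves linear terms in the differences of the data and a bilinear
difference that is a contraction on the ball. Uniqueness and continuous dependence both follow from
this inequality. -/
theorem MildEquation.tnorm_sub_le (hB : BilinearBound P p q ν α K) (hp : 1 ≤ p) (hq : 1 ≤ q)
    (hν : 0 < ν) (hα : 0 < α) {U₀ V₀ : E3 → C3} {G H U V : ℝ → E3 → C3} (hU₀ : Measurable U₀)
    (hV₀ : Measurable V₀) (hG : IsPath P (forceReg α p) p q G) (hH : IsPath P (forceReg α p) p q H)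
    (hU : IsPath P (velReg α p) p q U) (hV : IsPath P (velReg α p) p q V)
    (hUe : tnorm P (velReg α p) p q U ≤ 2 * e) (hVe : tnorm P (velReg α p) p q V ≤ 2 * e)
    (hmU : MildEquation ν α Ω U₀ G U) (hmV : MildEquation ν α Ω V₀ H V) :
    tnorm P (velReg α p) p q (fun t ξ => U t ξ - V t ξ) ≤
      dataConst ν α * (fnNorm P (velReg α p) p q (fun ξ => U₀ ξ - V₀ ξ) +
        tnorm P (forceReg α p) p q (fun t ξ => G t ξ - H t ξ)) +
      K * (4 * e) * tnorm P (velReg α p) p q (fun t ξ => U t ξ - V t ξ) := by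
  rw [← velReg_sub] at hG hH
  have hS := measurable_semigroup ν α Ω (hU₀.sub hV₀)
  have h1 : ∀ᵐ t ∂timeMeasure, (fun ξ => U t ξ - V t ξ) =ᵐ[volume] fun ξ =>
      (act (semigroupSymbol ν α Ω t ξ) ((U₀ - V₀) ξ) +
        (duhamelHat ν α Ω G t ξ - duhamelHat ν α Ω H t ξ)) +
      (bilinearHat ν α Ω U U t ξ - bilinearHat ν α Ω V V t ξ) := by
    filter_upwards [hmU, hmV] with t h2 h3
    filter_upwards [h2, h3] with ξ h4 h5
    rw [h4, h5, Pi.sub_apply, act_sub_right]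
    abel
  have hd := (hG.duhamelHat hp hq hν hα Ω).sub hp hq (hH.duhamelHat hp hq hν hα Ω)
  have hb := (hB.isPath Ω hU hU).sub hp hq (hB.isPath Ω hV hV)
  have hSs : ∀ᵐ t ∂timeMeasure, AEStronglyMeasurable
      (fun ξ => act (semigroupSymbol ν α Ω t ξ) ((U₀ - V₀) ξ)) volume :=
    Eventually.of_forall fun t => (measurable_section hS t).aestronglyMeasurable
  have hSd : ∀ᵐ t ∂timeMeasure, AEStronglyMeasurable
      (fun ξ => act (semigroupSymbol ν α Ω t ξ) ((U₀ - V₀) ξ) +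
        (duhamelHat ν α Ω G t ξ - duhamelHat ν α Ω H t ξ)) volume := by
    filter_upwards [hSs, hd.aesections] with t h2 h3 using h2.add h3
  calc _ = _ := tnorm_congr P h1
    _ ≤ _ := tnorm_add_le P hp hq hSd hb.aesections
    _ ≤ _ := add_le_add ((tnorm_add_le P hp hq hSs hd.aesections).trans ?_)
      (tnorm_bilinearHat_self_sub_le hB hU hV hUe hVe)
  refine le_trans (add_le_add (tnorm_semigroup_le P hν.le α Ω (hU₀.sub hV₀))
    (tnorm_duhamelHat_sub_le hp hq hν hα Ω hG hH)) ?_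
  rw [velReg_sub]
  exact data_bound _ _

/-- Absorption needs `x` finite, since for `x = ∞` and `θ > 0` the hypothesis carries no
information. -/
theorem le_of_le_add_mul {x a θ : ℝ≥0∞} (hx : x ≠ ∞) (hθ : θ < 1) (h : x ≤ a + θ * x) :
    x ≤ (1 - θ)⁻¹ * a := by
  have h1 : (1 - θ) * x ≤ a := by
    rw [ENNReal.sub_mul fun _ _ => hx, one_mul]
    exact tsub_le_iff_right.2 h
  have h0 : 1 - θ ≠ 0 := (tsub_pos_of_lt hθ).ne'
  have ht : 1 - θ ≠ ∞ := ne_top_of_le_ne_top ENNReal.one_ne_top tsub_le_self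
  calc x = (1 - θ)⁻¹ * ((1 - θ) * x) := by
        rw [← mul_assoc, ENNReal.inv_mul_cancel h0 ht, one_mul]
    _ ≤ _ := by gcongr

theorem exists_mildEquation (hB : BilinearBound P p q ν α K) (hp : 1 ≤ p) (hq : 1 ≤ q)
    (hν : 0 < ν) (hα : 0 < α) {U₀ : E3 → C3} {G : ℝ → E3 → C3} (hU₀ : Measurable U₀)
    (hfin : fnNorm P (velReg α p) p q U₀ < ∞) (hG : IsPath P (forceReg α p) p q G)
    (hsmall : dataConst ν α * (fnNorm P (velReg α p) p q U₀ + tnorm P (forceReg α p) p q G) ≤ e)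
    (he : e ≠ ∞) (hKe : K * (4 * e) < 1) :
    ∃ U, IsPath P (velReg α p) p q U ∧ tnorm P (velReg α p) p q U ≤ 2 * e ∧
      MildEquation ν α Ω U₀ G U := by
  rw [← velReg_sub] at hG hsmall
  have hS := isPath_semigroup (P := P) (p := p) (q := q) hν α Ω hU₀ hfin
  have hd := hG.duhamelHat hp hq hν hα Ω
  obtain ⟨V, hV, hVe, heq⟩ := exists_fixedPoint (Ω := Ω) (e := e) hB hp hq (hS.add hp hq hd)
    ((tnorm_add_le P hp hq hS.aesections hd.aesections).trans
      ((add_le_add (tnorm_semigroup_le P hν.le α Ω hU₀)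
      (tnorm_duhamelHat_le P hp hν hα.le Ω hG.measurable)).trans
      ((data_bound _ _).trans hsmall))) he hKe
  refine ⟨V, hV, hVe, heq.mono fun t ht => ht.trans (Eventually.of_forall fun ξ => ?_)⟩
  beta_reduce
  abel

end Dependence

end FNSC

end

/-! ### The main theorem -/

theorem theorem1 (P : FNSC.DyadicPartition) (p q : ℝ≥0∞) (hp : 1 < p) (hq : 1 ≤ q)
    (ν α : ℝ) (hν : 0 < ν) (hα : 1 / 2 < α) (hα' : α < (5 - FNSC.threeOver p) / 4) :
    ∃ K C : ℝ, 0 < K ∧ 0 < C ∧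
      -- `K` is a bound of the bilinear operator on `𝓧`, for all Coriolis parameters
      (∀ (Ω : ℝ) (v w : ℝ → 𝓢'(FNSC.E3, FNSC.C3)),
        FNSC.MemTime P (FNSC.velReg α p) p q v → FNSC.MemTime P (FNSC.velReg α p) p q w →
        ∃ b : ℝ → 𝓢'(FNSC.E3, FNSC.C3),
          FNSC.MemTime P (FNSC.velReg α p) p q b ∧ FNSC.IsBilinearTerm ν α Ω v w b ∧
          FNSC.timeNorm P (FNSC.velReg α p) p q b ≤
            ENNReal.ofReal K * FNSC.timeNorm P (FNSC.velReg α p) p q v *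
              FNSC.timeNorm P (FNSC.velReg α p) p q w) ∧
      ∀ ε : ℝ, 0 < ε → ε < 1 / (4 * K) → ∀ Ω : ℝ,
        -- existence, and uniqueness in the ball of radius `2ε`
        (∀ (u₀ : 𝓢'(FNSC.E3, FNSC.C3)) (F : ℝ → 𝓢'(FNSC.E3, FNSC.C3)),
          FNSC.MemTime P (FNSC.forceReg α p) p q F →
          ENNReal.ofReal C * (FNSC.fbNorm P (FNSC.velReg α p) p q u₀ +
            FNSC.timeNorm P (FNSC.forceReg α p) p q F) < ENNReal.ofReal ε →
          ∃ u : ℝ → 𝓢'(FNSC.E3, FNSC.C3),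
            FNSC.MemTime P (FNSC.velReg α p) p q u ∧
            FNSC.timeNorm P (FNSC.velReg α p) p q u ≤ ENNReal.ofReal (2 * ε) ∧
            FNSC.IsMildSolution ν α Ω u₀ F u ∧
            ∀ v : ℝ → 𝓢'(FNSC.E3, FNSC.C3),
              FNSC.MemTime P (FNSC.velReg α p) p q v →
              FNSC.timeNorm P (FNSC.velReg α p) p q v ≤ ENNReal.ofReal (2 * ε) →
              FNSC.IsMildSolution ν α Ω u₀ F v →
              ∀ᵐ t ∂FNSC.timeMeasure, v t = u t) ∧
        -- continuous dependence on the data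
        (∀ (u₀ v₀ : 𝓢'(FNSC.E3, FNSC.C3)) (F G u v : ℝ → 𝓢'(FNSC.E3, FNSC.C3)),
          FNSC.MemTime P (FNSC.forceReg α p) p q F →
          FNSC.MemTime P (FNSC.forceReg α p) p q G →
          ENNReal.ofReal C * (FNSC.fbNorm P (FNSC.velReg α p) p q u₀ +
            FNSC.timeNorm P (FNSC.forceReg α p) p q F) < ENNReal.ofReal ε →
          ENNReal.ofReal C * (FNSC.fbNorm P (FNSC.velReg α p) p q v₀ +
            FNSC.timeNorm P (FNSC.forceReg α p) p q G) < ENNReal.ofReal ε →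
          FNSC.MemTime P (FNSC.velReg α p) p q u →
          FNSC.timeNorm P (FNSC.velReg α p) p q u ≤ ENNReal.ofReal (2 * ε) →
          FNSC.IsMildSolution ν α Ω u₀ F u →
          FNSC.MemTime P (FNSC.velReg α p) p q v →
          FNSC.timeNorm P (FNSC.velReg α p) p q v ≤ ENNReal.ofReal (2 * ε) →
          FNSC.IsMildSolution ν α Ω v₀ G v →
          FNSC.timeNorm P (FNSC.velReg α p) p q (u - v) ≤
            ENNReal.ofReal (C / (1 - 4 * K * ε)) *
              (FNSC.fbNorm P (FNSC.velReg α p) p q (u₀ - v₀) +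
                FNSC.timeNorm P (FNSC.forceReg α p) p q (F - G))) := by
  have hp1 : 1 ≤ p := hp.le
  have hα0 : 0 < α := by linarith
  -- This number is `2α - 1`; its positivity lets functions of finite norm be realized as tempered
  -- distributions.
  have hs : 0 < 3 - FNSC.threeOver p - FNSC.velReg α p := by unfold FNSC.velReg; linarith
  obtain ⟨K₀, hK₀, hB₀⟩ := FNSC.exists_bilinearBound P hp1 hq hν hα hα'
  -- The added one only ensures `K > 0`.
  set K : ℝ := K₀.toReal + 1 with hK
  have hK0 : 0 < K := by positivity
  have hB : FNSC.BilinearBound P p q ν α (ENNReal.ofReal K) := by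
    refine hB₀.mono ?_
    rw [← ENNReal.ofReal_toReal hK₀]
    exact ENNReal.ofReal_le_ofReal (by linarith)
  set C : ℝ := (FNSC.dataConst ν α).toReal with hC
  have hCd : ENNReal.ofReal C = FNSC.dataConst ν α := ENNReal.ofReal_toReal FNSC.dataConst_ne_top
  have hC0 : 0 < C := by
    refine ENNReal.toReal_pos ?_ FNSC.dataConst_ne_top
    exact (lt_of_lt_of_le (by norm_num) (le_self_add : 18 ≤ FNSC.dataConst ν α)).ne'
  refine ⟨K, C, hK0, hC0, fun Ω v w hv hw => ?_, fun ε hε hεK Ω => ?_⟩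
  · obtain ⟨V, hV, hvV, hVn⟩ := hv.exists_isPath hp1 hq
    obtain ⟨W, hW, hwW, hWn⟩ := hw.exists_isPath hp1 hq
    have hBp := hB.isPath Ω hV hW
    obtain ⟨b, hb, hbB⟩ := FNSC.exists_memTime P hp1 hq hs hBp.measurable hBp.separable hBp.finite
    refine ⟨b, hb, ⟨V, W, _, ⟨hV.measurable.aestronglyMeasurable, hvV⟩,
      ⟨hW.measurable.aestronglyMeasurable, hwW⟩, ⟨hBp.measurable.aestronglyMeasurable, hbB⟩,
      hB.converges Ω hV hW, Eventually.of_forall fun t => Eventually.of_forall fun ξ => rfl⟩, ?_⟩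
    rw [FNSC.timeNorm_eq_tnorm P hbB, hVn, hWn]
    exact hB.bound Ω hV hW
  have h4 : K * (4 * ε) < 1 := by
    rw [lt_div_iff₀ (by positivity)] at hεK
    linarith
  have hKe : ENNReal.ofReal K * (4 * ENNReal.ofReal ε) = ENNReal.ofReal (K * (4 * ε)) := by
    rw [ENNReal.ofReal_mul hK0.le, ENNReal.ofReal_mul (by norm_num), ENNReal.ofReal_ofNat]
  have hKe1 : ENNReal.ofReal K * (4 * ENNReal.ofReal ε) < 1 := by
    rw [hKe]; exact ENNReal.ofReal_lt_one.2 h4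
  have h2e : ENNReal.ofReal (2 * ε) = 2 * ENNReal.ofReal ε := by
    rw [ENNReal.ofReal_mul (by norm_num), ENNReal.ofReal_ofNat]
  have hdata : ∀ {u₀ : 𝓢'(FNSC.E3, FNSC.C3)} {x : ℝ≥0∞},
      ENNReal.ofReal C * (FNSC.fbNorm P (FNSC.velReg α p) p q u₀ + x) < ENNReal.ofReal ε →
      ∃ U₀, Measurable U₀ ∧ FNSC.HasFourierDensity u₀ U₀ ∧
        FNSC.fbNorm P (FNSC.velReg α p) p q u₀ = FNSC.fnNorm P (FNSC.velReg α p) p q U₀ ∧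
        FNSC.fnNorm P (FNSC.velReg α p) p q U₀ < ∞ := by
    intro u₀ x h
    have h1 := ENNReal.lt_top_of_mul_ne_top_right (h.trans ENNReal.ofReal_lt_top).ne
      (ENNReal.ofReal_pos.2 hC0).ne'
    have h2 := (ENNReal.add_lt_top.1 h1).1
    obtain ⟨U₀, hU₀, hd⟩ := FNSC.exists_density_of_fbNorm_lt_top P hq h2
    have h3 := FNSC.fbNorm_eq P (FNSC.velReg α p) p q hd
    exact ⟨U₀, hU₀, hd, h3, h3 ▸ h2⟩
  have hdiff : ∀ {U₀ V₀ : FNSC.E3 → FNSC.C3} {G H U V : ℝ → FNSC.E3 → FNSC.C3}, Measurable U₀ →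
      Measurable V₀ → FNSC.IsPath P (FNSC.forceReg α p) p q G →
      FNSC.IsPath P (FNSC.forceReg α p) p q H → FNSC.IsPath P (FNSC.velReg α p) p q U →
      FNSC.IsPath P (FNSC.velReg α p) p q V →
      FNSC.tnorm P (FNSC.velReg α p) p q U ≤ ENNReal.ofReal (2 * ε) →
      FNSC.tnorm P (FNSC.velReg α p) p q V ≤ ENNReal.ofReal (2 * ε) →
      FNSC.MildEquation ν α Ω U₀ G U → FNSC.MildEquation ν α Ω V₀ H V →
      FNSC.tnorm P (FNSC.velReg α p) p q (fun t ξ => U t ξ - V t ξ) ≤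
        ENNReal.ofReal (C / (1 - 4 * K * ε)) *
          (FNSC.fnNorm P (FNSC.velReg α p) p q (fun ξ => U₀ ξ - V₀ ξ) +
            FNSC.tnorm P (FNSC.forceReg α p) p q (fun t ξ => G t ξ - H t ξ)) := by
    intro U₀ V₀ G H U V hU₀ hV₀ hG hH hU hV hUe hVe hmU hmV
    rw [h2e] at hUe hVe
    refine (FNSC.le_of_le_add_mul (hU.sub hp1 hq hV).finite.ne hKe1
      (hmU.tnorm_sub_le hB hp1 hq hν hα0 hU₀ hV₀ hG hH hU hV hUe hVe hmV)).trans (le_of_eq ?_)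
    have h5 : 0 < 1 - 4 * K * ε := by linarith
    rw [← mul_assoc, ← hCd, hKe, ← ENNReal.ofReal_one, ← ENNReal.ofReal_sub _ (by positivity),
      ← ENNReal.ofReal_inv_of_pos (by linarith), ← ENNReal.ofReal_mul (inv_nonneg.2 (by linarith))]
    congr 2
    rw [div_eq_inv_mul]
    congr 2
    ring
  refine ⟨fun u₀ F hF hsmall => ?_, fun u₀ v₀ F G u v hF hG hsu hsv hu hue hmu hv hve hmv => ?_⟩
  · obtain ⟨U₀, hU₀, hd₀, hn₀, hfin₀⟩ := hdata hsmall
    obtain ⟨G, hG, hFG, hGn⟩ := hF.exists_isPath hp1 hq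
    rw [hn₀, hGn, hCd] at hsmall
    obtain ⟨U, hU, hUe, hmU⟩ := FNSC.exists_mildEquation (Ω := Ω) hB hp1 hq hν hα0 hU₀ hfin₀ hG
      hsmall.le ENNReal.ofReal_ne_top hKe1
    rw [← h2e] at hUe
    obtain ⟨u, hu, huU⟩ := FNSC.exists_memTime P hp1 hq hs hU.measurable hU.separable hU.finite
    refine ⟨u, hu, ?_, hmU.isMildSolution hB hp1 hq hν hd₀ hG hFG hU huU, fun v hv hve hmv => ?_⟩
    · rwa [FNSC.timeNorm_eq_tnorm P huU]
    · obtain ⟨V, hV, hvV, hVn⟩ := hv.exists_isPath hp1 hq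
      rw [hVn] at hve
      -- With equal data the difference inequality has right-hand side zero; injectivity of the
      -- Fourier density then identifies the distributions.
      have h := hdiff hU₀ hU₀ hG hG hV hU hve hUe
        (hmv.mildEquation hd₀ hG.measurable hFG hvV) hmU
      simp only [sub_self, FNSC.fnNorm_zero, FNSC.tnorm_zero, add_zero, mul_zero] at h
      filter_upwards [FNSC.ae_eq_of_tnorm_sub_eq_zero P hp1 hq hV.aesections hU.aesections
        (le_antisymm h zero_le), hvV, huU] with t h1 h2 h3
      exact (h2.congr h1).injective h3
  · obtain ⟨U₀, hU₀, hdU₀, -, -⟩ := hdata hsu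
    obtain ⟨V₀, hV₀, hdV₀, -, -⟩ := hdata hsv
    obtain ⟨F', hF', hFF', -⟩ := hF.exists_isPath hp1 hq
    obtain ⟨G', hG', hGG', -⟩ := hG.exists_isPath hp1 hq
    obtain ⟨U, hU, huU, hUn⟩ := hu.exists_isPath hp1 hq
    obtain ⟨V, hV, hvV, hVn⟩ := hv.exists_isPath hp1 hq
    rw [hUn] at hue
    rw [hVn] at hve
    have e1 : FNSC.timeNorm P (FNSC.velReg α p) p q (u - v) =
        FNSC.tnorm P (FNSC.velReg α p) p q (fun t ξ => U t ξ - V t ξ) :=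
      FNSC.timeNorm_eq_tnorm P (by filter_upwards [huU, hvV] with t h1 h2 using h1.sub h2)
    have e2 : FNSC.timeNorm P (FNSC.forceReg α p) p q (F - G) =
        FNSC.tnorm P (FNSC.forceReg α p) p q (fun t ξ => F' t ξ - G' t ξ) :=
      FNSC.timeNorm_eq_tnorm P (by filter_upwards [hFF', hGG'] with t h1 h2 using h1.sub h2)
    rw [e1, e2, FNSC.fbNorm_eq P _ p q (hdU₀.sub hdV₀)]
    exact hdiff hU₀ hV₀ hF' hG' hU hV hue hve (hmu.mildEquation hdU₀ hF'.measurable hFF' huU)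
      (hmv.mildEquation hdV₀ hG'.measurable hGG' hvV)
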